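/- **Setting.** Let $\omega\in\mathbb C$ with $\Im\omega>0$, let $\Gamma=\pi\mathbb Z+\pi\omega\mathbb Z$, and let $$\theta(z)=-i\sum_{k\in\mathbb Z}(-1)^k e^{i\pi\omega(k+\frac12)^2}e^{2i(k+\frac12)z}.$$ Let $N\ge 1$, let $x,y\in\{0,1\}$ with $(x,y)\neq(0,0)$ if $N$ is even, let $\xi_1,\dots,\xi_N\in\mathbb C$, and let $\eta\in\mathbb C$ be generic, i.e. $n\eta\notin\Gamma$ for every nonzero integer $n$. Put $t_0=-\frac{\eta}{2}N+x\frac{\pi}{2}+y\frac{\pi}{2}\omega$. The dynamical $R$-matrix, in the basis $(++,+-,-+,--)$ of $\mathbb C^2\otimes\mathbb C^2$, is $$R(\lambda|t)=\begin{pmatrix}a(\lambda)&0&0&0\\0&e^{iy\eta}b(\lambda|t)&e^{iy\lambda}c(\lambda|t)&0\\0&e^{-iy\lambda}c(\lambda|-t)&e^{-iy\eta}b(\lambda|-t)&0\\0&0&0&a(\lambda)\end{pmatrix},$$ $$a(\lambda)=\theta(\lambda+\eta),\quad b(\lambda|t)=\frac{\theta(\lambda)\theta(t+\eta)}{\theta(t)},\quad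 c(\lambda|t)=\frac{\theta(\eta)\theta(t+\lambda)}{\theta(t)},$$ and the monodromy matrix is $$R_{0,N}\Big(\lambda-\xi_N\Big|t+\eta\sum_{a=1}^{N-1}\sigma_a^z\Big)\cdots R_{0,1}(\lambda-\xi_1|t)=\begin{pmatrix}A(\lambda|t)&B(\lambda|t)\\C(\lambda|t)&D(\lambda|t)\end{pmatrix}_{[0]}.$$ On $(\mathbb C^2)^{\otimes N}\otimes\mathbb D$, where $\mathbb D$ has basis $|t(a)\rangle$, $a\in\mathbb Z$, let $\tau|t(a)\rangle=(t_0-\eta a)|t(a)\rangle$ and $\mathsf T_\tau^{\pm}|t(a)\rangle=|t(a\pm1)\rangle$. Let $S=\sum_n\sigma_n^z$, $\mathcal B(\lambda)=B(\lambda|\tau)\mathsf T_\tau^-$ and $\mathcal C(\lambda)=C(\lambda|\tau)\mathsf T_\tau^+$. For $\kappa\in\mathbb C\setminus\{0\}$ the ($\kappa$-twisted) antiperiodic transfer matrix is $\overline{\mathcal T}^{(\kappa)}(\lambda)=\kappa^{-1}\mathcal B(\lambda)+\kappa\,\mathcal C(\lambda)$; the antiperiodic transfer matrix is the case $\kappa=1$.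 Let $\Sigma_{\overline{\mathcal T}}$ be the set of its eigenvalue functions on the eigenspace of $\eta S+2\tau$ for the eigenvalue $x\pi+y\pi\omega$, i.e. the set of functions $\bar t:\mathbb C\to\mathbb C$ for which some nonzero vector $v$ of that eigenspace satisfies $\overline{\mathcal T}^{(\kappa)}(\lambda)v=\bar t(\lambda)v$ for all $\lambda\in\mathbb C$. Put $\mathsf a(\lambda)=\prod_{n=1}^N\theta(\lambda-\xi_n+\eta)$, $\mathsf d(\lambda)=\mathsf a(\lambda-\eta)$ and $\mathsf a_{x,y}(\lambda)=(-1)^{x+y+xy}\mathsf a(\lambda)$. Assume $$\text{(cond-inh)}\qquad \xi_a-\xi_b+\epsilon\eta\notin\Gamma\quad\text{for all }a\ne b,\ \epsilon\in\{-1,0,1\},$$ and let $\mu\in\mathbb C$ be fixed such that $\mu-\xi_j$, $\mu-\eta-\xi_j$, $\mu-t_0-\xi_j$ and $\mu+\eta-t_0-\xi_j$ are not in $\Gamma$ for any $j$. For $\beta\in\mathbb C\setminus\{0\}$ let $$f_\mu^{(\beta)}(\lambda)=\beta^{-1}e^{-iy\lambda}\frac{\theta(\lambda-\mu)}{\theta(\lambda-\mu+t_0)}.$$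 For $Q(\lambda)=\prod_{j=1}^N\theta(\lambda-\lambda_j)$ with $\lambda_1,\dots,\lambda_N\in\mathbb C$ and $X=\sum_j\lambda_j-\sum_k\xi_k+N\eta$ such that $t_0+X\notin\Gamma$, let $$F_{\mu,Q}^{(\beta)}(\lambda)=\frac{\beta^{-1}(-1)^{x+y+xy}e^{-iy\lambda}\theta(t_0)}{\theta(t_0+X)}\,\frac{Q(\mu-\eta-t_0)}{\mathsf d(\mu-t_0)}\,\frac{\theta(\lambda-\mu-X)}{\theta(\lambda-\mu+t_0)}+\frac{\beta e^{iy(\lambda+\eta)}\theta(t_0)}{\theta(y\pi\omega-t_0-X)}\,\frac{Q(\mu)}{\mathsf a(\mu-\eta)}\,\frac{\theta(\lambda-\mu+\eta+y\pi\omega-t_0-X)}{\theta(\lambda-\mu+\eta)}.$$ For a function $\bar t$ on $\mathbb C$ and $\beta\neq0$, let $\mathcal P_\beta(\bar t)$ be the statement: there are $\lambda_1,\dots,\lambda_N\in\mathbb C$ such that $Q(\lambda)=\prod_{j=1}^N\theta(\lambda-\lambda_j)$ satisfies $t_0+X\notin\Gamma$, $(Q(\xi_j),Q(\xi_j-\eta))\neq(0,0)$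 for $1\le j\le N$, and the inhomogeneous $T$-$Q$ equation $$\bar t(\lambda)Q(\lambda)=f_\mu^{(\beta)}(\lambda)\,\mathsf a_{x,y}(\lambda)\,Q(\lambda-\eta)+\frac{\mathsf d(\lambda)}{f_\mu^{(\beta)}(\lambda+\eta)}\,Q(\lambda+\eta)-\mathsf a(\lambda)\,\mathsf d(\lambda)\,F_{\mu,Q}^{(\beta)}(\lambda)$$ as an identity of functions of $\lambda$ away from the poles of its coefficients (contained in the zero set of $\theta(\lambda-\mu+t_0)\,\theta(\lambda-\mu+\eta)$). **Theorem.** For every $\kappa\in\mathbb C\setminus\{0\}$ and every function $\bar t:\mathbb C\to\mathbb C$, the following are equivalent: 1. $\bar t\in\Sigma_{\overline{\mathcal T}}$; 2. $\bar t$ is entire and $\mathcal P_\beta(\bar t)$ holds for some $\beta\in\mathbb C\setminus\{0\}$. If $\eta\notin\mathbb R$, these are also equivalent to 3. $\bar t$ is entire and $\mathcal P_\beta(\bar t)$ holds for every $\beta\in\mathbb C\setminus\{0\}$. -/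

import Mathlib

namespace SOS

noncomputable section

/-- The theta function `θ₁(z|ω)` with quasi-periods `π` and `πω`. -/
def theta (ω z : ℂ) : ℂ :=
  -Complex.I * ∑' k : ℤ, (-1 : ℂ) ^ k *
    Complex.exp (Complex.I * Real.pi * ω * ((k : ℂ) + 1 / 2) ^ 2) *
    Complex.exp (2 * Complex.I * ((k : ℂ) + 1 / 2) * z)

/-- The lattice `Γ = πℤ + πωℤ`. -/
def lattice (ω : ℂ) : Set ℂ :=
  {z | ∃ m n : ℤ, z = Real.pi * m + Real.pi * ω * n}

/-- The parameters of the chain: elliptic modulus `ω`, crossing parameter `η`, the two integers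
`x, y` that fix the dynamical parameter, and the inhomogeneities `ξ`. -/
structure Params (N : ℕ) where
  ω : ℂ
  η : ℂ
  x : ℕ
  y : ℕ
  ξ : Fin N → ℂ

/-- The standing assumptions: `Im ω > 0`; `x, y ∈ {0,1}`, not both zero when `N` is even; and `η`
is generic, i.e. no nonzero integer multiple of `η` lies in the lattice `Γ`
(equivalently `η ∉ πℚ + πωℚ`). -/
structure Params.Admissible {N : ℕ} (P : Params N) : Prop where
  im_pos : 0 < P.ω.im
  x_le : P.x ≤ 1
  y_le : P.y ≤ 1
  xy_ne : Even N → ¬ (P.x = 0 ∧ P.y = 0)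
  generic : ∀ n : ℤ, n ≠ 0 → (n : ℂ) * P.η ∉ lattice P.ω

namespace Params

variable {N : ℕ} (P : Params N)

/-- The theta function attached to the parameters. -/
def th (z : ℂ) : ℂ := theta P.ω z

/-- The Boltzmann weights `a(u)`, `b(u|t)`, `c(u|t)`. -/
def wa (u : ℂ) : ℂ := P.th (u + P.η)

def wb (u t : ℂ) : ℂ := P.th u * P.th (t + P.η) / P.th t

def wc (u t : ℂ) : ℂ := P.th P.η * P.th (t + u) / P.th t

/-- The dynamical `R`-matrix `R(u|t)` in the basis `(++, +-, -+, --)`; the index `0` stands for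
spin `+` and the index `1` for spin `-`. The first pair is the row, the second the column. -/
def R (u t : ℂ) : Matrix (Fin 2 × Fin 2) (Fin 2 × Fin 2) ℂ :=
  Matrix.of fun p q =>
    match p, q with
    | (0, 0), (0, 0) => P.wa u
    | (0, 1), (0, 1) => Complex.exp (Complex.I * P.y * P.η) * P.wb u t
    | (0, 1), (1, 0) => Complex.exp (Complex.I * P.y * u) * P.wc u t
    | (1, 0), (0, 1) => Complex.exp (-(Complex.I * P.y * u)) * P.wc u (-t)
    | (1, 0), (1, 0) => Complex.exp (-(Complex.I * P.y * P.η)) * P.wb u (-t)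
    | (1, 1), (1, 1) => P.wa u
    | _, _ => 0

/-- The eigenvalue of `σᶻ` on the basis vector with label `h`: `+1` for `0` and `-1` for `1`. -/
def spin (h : Fin 2) : ℂ := 1 - 2 * ((h : ℕ) : ℂ)

/-- The operator `R_{0,n}(u - ξ_n | t + η ∑_{a<n} σ_aᶻ)` on the tensor product of the auxiliary
space (first index) and of the `N` quantum spaces. -/
def siteR (u t : ℂ) (n : Fin N) :
    Matrix (Fin 2 × (Fin N → Fin 2)) (Fin 2 × (Fin N → Fin 2)) ℂ :=
  Matrix.of fun p q =>
    if ∀ m, m ≠ n → p.2 m = q.2 m then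
      P.R (u - P.ξ n) (t + P.η * ∑ a ∈ Finset.Iio n, spin (q.2 a)) (p.1, p.2 n) (q.1, q.2 n)
    else 0

/-- The monodromy matrix, the ordered product with the factor of the last site on the left and
that of the first site on the right. -/
def monodromy (u t : ℂ) :
    Matrix (Fin 2 × (Fin N → Fin 2)) (Fin 2 × (Fin N → Fin 2)) ℂ :=
  ((List.ofFn fun n : Fin N => P.siteR u t n).reverse).prod

/-- The entries `B(u|t)` (row `+`, column `-`) and `C(u|t)` (row `-`, column `+`) of the monodromy
matrix, as operators on the quantum space. -/
def monB (u t : ℂ) : Matrix (Fin N → Fin 2) (Fin N → Fin 2) ℂ :=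
  Matrix.of fun h k => P.monodromy u t (0, h) (1, k)

def monC (u t : ℂ) : Matrix (Fin N → Fin 2) (Fin N → Fin 2) ℂ :=
  Matrix.of fun h k => P.monodromy u t (1, h) (0, k)

/-- `t_{0,𝟎} = -(η/2) N + x π/2 + y πω/2`. -/
def t₀ : ℂ :=
  -(P.η / 2) * N + P.x * (Real.pi / 2) + P.y * (Real.pi / 2) * P.ω

/-- The eigenvalue `t(a) = t₀ - η a` of the dynamical operator `τ` on `|t(a)⟩`. -/
def height (a : ℤ) : ℂ := -P.η * a + P.t₀

end Params

/-- The representation space `(ℂ²)^{⊗N} ⊗ 𝔻`; the basis vector with index `(h, a)` is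
`(⊗ₙ |n, hₙ⟩) ⊗ |t(a)⟩`. -/
abbrev StateSpace (N : ℕ) : Type := ((Fin N → Fin 2) × ℤ) →₀ ℂ

/-- The shift operators: `shift 1 = T_τ⁺` maps `|t(a)⟩` to `|t(a+1)⟩`, and `shift (-1) = T_τ⁻`
is its inverse. -/
def shift {N : ℕ} (e : ℤ) : StateSpace N →ₗ[ℂ] StateSpace N :=
  Finsupp.linearCombination ℂ fun p => Finsupp.single (p.1, p.2 + e) 1

/-- The total spin operator `S = ∑ₙ σₙᶻ`. -/
def totalSpin {N : ℕ} : StateSpace N →ₗ[ℂ] StateSpace N :=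
  Finsupp.linearCombination ℂ fun p => Finsupp.single p (∑ n, Params.spin (p.1 n))

namespace Params

variable {N : ℕ} (P : Params N)

/-- The dynamical operator `τ`. -/
def tau : StateSpace N →ₗ[ℂ] StateSpace N :=
  Finsupp.linearCombination ℂ fun p => Finsupp.single p (P.height p.2)

/-- The operator `M(τ)` obtained from a family `M(t)` of operators on the quantum space by
substituting the operator `τ` (which commutes with the spins) for `t`. -/
def atTau (M : ℂ → Matrix (Fin N → Fin 2) (Fin N → Fin 2) ℂ) :
    StateSpace N →ₗ[ℂ] StateSpace N :=
  Finsupp.linearCombination ℂ fun p =>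
    ∑ h : Fin N → Fin 2, Finsupp.single (h, p.2) (M (P.height p.2) h p.1)

/-- `𝓑(u) = B(u|τ) T_τ⁻`. -/
def calB (u : ℂ) : StateSpace N →ₗ[ℂ] StateSpace N := P.atTau (P.monB u) ∘ₗ shift (-1)

/-- `𝓒(u) = C(u|τ) T_τ⁺`. -/
def calC (u : ℂ) : StateSpace N →ₗ[ℂ] StateSpace N := P.atTau (P.monC u) ∘ₗ shift 1

/-- The `κ`-twisted antiperiodic transfer matrix `κ⁻¹ 𝓑(u) + κ 𝓒(u)`. -/
def transfer (κ u : ℂ) : StateSpace N →ₗ[ℂ] StateSpace N :=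
  κ⁻¹ • P.calB u + κ • P.calC u

/-- The space of states of the antiperiodic model: the eigenspace of `S_τ = η S + 2τ` for the
eigenvalue `xπ + yπω`. -/
def physicalSpace : Submodule ℂ (StateSpace N) :=
  Module.End.eigenspace (P.η • totalSpin + (2 : ℂ) • P.tau : StateSpace N →ₗ[ℂ] StateSpace N)
    (P.x * Real.pi + P.y * Real.pi * P.ω)

/-- The set of eigenvalue functions of the transfer matrix on the space of states. -/
def spectrumT (κ : ℂ) : Set (ℂ → ℂ) :=
  {t | ∃ v ∈ P.physicalSpace, v ≠ 0 ∧ ∀ u, P.transfer κ u v = t u • v}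

/-- The condition on the inhomogeneities: `ξ_a - ξ_b + ε η ∉ Γ` for `ε ∈ {-1,0,1}`, `a ≠ b`. -/
def CondInh : Prop :=
  ∀ a b, a ≠ b → ∀ ε : ℤ, ε = -1 ∨ ε = 0 ∨ ε = 1 →
    P.ξ a - P.ξ b + ε * P.η ∉ lattice P.ω

/-- The condition on the gauge parameter `μ`. -/
def CondMu (μ : ℂ) : Prop :=
  ∀ j, μ - P.ξ j ∉ lattice P.ω ∧ μ - P.η - P.ξ j ∉ lattice P.ω ∧
    μ - P.t₀ - P.ξ j ∉ lattice P.ω ∧ μ + P.η - P.t₀ - P.ξ j ∉ lattice P.ω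

/-- `a(u) = ∏ₙ a(u - ξₙ)`, `d(u) = a(u - η)` and `a_{x,y}(u) = (-1)^{x+y+xy} a(u)`. -/
def bigA (u : ℂ) : ℂ := ∏ n, P.wa (u - P.ξ n)

def bigD (u : ℂ) : ℂ := P.bigA (u - P.η)

def bigAxy (u : ℂ) : ℂ := (-1) ^ (P.x + P.y + P.x * P.y) * P.bigA u

/-- The elliptic polynomial `Q(u) = ∏ⱼ θ(u - λⱼ)` of order `N` with roots `λⱼ = r j`. -/
def Q (r : Fin N → ℂ) (u : ℂ) : ℂ := ∏ j, P.th (u - r j)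

/-- The gauge function `f_μ^{(β)}`. -/
def f (μ β u : ℂ) : ℂ :=
  β⁻¹ * Complex.exp (-(Complex.I * P.y * u)) * P.th (u - μ) / P.th (u - μ + P.t₀)

/-- `α_Q - ∑ₖ ξₖ + N η`, where `α_Q = ∑ⱼ λⱼ` is the norm of `Q`. -/
def X (r : Fin N → ℂ) : ℂ := ∑ j, r j - ∑ k, P.ξ k + N * P.η

/-- The function `F_{μ,Q}^{(β)}` of the inhomogeneous term. -/
def F (μ β : ℂ) (r : Fin N → ℂ) (u : ℂ) : ℂ :=
  β⁻¹ * (-1) ^ (P.x + P.y + P.x * P.y) * Complex.exp (-(Complex.I * P.y * u)) * P.th P.t₀ /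
        P.th (P.t₀ + P.X r) *
      (P.Q r (μ - P.η - P.t₀) / P.bigD (μ - P.t₀)) *
      (P.th (u - μ - P.X r) / P.th (u - μ + P.t₀)) +
    β * Complex.exp (Complex.I * P.y * (u + P.η)) * P.th P.t₀ /
        P.th (P.y * Real.pi * P.ω - P.t₀ - P.X r) *
      (P.Q r μ / P.bigA (μ - P.η)) *
      (P.th (u - μ + P.η + P.y * Real.pi * P.ω - P.t₀ - P.X r) / P.th (u - μ + P.η))

/-- The functions `t` and `Q` (with roots `r`) solve the inhomogeneous functional `T`-`Q` equation.
The first two conditions say that the constant denominators in `F` do not vanish. The equation is an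
identity of meromorphic functions of `u`: it is required off the poles of `f(u)`, `1/f(u+η)` and
`F(u)`, which lie at the zeros of `θ(u - μ + t₀)` and `θ(u - μ + η)`. At a zero of `1/f(u+η)`, i.e.
a pole of `f(u+η)`, the convention `x/0 = 0` gives the quotient `d(u)/f(u+η)` its correct value. -/
def SolvesTQ (μ β : ℂ) (t : ℂ → ℂ) (r : Fin N → ℂ) : Prop :=
  P.th (P.t₀ + P.X r) ≠ 0 ∧ P.th (P.y * Real.pi * P.ω - P.t₀ - P.X r) ≠ 0 ∧
  ∀ u, P.th (u - μ + P.t₀) ≠ 0 → P.th (u - μ + P.η) ≠ 0 →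
    t u * P.Q r u =
      P.f μ β u * P.bigAxy u * P.Q r (u - P.η) +
        P.bigD u / P.f μ β (u + P.η) * P.Q r (u + P.η) -
        P.bigA u * P.bigD u * P.F μ β r u

/-- There is `Q` of order `N` with `(Q(ξⱼ), Q(ξⱼ - η)) ≠ (0,0)` for all `j` that solves the
inhomogeneous `T`-`Q` equation with `t`. -/
def HasQ (μ β : ℂ) (t : ℂ → ℂ) : Prop :=
  ∃ r : Fin N → ℂ,
    (∀ j, ¬ (P.Q r (P.ξ j) = 0 ∧ P.Q r (P.ξ j - P.η) = 0)) ∧ P.SolvesTQ μ β t r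

end Params

end

end SOS

/-! Both the spectrum and the T-Q equation reduce to the same finite system: conditions on an
elliptic polynomial t of order N at the points ξ_j and ξ_j - η.

Spectrum. On the given eigenspace the dynamical variable is determined by the number of down spins,
and a diagonal conjugation by powers of κ removes the twist. What remains is a matrix T(u) = `tmat
u` of size 2^N whose entries are elliptic polynomials of order N in u with common quasi-periods.
Weierstrass's three-term identity gives the dynamical Yang-Baxter relation, hence commutation of the
T(ξ_j) (`tm_comm`). The quantum determinant gives T(ξ_j) T(ξ_j - η) = a_{x,y}(ξ_j) d(ξ_j - η)
(`tm_fusion`). So every eigenvalue is `Fused`. Conversely, the covectors ⟨0| ∏ T(ξ_j)^{S_j} form a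
basis (`eq_zero_of_ordProd_tm`), and a `Fused` t defines a vector w by the coordinates ∏
t(ξ_j)^{S_j}. Each coordinate of T(u) w - t(u) w is an elliptic polynomial of order N with N known
zeros of non-exceptional sum, hence zero (`exists_eigenvector_iff`).

T-Q equation. Cleared of denominators, its two sides are elliptic polynomials of order 2N+2 with the
same quasi-periods, so it suffices to test it at 2N+2 points. The constants in F make it automatic
at μ - t₀ and μ - η. At ξ_j it reads Q(ξ_j - η) = β g_j Q(ξ_j), and at ξ_j - η it is then equivalent
to the fusion relation for t whenever Q(ξ_j) ≠ 0 (`fused_of_hasQ`, `solvesTQ_of_roots`).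

Existence of Q. The N equations Q(ξ_j - η) = β g_j Q(ξ_j) in N roots are solved at β = 0 by λ_j =
ξ_j - η with invertible Jacobian, so they are solvable for all small β (`eventually_roots`). Moving
one root by ∓πω multiplies β by exp(±2iη); for non-real η this reaches every β (`exists_roots`). -/

namespace SOS

open Complex Filter Topology

/-! ### Theta function: quasi-periods, parity, non-vanishing. -/

section Theta

variable {ω : ℂ}

lemma theta_eq_jacobiTheta (ω z : ℂ) :
    theta ω z = -I * exp (I * Real.pi * ω / 4 + I * z) *
      jacobiTheta₂ (z / Real.pi + ω / 2 + 1 / 2) ω := by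
  have hpi : (Real.pi : ℂ) ≠ 0 := by exact_mod_cast Real.pi_ne_zero
  rw [theta, jacobiTheta₂, mul_assoc (-I), ← tsum_mul_left (a := exp _)]
  congr 1
  refine tsum_congr fun k => ?_
  rw [jacobiTheta₂_term, ← exp_pi_mul_I, ← exp_int_mul, ← exp_add, ← exp_add, ← exp_add]
  congr 1
  field_simp
  ring

lemma theta_add_pi (ω z : ℂ) : theta ω (z + Real.pi) = -theta ω z := by
  have hpi : (Real.pi : ℂ) ≠ 0 := by exact_mod_cast Real.pi_ne_zero
  rw [theta_eq_jacobiTheta, theta_eq_jacobiTheta,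
    show (z + Real.pi) / Real.pi + ω / 2 + 1 / 2 = (z / Real.pi + ω / 2 + 1 / 2) + 1 by
      field_simp; ring, jacobiTheta₂_add_left,
    show I * Real.pi * ω / 4 + I * (z + Real.pi) = (I * Real.pi * ω / 4 + I * z) + Real.pi * I by
      ring, exp_add, exp_pi_mul_I]
  ring

lemma theta_add_pi_mul (ω z : ℂ) :
    theta ω (z + Real.pi * ω) = -exp (-(I * Real.pi * ω) - 2 * I * z) * theta ω z := by
  have hpi : (Real.pi : ℂ) ≠ 0 := by exact_mod_cast Real.pi_ne_zero
  rw [theta_eq_jacobiTheta, theta_eq_jacobiTheta,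
    show (z + Real.pi * ω) / Real.pi + ω / 2 + 1 / 2 = (z / Real.pi + ω / 2 + 1 / 2) + ω by
      field_simp; ring, jacobiTheta₂_add_left',
    show I * Real.pi * ω / 4 + I * (z + Real.pi * ω) =
      (I * Real.pi * ω / 4 + I * z) + I * (Real.pi * ω) by ring, exp_add,
    show -Real.pi * I * (ω + 2 * (z / Real.pi + ω / 2 + 1 / 2)) =
      (-(I * Real.pi * ω) - 2 * I * z) + -(I * (Real.pi * ω)) + -(Real.pi * I) by
      field_simp; ring, exp_add _ (-(Real.pi * I)), exp_add _ (-(I * (Real.pi * ω))),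
    exp_neg (Real.pi * I), exp_pi_mul_I, exp_neg (I * (Real.pi * ω))]
  have := exp_ne_zero (I * (Real.pi * ω))
  field_simp

lemma theta_neg (ω z : ℂ) : theta ω (-z) = -theta ω z := by
  have hpi : (Real.pi : ℂ) ≠ 0 := by exact_mod_cast Real.pi_ne_zero
  rw [theta_eq_jacobiTheta, theta_eq_jacobiTheta, ← jacobiTheta₂_neg_left,
    show -(-z / Real.pi + ω / 2 + 1 / 2) = (z / Real.pi - ω / 2 - 1 / 2) by ring,
    show z / Real.pi + ω / 2 + 1 / 2 = ((z / Real.pi - ω / 2 - 1 / 2) + 1) + ω by ring,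
    jacobiTheta₂_add_left', jacobiTheta₂_add_left,
    show -Real.pi * I * (ω + 2 * (z / Real.pi - ω / 2 - 1 / 2 + 1)) =
      -(2 * (I * z)) - (Real.pi * I) by field_simp; ring,
    exp_sub _ (Real.pi * I), exp_pi_mul_I, exp_add, exp_add,
    show I * (-z) = -(I * z) by ring, exp_neg, exp_neg (2 * (I * z)), two_mul, exp_add]
  have := exp_ne_zero (I * z)
  field_simp

lemma theta_zero (ω : ℂ) : theta ω 0 = 0 := by
  have := theta_neg ω 0
  rw [neg_zero] at this
  exact self_eq_neg.mp this

lemma differentiable_theta (hω : 0 < ω.im) : Differentiable ℂ (theta ω) := by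
  have : theta ω = fun z => -I * exp (I * Real.pi * ω / 4 + I * z) *
      jacobiTheta₂ (z / Real.pi + ω / 2 + 1 / 2) ω := funext (theta_eq_jacobiTheta ω)
  rw [this]
  intro z
  have h1 := (differentiableAt_jacobiTheta₂_fst (z / Real.pi + ω / 2 + 1 / 2) hω)
  have h2 : DifferentiableAt ℂ (fun z : ℂ => z / Real.pi + ω / 2 + 1 / 2) z := by fun_prop
  have h3 : DifferentiableAt ℂ (fun z : ℂ => jacobiTheta₂ (z / Real.pi + ω / 2 + 1 / 2) ω) z :=
    DifferentiableAt.comp (g := fun w => jacobiTheta₂ w ω) z h1 h2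
  exact (by fun_prop : DifferentiableAt ℂ
    (fun z : ℂ => -I * exp (I * Real.pi * ω / 4 + I * z)) z).mul h3

/-- Some Fourier coefficient of the theta function does not vanish. -/
lemma exists_theta_ne_zero (hω : 0 < ω.im) : ∃ z, theta ω z ≠ 0 := by
  by_contra! h
  have hJ : ∀ x : ℂ, jacobiTheta₂ x ω = 0 := by
    intro x
    have hpi : (Real.pi : ℂ) ≠ 0 := by exact_mod_cast Real.pi_ne_zero
    have := h (Real.pi * (x - ω / 2 - 1 / 2))
    rw [theta_eq_jacobiTheta, show Real.pi * (x - ω / 2 - 1 / 2) / Real.pi + ω / 2 + 1 / 2 = x by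
      field_simp; ring] at this
    simpa [exp_ne_zero] using this
  have hterm : ∀ (n : ℤ) (x : ℝ), jacobiTheta₂_term n x ω =
      exp (2 * Real.pi * I * n * x) * exp (Real.pi * I * n ^ 2 * ω) := by
    intro n x
    rw [jacobiTheta₂_term, exp_add]
  -- Integration over a real period extracts the zeroth Fourier coefficient, which is 1, so the
  -- series cannot vanish identically.
  have hint : ∀ n : ℤ, ∫ x in (0 : ℝ)..1, jacobiTheta₂_term n x ω = if n = 0 then 1 else 0 := by
    intro n
    simp_rw [hterm]
    rw [intervalIntegral.integral_mul_const]
    split_ifs with hn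
    · subst hn; simp
    · have hc : 2 * Real.pi * I * n ≠ 0 := by
        have hpi : (Real.pi : ℂ) ≠ 0 := by exact_mod_cast Real.pi_ne_zero
        have : (n : ℂ) ≠ 0 := by exact_mod_cast hn
        simp [hpi, this]
      rw [integral_exp_mul_complex hc]
      have : exp (2 * Real.pi * I * n) = 1 := by
        rw [show 2 * Real.pi * I * n = n * (2 * Real.pi * I) by ring]
        exact exp_int_mul_two_pi_mul_I n
      simp [this]
  have hsum := intervalIntegral.hasSum_intervalIntegral_of_summable_norm (a := 0) (b := 1)
    (f := fun n : ℤ => (⟨fun x : ℝ => jacobiTheta₂_term n x ω, by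
      unfold jacobiTheta₂_term; fun_prop⟩ : C(ℝ, ℂ))) (by
      refine Summable.of_nonneg_of_le (fun _ => norm_nonneg _) (fun n => ?_)
        ((summable_jacobiTheta₂_term_iff 0 ω).mpr hω).norm
      refine (ContinuousMap.norm_le _ (norm_nonneg _)).mpr fun x => ?_
      simp [norm_jacobiTheta₂_term])
  have h0 := hsum.tsum_eq
  simp only [ContinuousMap.coe_mk] at h0
  simp_rw [hint] at h0
  rw [tsum_ite_eq] at h0
  have : ∀ x : ℝ, ∑' n : ℤ, jacobiTheta₂_term n x ω = 0 := fun x => hJ x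
  simp [this] at h0

end Theta

/-- Every complex number is a real combination of the two periods. -/
lemma exists_real_coords {ω : ℂ} (hω : 0 < ω.im) (z : ℂ) :
    ∃ s r : ℝ, z = Real.pi * s + Real.pi * ω * r := by
  have hp := Real.pi_ne_zero
  have := hω.ne'
  obtain ⟨r, hr⟩ : ∃ r : ℝ, Real.pi * ω.im * r = z.im :=
    ⟨z.im / (Real.pi * ω.im), by field_simp⟩
  obtain ⟨s, hs⟩ : ∃ s : ℝ, Real.pi * s = z.re - Real.pi * ω.re * r :=
    ⟨(z.re - Real.pi * ω.re * r) / Real.pi, by field_simp⟩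
  refine ⟨s, r, Complex.ext ?_ ?_⟩
  · simp; linarith
  · simp; linarith

/-- An entire function whose modulus is doubly periodic is constant. -/
lemma eq_const_of_norm_periodic {ω : ℂ} (hω : 0 < ω.im) {f : ℂ → ℂ} (hf : Differentiable ℂ f)
    (h1 : ∀ z, ‖f (z + Real.pi)‖ = ‖f z‖) (h2 : ∀ z, ‖f (z + Real.pi * ω)‖ = ‖f z‖) (z w : ℂ) :
    f z = f w := by
  have hm : ∀ (m : ℤ) z, ‖f (z + Real.pi * m)‖ = ‖f z‖ := by
    intro m z
    have : Function.Periodic (fun z => ‖f z‖) (Real.pi : ℂ) := h1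
    have := (this.int_mul m) z
    simpa [mul_comm] using this
  have hn : ∀ (m : ℤ) z, ‖f (z + Real.pi * ω * m)‖ = ‖f z‖ := by
    intro m z
    have : Function.Periodic (fun z => ‖f z‖) (Real.pi * ω : ℂ) := h2
    have := (this.int_mul m) z
    simpa [mul_comm] using this
  -- Fractional parts of the real coordinates move any point into this compact parallelogram without
  -- changing the modulus; Liouville's theorem then applies.
  have hK : IsCompact ((fun p : ℝ × ℝ => (Real.pi * p.1 + Real.pi * ω * p.2 : ℂ)) ''
      (Set.Icc 0 1 ×ˢ Set.Icc 0 1)) :=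
    (isCompact_Icc.prod isCompact_Icc).image (by fun_prop)
  obtain ⟨C, hC⟩ := hK.exists_bound_of_continuousOn hf.continuous.continuousOn
  refine hf.apply_eq_apply_of_bounded ?_ z w
  refine (Metric.isBounded_iff_subset_closedBall 0).mpr ⟨C, ?_⟩
  rintro _ ⟨z, rfl⟩
  obtain ⟨s, r, rfl⟩ := exists_real_coords hω z
  have := hC (Real.pi * (Int.fract s : ℝ) + Real.pi * ω * (Int.fract r : ℝ))
    ⟨(Int.fract s, Int.fract r), ⟨⟨Int.fract_nonneg _, (Int.fract_lt_one _).le⟩,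
      ⟨Int.fract_nonneg _, (Int.fract_lt_one _).le⟩⟩, rfl⟩
  rw [← hm ⌊s⌋, ← hn ⌊r⌋] at this
  rw [mem_closedBall_zero_iff]
  have e1 : (s : ℂ) = ⌊s⌋ + (Int.fract s : ℝ) := by
    conv_lhs => rw [← Int.floor_add_fract s]
    push_cast; rfl
  have e2 : (r : ℂ) = ⌊r⌋ + (Int.fract r : ℝ) := by
    conv_lhs => rw [← Int.floor_add_fract r]
    push_cast; rfl
  rw [e1, e2]
  refine le_of_eq_of_le (congrArg (fun z => ‖f z‖) ?_) this
  ring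

/-- Division of entire functions when the denominator has only simple zeros. -/
lemma exists_entire_quotient {p f : ℂ → ℂ} (hp : Differentiable ℂ p) (hf : Differentiable ℂ f)
    (hp' : ∀ z, p z = 0 → deriv p z ≠ 0) (h0 : ∀ z, p z = 0 → f z = 0) :
    ∃ g : ℂ → ℂ, Differentiable ℂ g ∧ ∀ z, f z = g z * p z := by
  refine ⟨fun z => if p z = 0 then deriv f z / deriv p z else f z / p z, fun z => ?_, fun z => ?_⟩
  · by_cases hz : p z = 0
    · have hd : ∀ h : ℂ → ℂ, Differentiable ℂ h → Differentiable ℂ (dslope h z) := fun h hh =>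
        differentiableOn_univ.mp ((differentiableOn_dslope univ_mem).mpr hh.differentiableOn)
      have hne : dslope p z z ≠ 0 := by rw [dslope_same]; exact hp' z hz
      have hev : ∀ᶠ w in 𝓝 z, dslope p z w ≠ 0 :=
        (hd p hp).continuous.continuousAt.eventually_ne hne
      -- Since f and p both vanish at z, f/p is the quotient of their difference quotients, and the
      -- denominator is nonzero near z because the zero of p is simple.
      have : (fun w => dslope f z w / dslope p z w) =ᶠ[𝓝 z]
          (fun w => if p w = 0 then deriv f w / deriv p w else f w / p w) := by
        filter_upwards [hev] with w hw
        by_cases hwz : w = z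
        · subst hwz; simp [hz]
        · rw [dslope_of_ne _ hwz, slope_def_field, hz] at hw
          have hpw : p w ≠ 0 := by rintro h; simp [h] at hw
          have hwz' : w - z ≠ 0 := sub_ne_zero.mpr hwz
          rw [if_neg hpw, dslope_of_ne _ hwz, dslope_of_ne _ hwz, slope_def_field,
            slope_def_field, hz, h0 z hz]
          field_simp
          simp
      exact (((hd f hf) z).div ((hd p hp) z) hne).congr_of_eventuallyEq this.symm
    · have hev : ∀ᶠ w in 𝓝 z, p w ≠ 0 := hp.continuous.continuousAt.eventually_ne hz
      refine ((hf z).div (hp z) hz).congr_of_eventuallyEq ?_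
      filter_upwards [hev] with w hw
      simp [hw]
  · by_cases hz : p z = 0
    · simp [hz, h0 z hz]
    · simp [hz]

/-! ### Product formula up to a constant, and the zeros of theta. -/

/-- The infinite product `∏ (1 - q^(n+1) w)`. -/
noncomputable def qProd (q w : ℂ) : ℂ := ∏' n : ℕ, (1 + -(q ^ (n + 1) * w))

section qProd

variable {q : ℂ}

lemma summable_qProd (hq : ‖q‖ < 1) (w : ℂ) : Summable fun n : ℕ => ‖-(q ^ (n + 1) * w)‖ := by
  simp only [norm_neg, norm_mul, norm_pow]
  exact ((summable_nat_add_iff 1).mpr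
    (summable_geometric_of_lt_one (norm_nonneg _) hq)).mul_right _

lemma differentiable_qProd (hq : ‖q‖ < 1) : Differentiable ℂ (qProd q) := by
  intro w
  have hu : Summable fun n : ℕ => ‖q‖ ^ (n + 1) * (‖w‖ + 1) :=
    ((summable_nat_add_iff 1).mpr (summable_geometric_of_lt_one (norm_nonneg _) hq)).mul_right _
  have := Summable.hasProdLocallyUniformlyOn_nat_one_add (f := fun (n : ℕ) (w : ℂ) => -(q ^ (n + 1) * w))
    (K := Metric.ball (0 : ℂ) (‖w‖ + 1)) Metric.isOpen_ball hu
    (Eventually.of_forall fun n x hx => by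
      rw [norm_neg, norm_mul, norm_pow]
      have : ‖x‖ ≤ ‖w‖ + 1 := by simpa using (mem_ball_zero_iff.mp hx).le
      gcongr) (fun n => by fun_prop)
  have hd := this.differentiableOn (.of_forall fun s => by
    simpa [Finset.prod_fn] using DifferentiableOn.finsetProd (fun _ _ => by fun_prop))
    Metric.isOpen_ball
  exact hd.differentiableAt (Metric.isOpen_ball.mem_nhds (by simp))

lemma qProd_ne_zero (hq : ‖q‖ < 1) {w : ℂ} (h : ∀ n : ℕ, q ^ (n + 1) * w ≠ 1) :
    qProd q w ≠ 0 :=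
  tprod_one_add_ne_zero_of_summable
    (fun n => by rw [← sub_eq_add_neg]; exact sub_ne_zero.mpr (h n).symm) (summable_qProd hq w)

/-- Splitting off the first factor. This functional equation under w ↦ q w is the source of the
quasi-period πω of `thetaProd`. -/
lemma qProd_step (hq : ‖q‖ < 1) (w : ℂ) : qProd q w = (1 - q * w) * qProd q (q * w) := by
  have hm : Multipliable fun n : ℕ => (1 + -(q ^ (n + 1 + 1) * w)) := by
    have := multipliable_one_add_of_summable (summable_qProd hq (q * w))
    refine this.congr fun n => ?_
    rw [pow_succ q (n + 1), mul_assoc]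
  have h0 : qProd q w = (1 + -(q ^ (0 + 1) * w)) * ∏' n : ℕ, (1 + -(q ^ (n + 1 + 1) * w)) :=
    tprod_eq_zero_mul' hm
  rw [h0, qProd, zero_add, pow_one, sub_eq_add_neg]
  congr 1
  exact tprod_congr fun n => by rw [pow_succ q (n + 1), mul_assoc]

end qProd

/-- The product form of the theta function, up to a constant. -/
noncomputable def thetaProd (ω z : ℂ) : ℂ :=
  exp (-(I * z)) * (1 - exp (2 * I * z)) * qProd (exp (2 * Real.pi * I * ω)) (exp (2 * I * z)) *
    qProd (exp (2 * Real.pi * I * ω)) (exp (-(2 * I * z)))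

section

variable {ω : ℂ}

lemma norm_nome_lt_one (hω : 0 < ω.im) : ‖exp (2 * Real.pi * I * ω)‖ < 1 := by
  rw [norm_exp]
  simp
  positivity

lemma differentiable_thetaProd (hω : 0 < ω.im) : Differentiable ℂ (thetaProd ω) := by
  have h := differentiable_qProd (norm_nome_lt_one hω)
  have h1 : Differentiable ℂ fun z : ℂ => qProd (exp (2 * Real.pi * I * ω)) (exp (2 * I * z)) :=
    h.comp (by fun_prop)
  have h2 : Differentiable ℂ fun z : ℂ => qProd (exp (2 * Real.pi * I * ω)) (exp (-(2 * I * z))) :=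
    h.comp (by fun_prop)
  exact (((by fun_prop : Differentiable ℂ
    fun z : ℂ => exp (-(I * z)) * (1 - exp (2 * I * z))).mul h1).mul h2)

lemma thetaProd_add_pi (ω z : ℂ) : thetaProd ω (z + Real.pi) = -thetaProd ω z := by
  rw [thetaProd, thetaProd,
    show 2 * I * (z + Real.pi) = 2 * I * z + 2 * Real.pi * I by ring,
    show -(I * (z + Real.pi)) = -(I * z) + -(Real.pi * I) by ring,
    show -(2 * I * z + 2 * Real.pi * I) = -(2 * I * z) - 2 * Real.pi * I by ring,
    exp_add _ (2 * Real.pi * I), exp_sub, exp_two_pi_mul_I, exp_add, exp_neg (Real.pi * I),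
    exp_pi_mul_I]
  simp

lemma thetaProd_add_pi_mul (hω : 0 < ω.im) (z : ℂ) :
    thetaProd ω (z + Real.pi * ω) = -exp (-(I * Real.pi * ω) - 2 * I * z) * thetaProd ω z := by
  have hq := norm_nome_lt_one hω
  rw [thetaProd, thetaProd]
  set q := exp (2 * Real.pi * I * ω) with hqdef
  have hq0 : q ≠ 0 := exp_ne_zero _
  set w := exp (2 * I * z) with hw
  have hw0 : w ≠ 0 := exp_ne_zero _
  have e1 : exp (2 * I * (z + Real.pi * ω)) = q * w := by
    rw [hw, hqdef, ← exp_add]; congr 1; ring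
  have e2 : exp (-(2 * I * (z + Real.pi * ω))) = q⁻¹ * w⁻¹ := by
    rw [hw, hqdef, ← exp_neg, ← exp_neg, ← exp_add]; congr 1; ring
  have e3 : exp (-(2 * I * z)) = w⁻¹ := by rw [hw, ← exp_neg]
  have e4 : exp (-(I * (z + Real.pi * ω))) = exp (-(I * z)) * exp (-(I * Real.pi * ω)) := by
    rw [← exp_add]; congr 1; ring
  have e5 : exp (-(I * Real.pi * ω) - 2 * I * z) = exp (-(I * Real.pi * ω)) * w⁻¹ := by
    rw [exp_sub, hw]; rfl
  have s1 := qProd_step hq w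
  have s2 := qProd_step hq (q⁻¹ * w⁻¹)
  rw [show q * (q⁻¹ * w⁻¹) = w⁻¹ by field_simp] at s2
  rw [e1, e2, e3, e4, e5, s2, s1]
  field_simp
  ring

lemma exp_two_I_eq_one_iff {z : ℂ} : exp (2 * I * z) = 1 ↔ ∃ m : ℤ, z = Real.pi * m := by
  rw [exp_eq_one_iff]
  refine exists_congr fun m => ⟨fun h => ?_, fun h => by rw [h]; ring⟩
  have : 2 * I * (z - Real.pi * m) = 0 := by linear_combination h
  simpa [I_ne_zero, sub_eq_zero] using this

lemma thetaProd_ne_zero (hω : 0 < ω.im) {z : ℂ} (hz : z ∉ lattice ω) : thetaProd ω z ≠ 0 := by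
  have hq := norm_nome_lt_one hω
  rw [thetaProd]
  refine mul_ne_zero (mul_ne_zero (mul_ne_zero (exp_ne_zero _) ?_) ?_) ?_
  · refine sub_ne_zero.mpr fun h => hz ?_
    obtain ⟨m, hm⟩ := exp_two_I_eq_one_iff.mp h.symm
    exact ⟨m, 0, by simp [hm]⟩
  · refine qProd_ne_zero hq fun n h => hz ?_
    rw [← exp_nat_mul, ← exp_add,
      show ((n + 1 : ℕ) : ℂ) * (2 * Real.pi * I * ω) + 2 * I * z =
        2 * I * (z + Real.pi * ω * (n + 1)) by push_cast; ring] at h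
    obtain ⟨m, hm⟩ := exp_two_I_eq_one_iff.mp h
    exact ⟨m, -(n + 1 : ℤ), by push_cast; linear_combination hm⟩
  · refine qProd_ne_zero hq fun n h => hz ?_
    rw [← exp_nat_mul, ← exp_add,
      show ((n + 1 : ℕ) : ℂ) * (2 * Real.pi * I * ω) + -(2 * I * z) =
        2 * I * (-z + Real.pi * ω * (n + 1)) by push_cast; ring] at h
    obtain ⟨m, hm⟩ := exp_two_I_eq_one_iff.mp h
    exact ⟨-m, (n + 1 : ℤ), by push_cast; linear_combination -hm⟩

lemma hasDerivAt_thetaProd_zero (hω : 0 < ω.im) :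
    HasDerivAt (thetaProd ω) (-(2 * I) * qProd (exp (2 * Real.pi * I * ω)) 1 ^ 2) 0 := by
  have h := differentiable_qProd (norm_nome_lt_one hω)
  set q := exp (2 * Real.pi * I * ω)
  have h1 : Differentiable ℂ fun z : ℂ => qProd q (exp (2 * I * z)) := h.comp (by fun_prop)
  have h2 : Differentiable ℂ fun z : ℂ => qProd q (exp (-(2 * I * z))) := h.comp (by fun_prop)
  have h3 : HasDerivAt (fun z : ℂ => 1 - exp (2 * I * z)) (-(2 * I)) 0 := by
    have := (((hasDerivAt_id (0 : ℂ)).const_mul (2 * I)).cexp).const_sub 1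
    simpa using this
  have h4 : Differentiable ℂ fun z : ℂ => exp (-(I * z)) := by fun_prop
  have := ((((h4 0).hasDerivAt).mul h3).mul (h1 0).hasDerivAt).mul (h2 0).hasDerivAt
  refine HasDerivAt.congr_deriv (f := thetaProd ω) this ?_
  simp
  ring

lemma qProd_one_ne_zero (hω : 0 < ω.im) : qProd (exp (2 * Real.pi * I * ω)) 1 ≠ 0 := by
  refine qProd_ne_zero (norm_nome_lt_one hω) fun n h => ?_
  have hlt := pow_lt_one₀ (norm_nonneg _) (norm_nome_lt_one hω) (Nat.succ_ne_zero n)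
  rw [← norm_pow] at hlt
  rw [mul_one] at h
  rw [h] at hlt
  simp at hlt

/-- A multiplicative quasi-period carries simple zeros to simple zeros. -/
lemma simple_zero_of_quasiperiod {p e : ℂ → ℂ} {T : ℂ} (hp : Differentiable ℂ p)
    (he : Differentiable ℂ e) (he0 : ∀ z, e z ≠ 0) (h : ∀ z, p (z + T) = e z * p z) (z : ℂ) :
    (p (z + T) = 0 ∧ deriv p (z + T) ≠ 0) ↔ (p z = 0 ∧ deriv p z ≠ 0) := by
  have hd : deriv p (z + T) = deriv e z * p z + e z * deriv p z := by
    rw [← deriv_comp_add_const, show (fun x => p (x + T)) = fun z => e z * p z from funext h]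
    exact ((he z).hasDerivAt.mul (hp z).hasDerivAt).deriv
  rw [hd, h]
  constructor
  · rintro ⟨h1, h2⟩
    have h1 : p z = 0 := by simpa [he0] using h1
    exact ⟨h1, by simpa [h1, he0] using h2⟩
  · rintro ⟨h1, h2⟩
    simp [h1, h2, he0]

/-- The multipliers never vanish, so the simple zero at the origin propagates along both periods. -/
lemma simple_zero_lattice {p : ℂ → ℂ} (hp : Differentiable ℂ p)
    (h1 : ∀ z, p (z + Real.pi) = -p z)
    (h2 : ∀ z, p (z + Real.pi * ω) = -exp (-(I * Real.pi * ω) - 2 * I * z) * p z)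
    (h0 : p 0 = 0 ∧ deriv p 0 ≠ 0) {z : ℂ} (hz : z ∈ lattice ω) : p z = 0 ∧ deriv p z ≠ 0 := by
  obtain ⟨m, n, rfl⟩ := hz
  have s1 := simple_zero_of_quasiperiod (e := fun _ => -1) hp (by fun_prop) (by simp)
    (by simpa using h1)
  have s2 := simple_zero_of_quasiperiod hp (by fun_prop) (by simp [exp_ne_zero]) h2
  have a1 : ∀ m : ℤ, p (Real.pi * m) = 0 ∧ deriv p (Real.pi * m) ≠ 0 := by
    intro m
    induction m using Int.induction_on with
    | zero => simpa using h0
    | succ i hi => convert (s1 _).mpr hi using 3 <;> (push_cast; ring_nf)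
    | pred i hi =>
      have := (s1 (Real.pi * ((-i - 1 : ℤ) : ℂ))).mp (by
        convert hi using 3 <;> (push_cast; ring_nf))
      exact this
  induction n using Int.induction_on with
  | zero => simpa using a1 m
  | succ i hi => convert (s2 _).mpr hi using 3 <;> (push_cast; ring_nf)
  | pred i hi =>
    have := (s2 (Real.pi * m + Real.pi * ω * ((-i - 1 : ℤ) : ℂ))).mp (by
      convert hi using 3 <;> (push_cast; ring_nf))
    exact this

lemma thetaProd_simple (hω : 0 < ω.im) {z : ℂ} (hz : z ∈ lattice ω) :
    thetaProd ω z = 0 ∧ deriv (thetaProd ω) z ≠ 0 := by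
  refine simple_zero_lattice (differentiable_thetaProd hω) (thetaProd_add_pi ω)
    (thetaProd_add_pi_mul hω) ⟨by simp [thetaProd], ?_⟩ hz
  rw [(hasDerivAt_thetaProd_zero hω).deriv]
  simp [qProd_one_ne_zero hω, I_ne_zero]

lemma theta_zero_lattice {z : ℂ} (hz : z ∈ lattice ω) : theta ω z = 0 := by
  obtain ⟨m, n, rfl⟩ := hz
  have a1 : ∀ m : ℤ, theta ω (Real.pi * m) = 0 := by
    intro m
    induction m using Int.induction_on with
    | zero => simpa using theta_zero ω
    | succ i hi => push_cast at *; rw [mul_add, mul_one, theta_add_pi, hi, neg_zero]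
    | pred i hi =>
      have := theta_add_pi ω (Real.pi * ((-i - 1 : ℤ) : ℂ))
      rw [show (Real.pi * ((-i - 1 : ℤ) : ℂ) + Real.pi : ℂ) = Real.pi * ((-i : ℤ) : ℂ) by
        push_cast; ring, hi] at this
      exact neg_eq_zero.mp this.symm
  induction n using Int.induction_on with
  | zero => simpa using a1 m
  | succ i hi =>
    push_cast at *
    rw [mul_add, mul_one, ← add_assoc, theta_add_pi_mul, hi, mul_zero]
  | pred i hi =>
    have := theta_add_pi_mul ω (Real.pi * m + Real.pi * ω * ((-i - 1 : ℤ) : ℂ))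
    rw [show (Real.pi * m + Real.pi * ω * ((-i - 1 : ℤ) : ℂ) + Real.pi * ω : ℂ) =
      Real.pi * m + Real.pi * ω * ((-i : ℤ) : ℂ) by push_cast; ring, hi] at this
    have h := mul_eq_zero.mp this.symm
    simpa [exp_ne_zero] using h

lemma thetaProd_eq_zero_iff (hω : 0 < ω.im) {z : ℂ} : thetaProd ω z = 0 ↔ z ∈ lattice ω :=
  ⟨fun h => by_contra fun hz => thetaProd_ne_zero hω hz h, fun h => (thetaProd_simple hω h).1⟩

/-- Theta vanishes on the lattice, where the product has simple zeros and no others elsewhere. The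
quotient is therefore entire, and doubly periodic because both functions have the same multipliers,
hence constant. This transfers exact knowledge of the zeros from the product to theta. -/
lemma exists_theta_eq_thetaProd (hω : 0 < ω.im) :
    ∃ C : ℂ, C ≠ 0 ∧ ∀ z, theta ω z = C * thetaProd ω z := by
  obtain ⟨g, hg, hgp⟩ := exists_entire_quotient (differentiable_thetaProd hω)
    (differentiable_theta hω)
    (fun z hz => (thetaProd_simple hω ((thetaProd_eq_zero_iff hω).mp hz)).2)
    (fun z hz => theta_zero_lattice ((thetaProd_eq_zero_iff hω).mp hz))
  -- Periodicity of the quotient is visible only where the product does not vanish; density and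
  -- continuity extend it.
  have hdense : Dense {z : ℂ | thetaProd ω z ≠ 0} := by
    have han : AnalyticOnNhd ℂ (thetaProd ω) Set.univ :=
      fun z _ => (differentiable_thetaProd hω).analyticAt z
    intro z
    rw [mem_closure_iff_frequently]
    have h1 : ∀ᶠ w in 𝓝[≠] z, thetaProd ω w ≠ 0 := by
      rcases (han z trivial).eventually_eq_zero_or_eventually_ne_zero with h | h
      · obtain ⟨w, hw⟩ := exists_theta_ne_zero hω
        have := han.eqOn_zero_of_preconnected_of_eventuallyEq_zero isPreconnected_univ trivial h
        exact absurd (by rw [hgp, this (Set.mem_univ w)]; simp) hw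
      · exact h
    exact h1.frequently.filter_mono nhdsWithin_le_nhds
  have hper : ∀ (T : ℂ) (e : ℂ → ℂ), (∀ z, e z ≠ 0) →
      (∀ z, theta ω (z + T) = e z * theta ω z) →
      (∀ z, thetaProd ω (z + T) = e z * thetaProd ω z) → ∀ z, g (z + T) = g z := by
    intro T e he h1 h2
    have hgc := hg.continuous
    refine fun z => congrFun (Continuous.ext_on (f := fun z => g (z + T)) hdense (by fun_prop)
      hgc fun z hz => ?_) z
    change g (z + T) = g z
    have := h1 z
    rw [hgp, hgp z, h2] at this
    have hz : thetaProd ω z ≠ 0 := hz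
    have h3 : (g (z + T) - g z) * (e z * thetaProd ω z) = 0 := by linear_combination this
    have := mul_eq_zero.mp h3
    simpa [he, hz, sub_eq_zero] using this
  have p1 := hper Real.pi (fun _ => -1) (by simp) (by simpa using theta_add_pi ω)
    (by simpa using thetaProd_add_pi ω)
  have p2 := hper (Real.pi * ω) _ (by simp [exp_ne_zero]) (theta_add_pi_mul ω)
    (thetaProd_add_pi_mul hω)
  have hc := eq_const_of_norm_periodic hω hg (fun z => by rw [p1]) (fun z => by rw [p2])
  refine ⟨g 0, fun h => ?_, fun z => by rw [hgp, hc z 0]⟩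
  obtain ⟨w, hw⟩ := exists_theta_ne_zero hω
  exact hw (by rw [hgp, hc w 0, h, zero_mul])

lemma theta_eq_zero_iff (hω : 0 < ω.im) {z : ℂ} : theta ω z = 0 ↔ z ∈ lattice ω := by
  obtain ⟨C, hC, h⟩ := exists_theta_eq_thetaProd hω
  rw [h, mul_eq_zero, ← thetaProd_eq_zero_iff hω]
  simp [hC]

lemma deriv_theta_ne_zero (hω : 0 < ω.im) {z : ℂ} (hz : theta ω z = 0) :
    deriv (theta ω) z ≠ 0 := by
  obtain ⟨C, hC, h⟩ := exists_theta_eq_thetaProd hω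
  rw [show theta ω = fun z => C * thetaProd ω z from funext h, deriv_const_mul_field]
  exact mul_ne_zero hC (thetaProd_simple hω ((theta_eq_zero_iff hω).mp hz)).2

end

/-! ### Elliptic polynomials and their interpolation. -/

/-- The tool for cancelling a factor that is not identically zero: identities checked off the zeros
of a denominator become identities everywhere. -/
lemma entire_mul_eq_zero {f g : ℂ → ℂ} (hf : Differentiable ℂ f) (hg : Differentiable ℂ g)
    (h : ∀ z, f z * g z = 0) : (∀ z, f z = 0) ∨ (∀ z, g z = 0) := by
  have := AnalyticOnNhd.eq_zero_or_eq_zero_of_mul_eq_zero (U := Set.univ)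
    (fun z _ => hf.analyticAt z) (fun z _ => hg.analyticAt z) (fun z _ => h z)
    isPreconnected_univ
  simpa using this

lemma entire_prod_ne_zero {ι : Type*} {f : ι → ℂ → ℂ} (s : Finset ι)
    (hf : ∀ i ∈ s, Differentiable ℂ (f i)) (h : ∀ i ∈ s, ∃ z, f i z ≠ 0) :
    ∃ z, ∏ i ∈ s, f i z ≠ 0 := by
  classical
  induction s using Finset.induction_on with
  | empty => simp
  | insert a s ha ih =>
    by_contra! hc
    simp_rw [Finset.prod_insert ha] at hc
    have hd : Differentiable ℂ fun z => ∏ i ∈ s, f i z :=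
      Differentiable.fun_finsetProd fun i hi => hf i (Finset.mem_insert_of_mem hi)
    rcases entire_mul_eq_zero (hf a (Finset.mem_insert_self _ _)) hd hc with h1 | h1
    · obtain ⟨z, hz⟩ := h a (Finset.mem_insert_self _ _)
      exact hz (h1 z)
    · obtain ⟨z, hz⟩ := ih (fun i hi => hf i (Finset.mem_insert_of_mem hi))
        (fun i hi => h i (Finset.mem_insert_of_mem hi))
      exact hz (h1 z)

section Lattice

variable {ω : ℂ}

lemma zero_mem_lattice : (0 : ℂ) ∈ lattice ω := ⟨0, 0, by simp⟩

lemma neg_mem_lattice {z : ℂ} (h : z ∈ lattice ω) : -z ∈ lattice ω := by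
  obtain ⟨m, n, rfl⟩ := h
  exact ⟨-m, -n, by push_cast; ring⟩

lemma add_mem_lattice {z w : ℂ} (h : z ∈ lattice ω) (h' : w ∈ lattice ω) :
    z + w ∈ lattice ω := by
  obtain ⟨m, n, rfl⟩ := h
  obtain ⟨m', n', rfl⟩ := h'
  exact ⟨m + m', n + n', by push_cast; ring⟩

end Lattice

/-- The quasi-periodicity factor of the theta function. -/
noncomputable def thetaFactor (ω : ℂ) : ℂ := -exp (-(I * Real.pi * ω))

lemma thetaFactor_ne_zero (ω : ℂ) : thetaFactor ω ≠ 0 := neg_ne_zero.mpr (exp_ne_zero _)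

/-- Elliptic polynomials of order `n`: entire functions with the quasi-periods of
`exp (i s u) ∏ⱼ θ(u - λⱼ)`, where `∑ⱼ λⱼ = b - s π ω / 2`. -/
structure QP (ω : ℂ) (n : ℕ) (s b : ℂ) (f : ℂ → ℂ) : Prop where
  diff : Differentiable ℂ f
  pi : ∀ u, f (u + Real.pi) = (-1) ^ n * exp (I * Real.pi * s) * f u
  tau : ∀ u, f (u + Real.pi * ω) =
    thetaFactor ω ^ n * exp (2 * I * b) * exp (-(2 * I * n * u)) * f u

namespace QP

variable {ω : ℂ} {n m : ℕ} {s s' b b' : ℂ} {f g : ℂ → ℂ}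

lemma add (hf : QP ω n s b f) (hg : QP ω n s b g) : QP ω n s b fun u => f u + g u where
  diff := hf.diff.fun_add hg.diff
  pi u := by rw [hf.pi, hg.pi]; ring
  tau u := by rw [hf.tau, hg.tau]; ring

lemma const_mul (c : ℂ) (hf : QP ω n s b f) : QP ω n s b fun u => c * f u where
  diff := hf.diff.const_mul c
  pi u := by rw [hf.pi]; ring
  tau u := by rw [hf.tau]; ring

lemma zero : QP ω n s b fun _ => 0 := ⟨by fun_prop, by simp, by simp⟩

lemma sub (hf : QP ω n s b f) (hg : QP ω n s b g) : QP ω n s b fun u => f u - g u := by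
  simpa [sub_eq_add_neg] using hf.add (hg.const_mul (-1))

lemma sum {ι : Type*} {F : ι → ℂ → ℂ} (t : Finset ι) (h : ∀ i ∈ t, QP ω n s b (F i)) :
    QP ω n s b fun u => ∑ i ∈ t, F i u := by
  classical
  induction t using Finset.induction_on with
  | empty => simpa using zero
  | insert a t ha ih =>
    simp_rw [Finset.sum_insert ha]
    exact (h a (Finset.mem_insert_self _ _)).add
      (ih fun i hi => h i (Finset.mem_insert_of_mem hi))

lemma mul (hf : QP ω n s b f) (hg : QP ω m s' b' g) :
    QP ω (n + m) (s + s') (b + b') fun u => f u * g u where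
  diff := hf.diff.fun_mul hg.diff
  pi u := by rw [hf.pi, hg.pi, mul_add, exp_add, pow_add]; ring
  tau u := by
    rw [hf.tau, hg.tau, mul_add (2 * I), exp_add, pow_add, Nat.cast_add,
      show -(2 * I * (n + m) * u) = -(2 * I * n * u) + -(2 * I * m * u) by ring, exp_add]
    ring

lemma const (c : ℂ) : QP ω 0 0 0 fun _ => c := ⟨by fun_prop, by simp, by simp⟩

lemma finset_prod {ι : Type*} {F : ι → ℂ → ℂ} {n : ι → ℕ} {s b : ι → ℂ} (t : Finset ι)
    (h : ∀ i ∈ t, QP ω (n i) (s i) (b i) (F i)) :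
    QP ω (∑ i ∈ t, n i) (∑ i ∈ t, s i) (∑ i ∈ t, b i) fun u => ∏ i ∈ t, F i u := by
  classical
  induction t using Finset.induction_on with
  | empty => simpa using const 1
  | insert a t ha ih =>
    simp_rw [Finset.prod_insert ha, Finset.sum_insert ha]
    exact (h a (Finset.mem_insert_self _ _)).mul
      (ih fun i hi => h i (Finset.mem_insert_of_mem hi))

lemma theta_sub (hω : 0 < ω.im) (a : ℂ) : QP ω 1 0 a fun u => theta ω (u - a) where
  diff := (differentiable_theta hω).comp (by fun_prop)
  pi u := by
    rw [show u + Real.pi - a = u - a + Real.pi by ring, theta_add_pi]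
    simp
  tau u := by
    rw [show u + Real.pi * ω - a = u - a + Real.pi * ω by ring, theta_add_pi_mul, thetaFactor,
      show -(I * Real.pi * ω) - 2 * I * (u - a) =
        -(I * Real.pi * ω) + 2 * I * a + -(2 * I * (1 : ℕ) * u) by push_cast; ring, exp_add,
      exp_add]
    ring

lemma theta_add (hω : 0 < ω.im) (a : ℂ) : QP ω 1 0 (-a) fun u => theta ω (u + a) := by
  simpa using theta_sub hω (-a)

lemma exponential (r c : ℂ) : QP ω 0 r (r * Real.pi * ω / 2) fun u => exp (I * r * u + c) where
  diff := by fun_prop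
  pi u := by
    rw [show I * r * (u + Real.pi) + c = I * Real.pi * r + (I * r * u + c) by ring, exp_add]
    simp
  tau u := by
    rw [show I * r * (u + Real.pi * ω) + c =
      2 * I * (r * Real.pi * ω / 2) + (I * r * u + c) by ring, exp_add]
    simp

/-- The parameters `s` and `b` matter only modulo `2` and `π`. -/
lemma congr (hf : QP ω n s b f) (hs : ∃ k : ℤ, s' = s + 2 * k)
    (hb : ∃ k : ℤ, b' = b + Real.pi * k) : QP ω n s' b' f := by
  obtain ⟨k, rfl⟩ := hs
  obtain ⟨l, rfl⟩ := hb
  have h1 : exp (I * Real.pi * (s + 2 * k)) = exp (I * Real.pi * s) := by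
    rw [show I * Real.pi * (s + 2 * k) = I * Real.pi * s + k * (2 * Real.pi * I) by ring, exp_add,
      exp_int_mul_two_pi_mul_I, mul_one]
  have h2 : exp (2 * I * (b + Real.pi * l)) = exp (2 * I * b) := by
    rw [show 2 * I * (b + Real.pi * l) = 2 * I * b + l * (2 * Real.pi * I) by ring, exp_add,
      exp_int_mul_two_pi_mul_I, mul_one]
  exact ⟨hf.diff, by rw [h1]; exact hf.pi, by rw [h2]; exact hf.tau⟩

lemma eq_zero_of_sub_mem (hf : QP ω n s b f) {x z : ℂ} (hx : f x = 0)
    (hz : z - x ∈ lattice ω) : f z = 0 := by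
  have s1 : ∀ u, f (u + Real.pi) = 0 ↔ f u = 0 := fun u => by rw [hf.pi]; simp [exp_ne_zero]
  have s2 : ∀ u, f (u + Real.pi * ω) = 0 ↔ f u = 0 := fun u => by
    rw [hf.tau]; simp [exp_ne_zero, thetaFactor_ne_zero]
  have a1 : ∀ (m : ℤ) u, f (u + Real.pi * m) = 0 ↔ f u = 0 := by
    intro m u
    have : Function.Periodic (fun u => f u = 0) (Real.pi : ℂ) := fun u => propext (s1 u)
    simpa [mul_comm] using iff_of_eq (this.int_mul m u)
  have a2 : ∀ (m : ℤ) u, f (u + Real.pi * ω * m) = 0 ↔ f u = 0 := by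
    intro m u
    have : Function.Periodic (fun u => f u = 0) (Real.pi * ω : ℂ) := fun u => propext (s2 u)
    simpa [mul_comm] using iff_of_eq (this.int_mul m u)
  obtain ⟨k, l, hkl⟩ := hz
  rw [show z = x + Real.pi * k + Real.pi * ω * l by linear_combination hkl, a2, a1]
  exact hx

/-- An elliptic polynomial of order zero is an exponential. -/
lemma eq_exp (hω : 0 < ω.im) (hf : QP ω 0 s b f) : ∃ c, ∀ u, f u = f 0 * exp (c * u) := by
  set α := (exp (I * Real.pi * s)) with hα
  set β := (exp (2 * I * b)) with hβ
  have hp := Real.pi_ne_zero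
  have hi := hω.ne'
  -- The exponent c = cr + i ci is chosen so that exp(c u) has multipliers of the same modulus as f
  -- along both periods; this is two real linear equations, solvable as Im ω ≠ 0. Then f(u) exp(-c
  -- u) has doubly periodic modulus.
  set cr : ℝ := Real.log ‖α‖ / Real.pi with hcr
  set ci : ℝ := (cr * ω.re - Real.log ‖β‖ / Real.pi) / ω.im with hci
  have h1 : ‖exp ((cr + ci * I) * Real.pi)‖ = ‖α‖ := by
    rw [norm_exp]
    have : ((cr + ci * I) * Real.pi : ℂ).re = Real.log ‖α‖ := by
      simp [hcr, hp]
    rw [this, Real.exp_log (by simp [hα, exp_ne_zero])]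
  have h2 : ‖exp ((cr + ci * I) * (Real.pi * ω))‖ = ‖β‖ := by
    rw [norm_exp]
    have : ((cr + ci * I) * (Real.pi * ω) : ℂ).re = Real.log ‖β‖ := by
      have e : ci * ω.im = cr * ω.re - Real.log ‖β‖ / Real.pi := by rw [hci]; field_simp
      have e2 : Real.pi * (ci * ω.im) = Real.pi * (cr * ω.re) - Real.log ‖β‖ := by
        rw [e]; field_simp
      simp
      linarith
    rw [this, Real.exp_log (by simp [hβ, exp_ne_zero])]
  set c : ℂ := cr + ci * I with hc
  refine ⟨c, fun u => ?_⟩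
  have key := eq_const_of_norm_periodic hω (f := fun u => f u * exp (-(c * u)))
    (hf.diff.fun_mul (by fun_prop))
    (fun z => by
      rw [hf.pi, show -(c * (z + Real.pi)) = -(c * Real.pi) + -(c * z) by ring, exp_add,
        exp_neg (c * Real.pi)]
      simp only [norm_mul, norm_inv, h1, ← hα]
      have : ‖α‖ ≠ 0 := by simp [hα, exp_ne_zero]
      simp
      field_simp)
    (fun z => by
      rw [hf.tau, show -(c * (z + Real.pi * ω)) = -(c * (Real.pi * ω)) + -(c * z) by ring,
        exp_add, exp_neg (c * (Real.pi * ω))]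
      simp only [norm_mul, norm_inv, h2, ← hβ]
      have : ‖β‖ ≠ 0 := by simp [hβ, exp_ne_zero]
      simp
      field_simp) u 0
  simp only [mul_zero, neg_zero, exp_zero, mul_one] at key
  rw [← key, mul_assoc, ← exp_add]
  simp

/-- A nonzero elliptic polynomial of order zero is an exponential exp(c u). The multiplier along π
forces c = i(s + 2k), and the one along πω then ties b to s modulo the lattice. -/
lemma eq_zero_or_mem (hω : 0 < ω.im) (hf : QP ω 0 s b f) :
    (∀ u, f u = 0) ∨ s * Real.pi * ω / 2 - b ∈ lattice ω := by
  obtain ⟨c, hc⟩ := hf.eq_exp hω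
  by_cases h0 : f 0 = 0
  · left; intro u; rw [hc, h0, zero_mul]
  right
  have h1 := hf.pi 0
  have h2 := hf.tau 0
  have hpi : (Real.pi : ℂ) ≠ 0 := by exact_mod_cast Real.pi_ne_zero
  rw [hc, zero_add, mul_comm] at h1 h2
  have h1 := mul_right_cancel₀ h0 h1
  have h2 := mul_right_cancel₀ h0 h2
  simp only [pow_zero, one_mul, mul_zero, neg_zero, exp_zero, mul_one] at h1 h2
  obtain ⟨k, hk⟩ := exp_eq_exp_iff_exists_int.mp h1
  obtain ⟨l, hl⟩ := exp_eq_exp_iff_exists_int.mp h2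
  have hc' : c = I * s + 2 * k * I := by
    apply mul_right_cancel₀ hpi; linear_combination hk
  rw [hc'] at hl
  refine ⟨l, -k, ?_⟩
  have : (2 * I) * (s * Real.pi * ω / 2 - b) =
      (2 * I) * (Real.pi * l + Real.pi * ω * (-k : ℤ)) := by
    push_cast; linear_combination hl
  exact mul_left_cancel₀ (by simp [I_ne_zero]) this

/-- Division by a theta function with a common zero. -/
lemma exists_div (hω : 0 < ω.im) (hf : QP ω (n + 1) s b f) {a : ℂ} (ha : f a = 0) :
    ∃ g, QP ω n s (b - a) g ∧ ∀ u, f u = g u * theta ω (u - a) := by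
  have hθ := theta_sub hω a
  obtain ⟨g, hg, hgf⟩ := exists_entire_quotient hθ.diff hf.diff
    (fun z hz => by
      rw [deriv_comp_sub_const]
      exact deriv_theta_ne_zero hω hz)
    (fun z hz => hf.eq_zero_of_sub_mem ha ((theta_eq_zero_iff hω).mp hz))
  have hne : ¬ ∀ z, theta ω (z - a) = 0 := by
    obtain ⟨z, hz⟩ := exists_theta_ne_zero hω
    exact fun h => hz (by simpa using h (z + a))
  refine ⟨g, ⟨hg, ?_, ?_⟩, hgf⟩
  -- The multiplier of the quotient is read off after multiplication by theta, which is then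
  -- cancelled.
  · have := entire_mul_eq_zero
      (f := fun u => g (u + Real.pi) - (-1) ^ n * exp (I * Real.pi * s) * g u)
      ((hg.comp (by fun_prop)).fun_sub (hg.const_mul _)) hθ.diff (fun z => by
        have h1 := hf.pi z
        rw [hgf, hgf z, hθ.pi] at h1
        simp only [mul_zero, exp_zero, pow_one] at h1
        rw [pow_succ] at h1
        linear_combination -h1)
    exact fun u => sub_eq_zero.mp ((this.resolve_right hne) u)
  · have := entire_mul_eq_zero
      (f := fun u => g (u + Real.pi * ω) -
        thetaFactor ω ^ n * exp (2 * I * (b - a)) * exp (-(2 * I * n * u)) * g u)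
      ((hg.comp (by fun_prop)).fun_sub (Differentiable.fun_mul (by fun_prop) hg)) hθ.diff
      (fun z => by
        have h1 := hf.tau z
        have hk := thetaFactor_ne_zero ω
        rw [hgf, hgf z, hθ.tau, pow_one, pow_succ,
          show -(2 * I * ((n + 1 : ℕ) : ℂ) * z) =
            -(2 * I * n * z) + -(2 * I * (1 : ℕ) * z) by push_cast; ring, exp_add,
          show 2 * I * b = 2 * I * (b - a) + 2 * I * a by ring, exp_add] at h1
        have h2 : (thetaFactor ω * exp (2 * I * a) * exp (-(2 * I * (1 : ℕ) * z))) *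
            ((g (z + Real.pi * ω) -
              thetaFactor ω ^ n * exp (2 * I * (b - a)) * exp (-(2 * I * n * z)) * g z) *
              theta ω (z - a)) = 0 := by linear_combination h1
        simpa [hk, exp_ne_zero] using h2)
    exact fun u => sub_eq_zero.mp ((this.resolve_right hne) u)

lemma exists_div_prod (hω : 0 < ω.im) {ι : Type*} (t : Finset ι) (x : ι → ℂ)
    (hx : ∀ i ∈ t, ∀ j ∈ t, i ≠ j → x i - x j ∉ lattice ω)
    (hf : QP ω (n + t.card) s b f) (h0 : ∀ i ∈ t, f (x i) = 0) :
    ∃ g, QP ω n s (b - ∑ i ∈ t, x i) g ∧ ∀ u, f u = g u * ∏ i ∈ t, theta ω (u - x i) := by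
  classical
  induction t using Finset.induction_on generalizing n with
  | empty => exact ⟨f, by simpa using hf, by simp⟩
  | insert a t ha ih =>
    rw [Finset.card_insert_of_notMem ha, show n + (t.card + 1) = (n + 1) + t.card by ring] at hf
    obtain ⟨g, hg, hgf⟩ := ih (fun i hi j hj => hx i (Finset.mem_insert_of_mem hi) j
      (Finset.mem_insert_of_mem hj)) hf (fun i hi => h0 i (Finset.mem_insert_of_mem hi))
    have hga : g (x a) = 0 := by
      have := h0 a (Finset.mem_insert_self _ _)
      rw [hgf] at this
      refine (mul_eq_zero.mp this).resolve_right (Finset.prod_ne_zero_iff.mpr fun i hi h => ?_)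
      refine hx a (Finset.mem_insert_self _ _) i (Finset.mem_insert_of_mem hi) ?_
        ((theta_eq_zero_iff hω).mp h)
      rintro rfl
      exact ha hi
    obtain ⟨k, hk, hkg⟩ := hg.exists_div hω hga
    refine ⟨k, ?_, fun u => ?_⟩
    · rw [Finset.sum_insert ha]
      convert hk using 1
      ring
    · rw [Finset.prod_insert ha, hgf, hkg]
      ring

/-- An elliptic polynomial of order `n` with `n` incongruent zeros vanishes, unless the zeros have
the right sum. -/
lemma eq_zero_of_vanish (hω : 0 < ω.im) {ι : Type*} (t : Finset ι) (x : ι → ℂ)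
    (hx : ∀ i ∈ t, ∀ j ∈ t, i ≠ j → x i - x j ∉ lattice ω)
    (hn : n = t.card) (hf : QP ω n s b f) (h0 : ∀ i ∈ t, f (x i) = 0)
    (hb : ∑ i ∈ t, x i - b + s * Real.pi * ω / 2 ∉ lattice ω) (u : ℂ) : f u = 0 := by
  have hf' : QP ω (0 + t.card) s b f := by rwa [zero_add, ← hn]
  obtain ⟨g, hg, hgf⟩ := hf'.exists_div_prod hω t x hx h0
  -- Division by all n theta factors leaves an elliptic polynomial of order zero whose parameter is
  -- b minus the sum of the zeros; `hb` excludes that it is nonzero.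
  rcases hg.eq_zero_or_mem hω with h | h
  · rw [hgf, h, zero_mul]
  · exact absurd (by convert h using 1; ring) hb

end QP

/-! ### Weierstrass's three-term identity. -/

section Weierstrass

variable {ω : ℂ}

/-- The three-term identity of Weierstrass. -/
lemma theta_three_term (hω : 0 < ω.im) (x y z w : ℂ) :
    theta ω (x + z) * theta ω (x - z) * (theta ω (y + w) * theta ω (y - w)) -
      theta ω (x + w) * theta ω (x - w) * (theta ω (y + z) * theta ω (y - z)) -
      theta ω (x + y) * theta ω (x - y) * (theta ω (z + w) * theta ω (z - w)) = 0 := by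
  have hθ := differentiable_theta hω
  have hneg : ∀ a b, theta ω (a - b) = -theta ω (b - a) := fun a b => by
    rw [← theta_neg, neg_sub]
  -- As a function of x the left side is an even-type elliptic polynomial of order 2 that vanishes
  -- at x = w and x = y. For generic y these zeros are incongruent and their sum w + y is not a
  -- period, so it vanishes identically; the excluded y are recovered by analyticity.
  have hgen : ∀ y, theta ω (w - y) ≠ 0 → theta ω (w + y) ≠ 0 →
      theta ω (x + z) * theta ω (x - z) * (theta ω (y + w) * theta ω (y - w)) -
      theta ω (x + w) * theta ω (x - w) * (theta ω (y + z) * theta ω (y - z)) -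
      theta ω (x + y) * theta ω (x - y) * (theta ω (z + w) * theta ω (z - w)) = 0 := by
    intro y h1 h2
    rw [Ne, theta_eq_zero_iff hω] at h1 h2
    have q : ∀ a, QP ω 2 0 0 fun u => theta ω (u + a) * theta ω (u - a) := fun a => by
      simpa using (QP.theta_add hω a).mul (QP.theta_sub hω a)
    have := QP.eq_zero_of_vanish (n := 2) hω (Finset.univ : Finset (Fin 2)) ![w, y] (by
        intro i _ j _ hij
        fin_cases i <;> fin_cases j <;> simp at hij ⊢
        · exact h1
        · exact fun h => h1 (by simpa using neg_mem_lattice h)) (by simp)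
      ((((q z).const_mul (theta ω (y + w) * theta ω (y - w))).sub
        ((q w).const_mul (theta ω (y + z) * theta ω (y - z)))).sub
        ((q y).const_mul (theta ω (z + w) * theta ω (z - w)))) (by
        intro i _
        fin_cases i
        · simp [theta_zero]
          rw [hneg w z, hneg w y, add_comm w z, add_comm w y]; ring
        · simp [theta_zero]; ring) (by simpa using h2) x
    linear_combination this
  have := entire_mul_eq_zero (f := fun y => (theta ω (x + z) * theta ω (x - z) *
      (theta ω (y + w) * theta ω (y - w)) -
      theta ω (x + w) * theta ω (x - w) * (theta ω (y + z) * theta ω (y - z)) -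
      theta ω (x + y) * theta ω (x - y) * (theta ω (z + w) * theta ω (z - w))))
    (g := fun y => theta ω (w - y) * theta ω (w + y)) (by fun_prop) (by fun_prop) (fun y => by
      by_cases h1 : theta ω (w - y) = 0
      · simp [h1]
      by_cases h2 : theta ω (w + y) = 0
      · simp [h2]
      rw [hgen y h1 h2, zero_mul])
  refine (this.resolve_right fun h => ?_) y
  obtain ⟨v, hv⟩ := exists_theta_ne_zero hω
  rcases entire_mul_eq_zero (by fun_prop) (by fun_prop) h with h | h
  · exact hv (by simpa using h (w - v))
  · exact hv (by simpa using h (v - w))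

end Weierstrass

/-! ### Monodromy matrices as products over sites. -/

/-- Extension by a default value of a finite sequence. -/
def extend {N : ℕ} {α : Type*} [Zero α] (f : Fin N → α) (n : ℕ) : α :=
  if h : n < N then f ⟨n, h⟩ else 0

lemma extend_of_lt {N : ℕ} {α : Type*} [Zero α] (f : Fin N → α) {n : ℕ} (h : n < N) :
    extend f n = f ⟨n, h⟩ := dif_pos h

lemma extend_val {N : ℕ} {α : Type*} [Zero α] (f : Fin N → α) (i : Fin N) :
    extend f i = f i := dif_pos i.2

lemma extend_snoc_of_lt {n : ℕ} {α : Type*} [Zero α] (f : Fin n → α) (x : α) {a : ℕ}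
    (h : a < n) : extend (Fin.snoc f x : Fin (n + 1) → α) a = extend f a := by
  rw [extend_of_lt _ (by omega : a < n + 1), extend_of_lt _ h]
  exact Fin.snoc_castSucc (α := fun _ => α) x f ⟨a, h⟩

lemma extend_snoc_last {n : ℕ} {α : Type*} [Zero α] (f : Fin n → α) (x : α) :
    extend (Fin.snoc f x : Fin (n + 1) → α) n = x := by
  rw [extend_of_lt _ (by omega : n < n + 1)]
  exact Fin.snoc_last (α := fun _ => α) x f

lemma sum_snoc {n : ℕ} {α : Type*} [Fintype α] (F : (Fin (n + 1) → α) → ℂ) :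
    ∑ k, F k = ∑ x : α, ∑ k : Fin n → α, F (Fin.snoc k x : Fin (n + 1) → α) := by
  rw [← (Fin.snocEquiv fun _ => α).sum_comp, Fintype.sum_prod_type]
  rfl

/-- The number of down spins among the first `n` sites. -/
def downs (n : ℕ) (h : ℕ → Fin 2) : ℕ := ∑ a ∈ Finset.range n, (h a : ℕ)

lemma downs_succ (n : ℕ) (h : ℕ → Fin 2) : downs (n + 1) h = downs n h + (h n : ℕ) :=
  Finset.sum_range_succ _ _

lemma downs_congr {n : ℕ} {h h' : ℕ → Fin 2} (e : ∀ a < n, h a = h' a) :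
    downs n h = downs n h' :=
  Finset.sum_congr rfl fun a ha => by rw [e a (Finset.mem_range.mp ha)]

lemma downs_extend {N : ℕ} (h : Fin N → Fin 2) : downs N (extend h) = ∑ i, (h i : ℕ) := by
  rw [downs, Finset.sum_range]
  simp [extend_val]

namespace Params

variable {N : ℕ} (P : Params N)

/-- The theta function of the dynamical variable, with the phase of the `R`-matrix absorbed. -/
noncomputable def phi (t : ℂ) : ℂ := exp (I * P.y * t) * P.th t

/-- With the phase absorbed in `phi`, every dynamical weight becomes a theta factor times a ratio of
values of `phi`, so later identities treat y = 0 and y = 1 alike. -/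
lemma phi_div (t s : ℂ) : P.phi (t + s) / P.phi t = exp (I * P.y * s) * P.th (t + s) / P.th t := by
  rw [phi, phi, mul_add, exp_add, mul_assoc, mul_div_mul_left _ _ (exp_ne_zero _)]

lemma th_neg (t : ℂ) : P.th (-t) = -P.th t := theta_neg _ _

lemma phi_div' (t s : ℂ) :
    P.phi (t - s) / P.phi t = exp (-(I * P.y * s)) * P.th (-t + s) / P.th (-t) := by
  rw [sub_eq_add_neg, phi_div, show -t + s = -(t + -s) by ring, th_neg, th_neg, mul_neg,
    mul_neg, neg_div_neg_eq]

/-- The `L`-operator, as a matrix on the auxiliary space, for given output spin `h` and input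
spin `k` of the site. -/
noncomputable def lop (u t : ℂ) (h k : Fin 2) : Matrix (Fin 2) (Fin 2) ℂ :=
  Matrix.of fun g g' => P.R u t (g, h) (g', k)

lemma lop_zero_zero (u t : ℂ) : P.lop u t 0 0 =
    !![P.th (u + P.η), 0; 0, P.th u * (P.phi (t - P.η) / P.phi t)] := by
  rw [phi_div']
  ext g g'
  fin_cases g <;> fin_cases g' <;> simp [lop, R, wa, wb]
  ring

lemma lop_one_one (u t : ℂ) : P.lop u t 1 1 =
    !![P.th u * (P.phi (t + P.η) / P.phi t), 0; 0, P.th (u + P.η)] := by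
  rw [phi_div]
  ext g g'
  fin_cases g <;> fin_cases g' <;> simp [lop, R, wa, wb]
  ring

lemma lop_zero_one (u t : ℂ) : P.lop u t 0 1 =
    !![0, 0; P.th P.η * (P.phi (t - u) / P.phi t), 0] := by
  rw [phi_div']
  ext g g'
  fin_cases g <;> fin_cases g' <;> simp [lop, R, wc]
  ring

lemma lop_one_zero (u t : ℂ) : P.lop u t 1 0 =
    !![0, P.th P.η * (P.phi (t + u) / P.phi t); 0, 0] := by
  rw [phi_div]
  ext g g'
  fin_cases g <;> fin_cases g' <;> simp [lop, R, wc]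
  ring

/-- The ice rule. -/
lemma lop_ice {u t : ℂ} {h k g g' : Fin 2} (hne : P.lop u t h k g g' ≠ 0) :
    (h : ℕ) + g = k + g' := by
  fin_cases h <;> fin_cases k <;> fin_cases g <;> fin_cases g' <;>
    first
    | rfl
    | (exfalso; revert hne; simp [lop, R])

/-- The height after `n` sites. -/
noncomputable def hgt (t : ℂ) (h : ℕ → Fin 2) (n : ℕ) : ℂ :=
  t + P.η * ∑ a ∈ Finset.range n, spin (h a)

lemma hgt_eq (t : ℂ) (h : ℕ → Fin 2) (n : ℕ) : P.hgt t h n = t + P.η * (n - 2 * downs n h) := by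
  simp [hgt, downs, spin, Finset.sum_sub_distrib, Finset.mul_sum]

lemma hgt_succ (t : ℂ) (h : ℕ → Fin 2) (n : ℕ) :
    P.hgt t h (n + 1) = P.hgt t h n + P.η * spin (h n) := by
  rw [hgt, hgt, Finset.sum_range_succ]; ring

lemma hgt_congr {t : ℂ} {n : ℕ} {h h' : ℕ → Fin 2} (e : ∀ a < n, h a = h' a) :
    P.hgt t h n = P.hgt t h' n := by
  rw [hgt_eq, hgt_eq, downs_congr e]

/-- The monodromy matrix of the first `n` sites, as a matrix on the auxiliary space. -/
noncomputable def mon (ξ : ℕ → ℂ) (u t : ℂ) (h k : ℕ → Fin 2) : ℕ → Matrix (Fin 2) (Fin 2) ℂ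
  | 0 => 1
  | n + 1 => P.lop (u - ξ n) (P.hgt t h n) (h n) (k n) * mon ξ u t h k n

lemma mon_congr {ξ : ℕ → ℂ} {u t : ℂ} {n : ℕ} {h h' k k' : ℕ → Fin 2}
    (e : ∀ a < n, h a = h' a) (e' : ∀ a < n, k a = k' a) :
    P.mon ξ u t h k n = P.mon ξ u t h' k' n := by
  induction n with
  | zero => rfl
  | succ n ih =>
    rw [mon, mon, ih (fun a ha => e a (by omega)) (fun a ha => e' a (by omega)), e n (by omega),
      e' n (by omega), P.hgt_congr fun a ha => e a (by omega)]

lemma mon_ice {ξ : ℕ → ℂ} {u t : ℂ} {n : ℕ} {h k : ℕ → Fin 2} {g g' : Fin 2}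
    (hne : P.mon ξ u t h k n g g' ≠ 0) : downs n h + g = downs n k + g' := by
  induction n generalizing g with
  | zero =>
    by_cases hg : g = g'
    · simp [downs, hg]
    · simp [mon, hg] at hne
  | succ n ih =>
    rw [mon, Matrix.mul_apply] at hne
    obtain ⟨γ, -, hγ⟩ := Finset.exists_ne_zero_of_sum_ne_zero hne
    have h1 := P.lop_ice (left_ne_zero_of_mul hγ)
    have h2 := ih (right_ne_zero_of_mul hγ)
    rw [downs_succ, downs_succ]
    omega

lemma siteR_apply (u t : ℂ) (n : Fin N) (g g' : Fin 2) (h k : Fin N → Fin 2) :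
    P.siteR u t n (g, h) (g', k) = if ∀ m, m ≠ n → h m = k m then
      P.lop (u - P.ξ n) (P.hgt t (extend k) n) (h n) (k n) g g' else 0 := by
  have hs : ∑ a ∈ Finset.Iio n, spin (k a) = ∑ a ∈ Finset.range n, spin (extend k a) := by
    refine Finset.sum_bij (fun a _ => (a : ℕ)) (by simp) (by simp [Fin.ext_iff])
      (fun b hb => ?_) (by simp [extend_val])
    have hb := Finset.mem_range.mp hb
    exact ⟨⟨b, hb.trans n.2⟩, by simpa using! hb, rfl⟩
  simp only [siteR, Matrix.of_apply, lop, hgt, hs]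

lemma partial_monodromy (u t : ℂ) (m : ℕ) (hm : m ≤ N) (g g' : Fin 2) (h k : Fin N → Fin 2) :
    ((List.ofFn fun n : Fin N => P.siteR u t n).take m).reverse.prod (g, h) (g', k) =
      if ∀ i : Fin N, m ≤ i → h i = k i then
        P.mon (extend P.ξ) u t (extend h) (extend k) m g g' else 0 := by
  induction m generalizing g h with
  | zero =>
    simp only [List.take_zero, List.reverse_nil, List.prod_nil, zero_le, forall_const, mon,
      Matrix.one_apply, Prod.mk.injEq, ← funext_iff]
    by_cases h1 : g = g' <;> by_cases h2 : h = k <;> simp [h1, h2]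
  | succ m ih =>
    have hmN : m < N := hm
    rw [List.take_add_one, List.getElem?_eq_getElem (by simpa using hmN), List.getElem_ofFn,
      List.reverse_append]
    simp only [Option.toList_some, List.reverse_cons, List.reverse_nil, List.nil_append,
      List.cons_append, List.prod_cons]
    rw [Matrix.mul_apply, Fintype.sum_prod_type]
    -- The only intermediate configuration that contributes: sites below m already carry their
    -- output spins, while site m still has its input spin.
    set l := Function.update h ⟨m, hmN⟩ (k ⟨m, hmN⟩) with hl
    have hone : ∀ γ, ∑ l', P.siteR u t ⟨m, hmN⟩ (g, h) (γ, l') *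
        ((List.ofFn fun n : Fin N => P.siteR u t n).take m).reverse.prod (γ, l') (g', k) =
        P.siteR u t ⟨m, hmN⟩ (g, h) (γ, l) *
        ((List.ofFn fun n : Fin N => P.siteR u t n).take m).reverse.prod (γ, l) (g', k) := by
      intro γ
      refine Finset.sum_eq_single l (fun l' _ hl' => ?_) (by simp)
      rw [siteR_apply, ih (by omega)]
      split_ifs with h1 h2
      · exfalso
        refine hl' (funext fun i => ?_)
        by_cases hi : i = ⟨m, hmN⟩
        · subst hi; simp [hl, h2]
        · simp [hl, hi, h1 i hi]
      all_goals simp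
    rw [Finset.sum_congr rfl fun γ _ => hone γ]
    have hlh : ∀ i, i ≠ ⟨m, hmN⟩ → h i = l i := fun i hi => by simp [hl, hi]
    have hext : ∀ a < m, extend l a = extend h a := fun a ha => by
      rw [extend_of_lt _ (ha.trans hmN), extend_of_lt _ (ha.trans hmN), hlh]
      simp [Fin.ext_iff]; omega
    simp_rw [siteR_apply, if_pos hlh, ih (by omega : m ≤ N),
      P.mon_congr hext (fun _ _ => rfl), P.hgt_congr hext]
    have hlm : l ⟨m, hmN⟩ = k ⟨m, hmN⟩ := by simp [hl]
    have hiff : (∀ i : Fin N, m ≤ i → l i = k i) ↔ (∀ i : Fin N, m + 1 ≤ i → h i = k i) := by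
      constructor
      · intro H i hi
        rw [hlh i (by simp [Fin.ext_iff]; omega)]
        exact H i (by omega)
      · intro H i hi
        by_cases hi' : i = ⟨m, hmN⟩
        · rw [hi', hlm]
        · rw [← hlh i hi']
          have : (i : ℕ) ≠ m := fun e => hi' (Fin.ext e)
          exact H i (by omega)
    simp_rw [hiff]
    split_ifs with H
    · rw [mon, Matrix.mul_apply, extend_of_lt _ hmN, extend_of_lt _ hmN, extend_of_lt _ hmN, hlm]
    · simp

lemma monodromy_apply (u t : ℂ) (g g' : Fin 2) (h k : Fin N → Fin 2) :
    P.monodromy u t (g, h) (g', k) =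
      P.mon (extend P.ξ) u t (extend h) (extend k) N g g' := by
  have := P.partial_monodromy u t N le_rfl g g' h k
  rw [if_pos fun i hi => absurd i.2 (by omega), List.take_of_length_le (by simp)] at this
  exact this

/-- The transfer matrix of the first `n` sites on the space of states, without twist. The last
argument shifts the dynamical parameter. -/
noncomputable def tm (ξ : ℕ → ℂ) (n : ℕ) (τ u : ℂ) :
    Matrix (Fin n → Fin 2) (Fin n → Fin 2) ℂ :=
  Matrix.of fun h k => ∑ g : Fin 2,
    P.mon ξ u (τ + P.η * downs n (extend h)) (extend h) (extend k) n g.rev g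

/-- The two-row `L`-operator. -/
noncomputable def lop2 (u v t : ℂ) (h r : Fin 2) :
    Matrix (Fin 2 × Fin 2) (Fin 2 × Fin 2) ℂ :=
  Matrix.of fun p q => ∑ κ : Fin 2,
    P.lop u t h κ p.1 q.1 * P.lop v (t + P.η * spin q.1) κ r p.2 q.2

/-- The two-row monodromy matrix. -/
noncomputable def mon2 (ξ : ℕ → ℂ) (u v t : ℂ) (h r : ℕ → Fin 2) :
    ℕ → Matrix (Fin 2 × Fin 2) (Fin 2 × Fin 2) ℂ
  | 0 => 1
  | n + 1 => P.lop2 (u - ξ n) (v - ξ n) (P.hgt t h n) (h n) (r n) * mon2 ξ u v t h r n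

lemma sum_mon_mul_mon (ξ : ℕ → ℂ) (u v t : ℂ) (h r : ℕ → Fin 2) (n : ℕ)
    (p q : Fin 2 × Fin 2) :
    ∑ k : Fin n → Fin 2, P.mon ξ u t h (extend k) n p.1 q.1 *
      P.mon ξ v (t + P.η * spin q.1) (extend k) r n p.2 q.2 = P.mon2 ξ u v t h r n p q := by
  induction n generalizing p with
  | zero =>
    by_cases h1 : p.1 = q.1 <;> by_cases h2 : p.2 = q.2 <;>
      simp [mon, mon2, Matrix.one_apply, Prod.ext_iff, h1, h2]
  | succ n ih =>
    rw [sum_snoc]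
    have step : ∀ (κ : Fin 2) (k : Fin n → Fin 2),
        P.mon ξ u t h (extend (Fin.snoc k κ : Fin (n + 1) → Fin 2)) (n + 1) p.1 q.1 *
        P.mon ξ v (t + P.η * spin q.1) (extend (Fin.snoc k κ : Fin (n + 1) → Fin 2)) r
          (n + 1) p.2 q.2 =
        ∑ γ : Fin 2, ∑ δ : Fin 2, P.lop (u - ξ n) (P.hgt t h n) (h n) κ p.1 γ *
          P.lop (v - ξ n) (P.hgt t h n + P.η * spin γ) κ (r n) p.2 δ *
          (P.mon ξ u t h (extend k) n γ q.1 *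
            P.mon ξ v (t + P.η * spin q.1) (extend k) r n δ q.2) := by
      intro κ k
      have e : ∀ a < n, extend (Fin.snoc k κ : Fin (n + 1) → Fin 2) a = extend k a :=
        fun a ha => extend_snoc_of_lt k κ ha
      rw [mon, mon, Matrix.mul_apply, Matrix.mul_apply, P.mon_congr (fun _ _ => rfl) e,
        P.mon_congr e (fun _ _ => rfl), extend_snoc_last, P.hgt_congr e, Finset.sum_mul_sum]
      refine Finset.sum_congr rfl fun γ _ => Finset.sum_congr rfl fun δ _ => ?_
      by_cases h0 : P.mon ξ u t h (extend k) n γ q.1 = 0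
      · simp [h0]
      have hi := P.mon_ice h0
      -- The ice rule of the first row expresses the height of the second row through h and the
      -- auxiliary spin γ, so the summed configuration k drops out of the heights.
      have : P.hgt (t + P.η * spin q.1) (extend k) n = P.hgt t h n + P.η * spin γ := by
        rw [hgt_eq, hgt_eq, spin, spin]
        have hi' : (downs n h : ℂ) + ((γ : ℕ) : ℂ) = downs n (extend k) + ((q.1 : ℕ) : ℂ) := by
          exact_mod_cast hi
        linear_combination 2 * P.η * hi'
      rw [this]; ring
    simp_rw [step]
    rw [mon2, Matrix.mul_apply, Fintype.sum_prod_type]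
    have : ∀ γ δ : Fin 2, P.lop2 (u - ξ n) (v - ξ n) (P.hgt t h n) (h n) (r n) p (γ, δ) *
        P.mon2 ξ u v t h r n (γ, δ) q = ∑ κ : Fin 2, ∑ k : Fin n → Fin 2,
        P.lop (u - ξ n) (P.hgt t h n) (h n) κ p.1 γ *
          P.lop (v - ξ n) (P.hgt t h n + P.η * spin γ) κ (r n) p.2 δ *
          (P.mon ξ u t h (extend k) n γ q.1 *
            P.mon ξ v (t + P.η * spin q.1) (extend k) r n δ q.2) := by
      intro γ δ
      rw [← ih (γ, δ), lop2, Matrix.of_apply, Finset.sum_mul]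
      exact Finset.sum_congr rfl fun κ _ => Finset.mul_sum _ _ _
    simp_rw [this]
    rw [Finset.sum_congr rfl fun κ _ => Finset.sum_comm, Finset.sum_comm]
    refine Finset.sum_congr rfl fun γ _ => ?_
    rw [Finset.sum_congr rfl fun κ _ => Finset.sum_comm, Finset.sum_comm]

/-- The product of two transfer matrices as a trace over two auxiliary spaces. -/
lemma tm_mul_tm (ξ : ℕ → ℂ) (n : ℕ) (τ u v : ℂ) (h r : Fin n → Fin 2) :
    (P.tm ξ n τ u * P.tm ξ n τ v) h r = ∑ q : Fin 2 × Fin 2,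
      P.mon2 ξ u v (τ + P.η * downs n (extend h)) (extend h) (extend r) n
        (q.1.rev, q.2.rev) q := by
  simp_rw [← sum_mon_mul_mon, Matrix.mul_apply, tm, Matrix.of_apply, Finset.sum_mul_sum]
  rw [Fintype.sum_prod_type, Finset.sum_comm]
  refine Finset.sum_congr rfl fun g _ => ?_
  rw [Finset.sum_comm]
  refine Finset.sum_congr rfl fun g' _ => Finset.sum_congr rfl fun k _ => ?_
  by_cases h0 : P.mon ξ u (τ + P.η * downs n (extend h)) (extend h) (extend k) n g.rev g = 0
  · simp [h0]
  have hi := P.mon_ice h0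
  -- The starting height of the second row depends on the down spins of k; by the ice rule it is the
  -- shift by the auxiliary spin that `mon2` requires.
  have : τ + P.η * downs n (extend k) = τ + P.η * downs n (extend h) + P.η * spin g := by
    have hi' : (downs n (extend h) : ℂ) + ((g.rev : ℕ) : ℂ) =
      downs n (extend k) + ((g : ℕ) : ℂ) := by exact_mod_cast hi
    have hr : ((g.rev : ℕ) : ℂ) = 1 - ((g : ℕ) : ℂ) := by fin_cases g <;> simp
    rw [hr] at hi'
    rw [spin]
    linear_combination -P.η * hi'
  rw [this]

end Params

/-! ### Three-term relations and the dynamical Yang-Baxter relation. -/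

/-- The three-term relation between an odd function `θ` and a function `F`. -/
structure ThreeTerm (θ F : ℂ → ℂ) : Prop where
  odd : ∀ u, θ (-u) = -θ u
  rel : ∀ p q i j, F p * F q * (θ (p - q - i - j) * θ (j - i)) -
    F (p - i) * F (q + i) * (θ (p - q - j) * θ j) +
    F (p - j) * F (q + j) * (θ (p - q - i) * θ i) = 0

namespace ThreeTerm

variable {θ F : ℂ → ℂ}

/-- Flipping all spins amounts to reflecting the height, so this symmetry halves the list of weight
identities to be proved. -/
lemma neg (H : ThreeTerm θ F) : ThreeTerm θ fun t => F (-t) where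
  odd := H.odd
  rel p q i j := by
    have := H.rel (-q) (-p) i j
    ring_nf at this ⊢
    linear_combination this

/-- The relation that expresses inversion and the fusion of two rows. -/
lemma square (H : ThreeTerm θ F) (η u t : ℂ) :
    θ η ^ 2 * (F (t + u) * F (t - u)) = θ u ^ 2 * (F (t + η) * F (t - η)) -
      θ (u + η) * θ (u - η) * F t ^ 2 := by
  have := H.rel t t u η
  rw [show t - t - u - η = -(u + η) by ring, show η - u = -(u - η) by ring,
    show t - t - η = -η by ring, show t - t - u = -u by ring] at this
  simp only [H.odd] at this
  linear_combination this

variable (H : ThreeTerm θ F) (η u x t : ℂ)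
include H

lemma aux₁ : θ (u + η) * θ (u + x) * (F (t - x) * F (t + η)) =
    θ (u + x + η) * θ u * (F (t + η - x) * F t) +
      θ x * θ η * (F (t - (u + x)) * F (t + η + u)) := by
  have := H.rel (t - x) (t + η) (-η) u
  rw [show t - x - (t + η) - -η - u = -(u + x) by ring, show u - -η = u + η by ring,
    show t - x - (t + η) - u = -(u + x + η) by ring, show t - x - (t + η) - -η = -x by ring,
    show t - x - -η = t + η - x by ring, show t + η + -η = t by ring,
    show t - x - u = t - (u + x) by ring] at this
  simp only [H.odd] at this
  linear_combination -this

lemma aux₂ : θ (u + x + η) * θ η * (F (t - u) * F (t - x)) =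
    θ (u + η) * θ (x + η) * (F t * F (t - (u + x))) -
      θ u * θ x * (F (t + η) * F (t - (u + x) - η)) := by
  have := H.rel t (t - (u + x)) (-η) u
  rw [show t - (t - (u + x)) - -η - u = x + η by ring, show u - -η = u + η by ring,
    show t - (t - (u + x)) - u = x by ring, show t - (t - (u + x)) - -η = u + x + η by ring,
    show t - -η = t + η by ring, show t - (u + x) + -η = t - (u + x) - η by ring,
    show t - (u + x) + u = t - x by ring] at this
  simp only [H.odd] at this
  linear_combination -this

variable {η u x t}

/-- The `star` lemmas are the nontrivial entries of the exchange relation at a site with spin up.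
After clearing denominators each is one instance of the three-term relation, except `star₂₁`. -/
lemma star₁₁ (h1 : F (t + η) ≠ 0) (h0 : F t ≠ 0) :
    θ (u + η) * (θ (u + x) * (F t / F (t + η))) * (θ η * (F (t - x) / F t)) =
      θ η * (F (t + η - x) / F (t + η)) * (θ (u + x + η) * (θ u * (F t / F (t + η)))) +
        θ x * (F t / F (t + η)) *
          (θ η * (F (t - (u + x)) / F t) * (θ η * (F (t + η + u) / F (t + η)))) := by
  have := H.aux₁ η u x t
  field_simp
  linear_combination θ η * this

lemma star₂₂ (h1 : F (t + η) ≠ 0) (h0 : F t ≠ 0) :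
    θ u * (F (t - η) / F t) * θ (u + x + η) * (θ η * (F (t + x) / F t)) +
      θ η * (F (t - u) / F t) * (θ η * (F (t + η + (u + x)) / F (t + η))) *
        (θ x * (F (t - η) / F t)) =
      θ η * (F (t + η + x) / F (t + η)) * (θ (u + x) * (F (t - η) / F t) * θ (u + η)) := by
  have := H.rel (t + x) (t + η) (-η) (u + x)
  rw [show t + x - (t + η) - -η - (u + x) = -u by ring, show u + x - -η = u + x + η by ring,
    show t + x - (t + η) - (u + x) = -(u + η) by ring, show t + x - (t + η) - -η = x by ring,
    show t + x - -η = t + η + x by ring, show t + η + -η = t by ring,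
    show t + x - (u + x) = t - u by ring] at this
  simp only [H.odd] at this
  field_simp
  linear_combination -θ η * F (t - η) * this

lemma star₂₁ (h1 : F (t + η) ≠ 0) (h0 : F t ≠ 0) (hv : θ (u + x + η) ≠ 0) :
    θ η * (F (t - u) / F t) * (θ η * (F (t + η + (u + x)) / F (t + η))) *
        (θ η * (F (t - x) / F t)) +
      θ u * (F (t - η) / F t) * θ (u + x + η) * (θ x * (F (t + η) / F t)) =
      θ x * (F (t + η + η) / F (t + η)) * (θ (u + x + η) * (θ u * (F t / F (t + η)))) +
        θ η * (F (t + η + x) / F (t + η)) *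
          (θ η * (F (t - (u + x)) / F t) * (θ η * (F (t + η + u) / F (t + η)))) := by
  have e1 := H.aux₂ η u x t
  have e2 := H.neg.aux₂ η u x (-(t + η))
  have e3 := H.square η (u + x + η) t
  have e4 := H.square η (u + x + η) (t + η)
  simp only [neg_sub, neg_neg, neg_add_rev] at e2
  rw [show u - (-η + -t) = t + η + u by ring, show x - (-η + -t) = t + η + x by ring,
    show u + x - (-η + -t) = t + η + (u + x) by ring,
    show -η + (t + η) = t by ring, show η - (-η + -t - (u + x)) = t + η + (u + x + η) by ring] at e2
  rw [show t + (u + x + η) = t + η + (u + x) by ring,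
    show t - (u + x + η) = t - (u + x) - η by ring] at e3
  rw [show t + η - (u + x + η) = t - (u + x) by ring, show t + η - η = t by ring] at e4
  field_simp
  -- The extra factor θ(u+x+η) lets `aux₂` and its reflection rewrite F(t-u)F(t-x) and
  -- F(t+η+u)F(t+η+x). The terms with θ(u+η)θ(x+η) cancel, and `square` at t and at t+η removes the
  -- rest.
  refine mul_left_cancel₀ hv ?_
  linear_combination θ η ^ 2 * F (t + η) * F (t + η + (u + x)) * e1 -
    θ η ^ 2 * F (t - (u + x)) * F t * e2 - θ u * θ x * F (t + η) ^ 2 * e3 +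
    θ u * θ x * F t ^ 2 * e4

lemma star₃ (h1 : F (t + η) ≠ 0) (h0 : F t ≠ 0) :
    θ (u + η) * (θ η * (F (t + η - (u + x)) / F (t + η))) * θ (x + η) =
      θ η * (F (t + η - x) / F (t + η)) * (θ (u + x + η) * (θ η * (F (t + η - u) / F (t + η)))) +
        θ x * (F t / F (t + η)) *
          (θ η * (F (t - (u + x)) / F t) * (θ u * (F (t + η + η) / F (t + η)))) := by
  have := H.aux₂ η u x (t + η)
  rw [show t + η - (u + x) - η = t - (u + x) by ring] at this
  field_simp
  linear_combination -θ η * this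

lemma star₄ (h1 : F (t + η) ≠ 0) (h0 : F t ≠ 0) :
    θ η * (F (t - u) / F t) * (θ (u + x) * (F (t + η + η) / F (t + η))) * θ (x + η) =
      θ x * (F (t + η + η) / F (t + η)) * (θ (u + x + η) * (θ η * (F (t + η - u) / F (t + η)))) +
        θ η * (F (t + η + x) / F (t + η)) *
          (θ η * (F (t - (u + x)) / F t) * (θ u * (F (t + η + η) / F (t + η)))) := by
  have := H.aux₁ η x u t
  rw [add_comm x u] at this
  field_simp
  linear_combination θ η * F (t + η + η) * this

lemma star₅ (hm : F (t - η) ≠ 0) (h0 : F t ≠ 0) :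
    θ η * (F (t - u) / F t) * θ (u + x + η) * (θ η * (F (t - x) / F t)) +
      θ u * (F (t - η) / F t) * (θ η * (F (t - η - (u + x)) / F (t - η))) *
        (θ x * (F (t + η) / F t)) =
      θ (x + η) * (θ η * (F (t - (u + x)) / F t) * θ (u + η)) := by
  have := H.aux₂ η u x t
  rw [show t - (u + x) - η = t - η - (u + x) by ring] at this
  field_simp
  linear_combination θ η * this

lemma star₆ (hm : F (t - η) ≠ 0) (h0 : F t ≠ 0) :
    θ η * (F (t - u) / F t) * θ (u + x + η) * (θ x * (F (t - η) / F t)) +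
      θ u * (F (t - η) / F t) * (θ η * (F (t - η - (u + x)) / F (t - η))) *
        (θ η * (F (t + x) / F t)) =
      θ (x + η) * (θ (u + x) * (F (t - η) / F t) * (θ η * (F (t - η - u) / F (t - η)))) := by
  have := H.rel (t - u) (t - η) (-(u + x)) η
  rw [show t - u - (t - η) - -(u + x) - η = x by ring, show η - -(u + x) = u + x + η by ring,
    show t - u - (t - η) - η = -u by ring, show t - u - (t - η) - -(u + x) = x + η by ring,
    show t - u - -(u + x) = t + x by ring, show t - η + -(u + x) = t - η - (u + x) by ring,
    show t - u - η = t - η - u by ring, show t - η + η = t by ring] at this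
  simp only [H.odd] at this
  field_simp
  linear_combination θ η * this

end ThreeTerm

namespace Params

variable {N : ℕ} (P : Params N)

/-- The phase of phi(p-r) phi(q+r) depends only on p+q, so it is common to the three terms. What is
left is Weierstrass's identity in half-sums and half-differences of p and q. -/
lemma threeTerm (hω : 0 < P.ω.im) : ThreeTerm P.th P.phi where
  odd := P.th_neg
  rel p q i j := by
    have := theta_three_term hω ((p - q) / 2) ((p - q) / 2 - i) ((p + q) / 2)
      ((p - q) / 2 - j)
    have hn : ∀ a b, theta P.ω (a - b) = -theta P.ω (b - a) := fun a b => by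
      rw [← theta_neg, neg_sub]
    have e : ∀ r, P.phi (p - r) * P.phi (q + r) =
        exp (I * P.y * (p + q)) * (P.th (p - r) * P.th (q + r)) := fun r => by
      rw [show I * P.y * (p + q) = I * P.y * (p - r) + I * P.y * (q + r) by ring, exp_add, phi,
        phi]; ring
    have e0 := e 0
    rw [sub_zero, add_zero] at e0
    rw [e0, e, e]
    rw [hn _ ((p + q) / 2), hn _ ((p + q) / 2),
      show (p - q) / 2 + (p + q) / 2 = p by ring, show (p + q) / 2 - (p - q) / 2 = q by ring,
      show (p - q) / 2 - i + ((p - q) / 2 - j) = p - q - i - j by ring,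
      show (p - q) / 2 - i - ((p - q) / 2 - j) = j - i by ring,
      show (p - q) / 2 + ((p - q) / 2 - j) = p - q - j by ring,
      show (p - q) / 2 - ((p - q) / 2 - j) = j by ring,
      show (p - q) / 2 - i + (p + q) / 2 = p - i by ring,
      show (p + q) / 2 - ((p - q) / 2 - i) = q + i by ring,
      show (p - q) / 2 + ((p - q) / 2 - i) = p - q - i by ring,
      show (p - q) / 2 - ((p - q) / 2 - i) = i by ring,
      show (p + q) / 2 + ((p - q) / 2 - j) = p - j by ring,
      show (p + q) / 2 - ((p - q) / 2 - j) = q + j by ring] at this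
    simp only [th]
    linear_combination -exp (I * P.y * (p + q)) * this

end Params

namespace Params

variable {N : ℕ} (P : Params N)

lemma spin_zero : spin 0 = 1 := by simp [spin]

lemma spin_one : spin 1 = -1 := by norm_num [spin]

/-- The face weight that exchanges two rows. -/
noncomputable def face (x t : ℂ) : Matrix (Fin 2 × Fin 2) (Fin 2 × Fin 2) ℂ :=
  Matrix.of fun p q => P.lop x t p.1 q.2 p.2 q.1

/-- The Yang-Baxter relation for one site: the face weight swaps the two spectral parameters and its
height moves by η on passing a spin up. The ice rule kills most of the entries. -/
lemma lop2_mul_face_zero (hω : 0 < P.ω.im) {u x t : ℂ} (h0 : P.phi t ≠ 0)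
    (h1 : P.phi (t + P.η) ≠ 0) (hm : P.phi (t - P.η) ≠ 0) (hv : P.th (u + x + P.η) ≠ 0)
    (r : Fin 2) :
    P.lop2 u (u + x) t 0 r * P.face x t = P.face x (t + P.η) * P.lop2 (u + x) u t 0 r := by
  have H := P.threeTerm hω
  have e₁₁ := H.star₁₁ (u := u) (x := x) h1 h0
  have e₂₂ := H.star₂₂ (u := u) (x := x) h1 h0
  have e₂₁ := H.star₂₁ h1 h0 hv
  have e₃ := H.star₃ (u := u) (x := x) h1 h0
  have e₄ := H.star₄ (u := u) (x := x) h1 h0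
  have e₅ := H.star₅ (u := u) (x := x) hm h0
  have e₆ := H.star₆ (u := u) (x := x) hm h0
  ext ⟨a, b⟩ ⟨c, d⟩
  fin_cases r <;> fin_cases a <;> fin_cases b <;> fin_cases c <;> fin_cases d <;>
    simp [Matrix.mul_apply, Fintype.sum_prod_type, lop2, face, lop_zero_zero, lop_zero_one,
      lop_one_zero, lop_one_one, spin_zero, spin_one, ← sub_eq_add_neg] <;>
    first
    | done
    | ring1
    | linear_combination e₁₁
    | linear_combination e₂₂
    | linear_combination e₂₁
    | linear_combination e₃
    | linear_combination e₄
    | linear_combination e₅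
    | linear_combination e₆

end Params

namespace Params

variable {N : ℕ} (P : Params N)

/-- The mirror image for a spin down, from the same weight identities applied to the reflected
function t ↦ phi(-t) at -t. -/
lemma lop2_mul_face_one (hω : 0 < P.ω.im) {u x t : ℂ} (h0 : P.phi t ≠ 0)
    (h1 : P.phi (t + P.η) ≠ 0) (hm : P.phi (t - P.η) ≠ 0) (hv : P.th (u + x + P.η) ≠ 0)
    (r : Fin 2) :
    P.lop2 u (u + x) t 1 r * P.face x t = P.face x (t - P.η) * P.lop2 (u + x) u t 1 r := by
  have H := P.threeTerm hω
  have h0' : (fun t => P.phi (-t)) (-t) ≠ 0 := by simpa using h0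
  have hm' : (fun t => P.phi (-t)) (-t + P.η) ≠ 0 := by
    simpa [show -P.η + t = t - P.η by ring] using hm
  have h1' : (fun t => P.phi (-t)) (-t - P.η) ≠ 0 := by
    simpa [show P.η + t = t + P.η by ring] using h1
  have e₁₁ := H.neg.star₁₁ (u := u) (x := x) hm' h0'
  have e₂₂ := H.neg.star₂₂ (u := u) (x := x) hm' h0'
  have e₂₁ := H.neg.star₂₁ hm' h0' hv
  have e₃ := H.neg.star₃ (u := u) (x := x) hm' h0'
  have e₄ := H.neg.star₄ (u := u) (x := x) hm' h0'
  have e₅ := H.neg.star₅ (u := u) (x := x) h1' h0'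
  have e₆ := H.neg.star₆ (u := u) (x := x) h1' h0'
  simp only [show -(-t) = t by ring,
    show -(-t + P.η) = t - P.η by ring,
    show -(-t - P.η) = t + P.η by ring,
    show -(-t - x) = t + x by ring,
    show -(-t + P.η - x) = t - P.η + x by ring,
    show -(-t - (u + x)) = t + (u + x) by ring,
    show -(-t + P.η + u) = t - P.η - u by ring,
    show -(-t + x) = t - x by ring,
    show -(-t - u) = t + u by ring,
    show -(-t + P.η + (u + x)) = t - P.η - (u + x) by ring,
    show -(-t + P.η + x) = t - P.η - x by ring,
    show -(-t + P.η + P.η) = t - P.η - P.η by ring,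
    show -(-t + P.η - (u + x)) = t - P.η + (u + x) by ring,
    show -(-t + P.η - u) = t - P.η + u by ring,
    show -(-t - P.η - (u + x)) = t + P.η + (u + x) by ring,
    show -(-t - P.η - u) = t + P.η + u by ring] at e₁₁ e₂₂ e₂₁ e₃ e₄ e₅ e₆
  ext ⟨a, b⟩ ⟨c, d⟩
  fin_cases r <;> fin_cases a <;> fin_cases b <;> fin_cases c <;> fin_cases d <;>
    simp [Matrix.mul_apply, Fintype.sum_prod_type, lop2, face, lop_zero_zero, lop_zero_one,
      lop_one_zero, lop_one_one, spin_zero, spin_one, ← sub_eq_add_neg] <;>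
    first
    | done
    | ring1
    | linear_combination e₁₁
    | linear_combination e₂₂
    | linear_combination e₂₁
    | linear_combination e₃
    | linear_combination e₄
    | linear_combination e₅
    | linear_combination e₆

end Params

/-! ### Commutation and fusion of transfer matrices. -/

namespace Params

variable {N : ℕ} (P : Params N)

/-- All heights reached from `t` are regular. -/
def Regular (t : ℂ) : Prop := ∀ m : ℤ, P.phi (t + P.η * m) ≠ 0

variable {P}

lemma Regular.shift {t : ℂ} (h : P.Regular t) (m : ℤ) : P.Regular (t + P.η * m) := fun l => by
  have := h (m + l)
  push_cast at this
  rwa [mul_add, ← add_assoc] at this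

lemma Regular.ne {t : ℂ} (h : P.Regular t) : P.phi t ≠ 0 := by simpa using h 0

lemma Regular.ne_add {t : ℂ} (h : P.Regular t) : P.phi (t + P.η) ≠ 0 := by simpa using h 1

lemma Regular.ne_sub {t : ℂ} (h : P.Regular t) : P.phi (t - P.η) ≠ 0 := by
  simpa [← sub_eq_add_neg] using h (-1)

lemma Regular.hgt {t : ℂ} (ht : P.Regular t) (h : ℕ → Fin 2) (n : ℕ) :
    P.Regular (P.hgt t h n) := by
  rw [hgt_eq]
  simpa using ht.shift (n - 2 * downs n h)

variable (P)

lemma lop2_mul_face (hω : 0 < P.ω.im) {u x t : ℂ} (ht : P.Regular t)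
    (hv : P.th (u + x + P.η) ≠ 0) (h r : Fin 2) :
    P.lop2 u (u + x) t h r * P.face x t =
      P.face x (t + P.η * spin h) * P.lop2 (u + x) u t h r := by
  fin_cases h
  · simpa [spin_zero] using P.lop2_mul_face_zero hω ht.ne ht.ne_add ht.ne_sub hv r
  · simpa [spin_one, ← sub_eq_add_neg] using
      P.lop2_mul_face_one hω ht.ne ht.ne_add ht.ne_sub hv r

lemma mon2_mul_face (hω : 0 < P.ω.im) {ξ : ℕ → ℂ} {u x t : ℂ} (ht : P.Regular t) {n : ℕ}
    (hv : ∀ a < n, P.th (u + x - ξ a + P.η) ≠ 0) (h r : ℕ → Fin 2) :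
    P.mon2 ξ u (u + x) t h r n * P.face x t =
      P.face x (P.hgt t h n) * P.mon2 ξ (u + x) u t h r n := by
  induction n with
  | zero => simp [mon2, hgt]
  | succ n ih =>
    rw [mon2, mon2, Matrix.mul_assoc, ih fun a ha => hv a (by omega), ← Matrix.mul_assoc,
      show u + x - ξ n = u - ξ n + x by ring, P.lop2_mul_face hω (ht.hgt h n)
        (by rw [show u - ξ n + x = u + x - ξ n by ring]; exact hv n (by omega)), hgt_succ,
      Matrix.mul_assoc]

/-- Unitarity of the face weight; its only nontrivial content is `ThreeTerm.square`. It makes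
conjugation by face weights invertible under a trace. -/
lemma face_mul_face (hω : 0 < P.ω.im) {x t : ℂ} (ht : P.phi t ≠ 0) :
    P.face x t * P.face (-x) t = (P.th (P.η + x) * P.th (P.η - x)) • 1 := by
  have H := P.threeTerm hω
  have e := H.square P.η x t
  have hs : P.th (x - P.η) = -P.th (P.η - x) := by rw [← th_neg, neg_sub]
  rw [hs] at e
  have e1 : P.th P.η * (P.phi (t - x) / P.phi t) * (P.th P.η * (P.phi (t + x) / P.phi t)) -
      P.th x * (P.phi (t - P.η) / P.phi t) * (P.th x * (P.phi (t + P.η) / P.phi t)) =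
      P.th (x + P.η) * P.th (P.η - x) := by
    field_simp
    linear_combination e
  ext ⟨a, b⟩ ⟨c, d⟩
  fin_cases a <;> fin_cases b <;> fin_cases c <;> fin_cases d <;>
    simp [Matrix.mul_apply, Fintype.sum_prod_type, face, lop_zero_zero, lop_zero_one,
      lop_one_zero, lop_one_one, th_neg, add_comm P.η x, ← sub_eq_add_neg,
      neg_add_eq_sub] <;>
    first
    | done
    | ring1
    | linear_combination e1

/-- Reversing both auxiliary spins equals reflecting the height, as only ratios of `phi` occur and
the constant c cancels. This is what an antiperiodic trace needs. -/
lemma face_rev {σ c : ℂ} (hc : c ≠ 0) (hr : ∀ s, P.phi (σ - s) = c * P.phi s) (x t : ℂ)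
    (p q : Fin 2 × Fin 2) :
    P.face x (σ - t) (p.1.rev, p.2.rev) q = P.face x t p (q.1.rev, q.2.rev) := by
  have r1 : ∀ s, P.phi (σ - t + s) = c * P.phi (t - s) := fun s => by rw [← hr]; congr 1; ring
  have r2 : ∀ s, P.phi (σ - t - s) = c * P.phi (t + s) := fun s => by rw [← hr]; congr 1; ring
  obtain ⟨a, b⟩ := p
  obtain ⟨d, e⟩ := q
  fin_cases a <;> fin_cases b <;> fin_cases d <;> fin_cases e <;>
    simp [face, lop_zero_zero, lop_zero_one, lop_one_zero, lop_one_one, r1, r2, hr,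
      mul_div_mul_left _ _ hc]

/-- Transfer matrices commute. -/
lemma tm_comm (hω : 0 < P.ω.im) {ξ : ℕ → ℂ} {n : ℕ} {τ u x c : ℂ} (hτ : P.Regular τ) (hc : c ≠ 0)
    (hr : ∀ s, P.phi (2 * τ + P.η * n - s) = c * P.phi s)
    (hv : ∀ a < n, P.th (u + x - ξ a + P.η) ≠ 0) (h1 : P.th (P.η + x) ≠ 0)
    (h2 : P.th (P.η - x) ≠ 0) :
    P.tm ξ n τ u * P.tm ξ n τ (u + x) = P.tm ξ n τ (u + x) * P.tm ξ n τ u := by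
  ext h r
  rw [tm_mul_tm, tm_mul_tm]
  set t := τ + P.η * downs n (extend h) with htdef
  have ht : P.Regular t := by simpa using hτ.shift (downs n (extend h))
  set M := P.mon2 ξ u (u + x) t (extend h) (extend r) n with hM
  set M' := P.mon2 ξ (u + x) u t (extend h) (extend r) n with hM'
  -- Because t = τ + η·(number of downs), the height after all n sites is exactly the reflection of
  -- t, where `face_rev` applies.
  have hMf : M * P.face x t = P.face x (2 * τ + P.η * n - t) * M' := by
    have := P.mon2_mul_face hω ht hv (extend h) (extend r)
    rw [hgt_eq] at this
    rw [hM, this, htdef]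
    congr 2
    ring
  set X : Matrix (Fin 2 × Fin 2) (Fin 2 × Fin 2) ℂ :=
    Matrix.of fun p q => if q = (p.1.rev, p.2.rev) then 1 else 0 with hX
  have hXl : ∀ (A : Matrix (Fin 2 × Fin 2) (Fin 2 × Fin 2) ℂ) p q,
      (X * A) p q = A (p.1.rev, p.2.rev) q := fun A p q => by
    simp [Matrix.mul_apply, hX]
  have hXr : ∀ (A : Matrix (Fin 2 × Fin 2) (Fin 2 × Fin 2) ℂ) p q,
      (A * X) p q = A p (q.1.rev, q.2.rev) := fun A p q => by
    rw [Matrix.mul_apply, Finset.sum_eq_single (q.1.rev, q.2.rev)]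
    · simp [hX]
    · intro b _ hb
      rw [hX, Matrix.of_apply, if_neg, mul_zero]
      rintro rfl
      simp at hb
    · simp
  have htr : ∀ A : Matrix (Fin 2 × Fin 2) (Fin 2 × Fin 2) ℂ,
      ∑ q : Fin 2 × Fin 2, A (q.1.rev, q.2.rev) q = (X * A).trace := fun A => by
    simp [Matrix.trace, hXl]
  rw [htr, htr]
  have hXf : X * P.face x (2 * τ + P.η * n - t) = P.face x t * X := by
    ext p q
    rw [hXl, hXr, P.face_rev hc hr]
  have hu := P.face_mul_face hω (x := x) ht.ne
  have hu' := P.face_mul_face hω (x := -x) ht.ne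
  rw [neg_neg, ← sub_eq_add_neg, sub_neg_eq_add, mul_comm] at hu'
  set s := P.th (P.η + x) * P.th (P.η - x)
  have hs : s ≠ 0 := mul_ne_zero h1 h2
  -- The usual commutation argument: insert the face weight and its inverse, carry one of them
  -- through the monodromy and the spin flip X, and close up by cyclicity of the trace.
  have : s * (X * M).trace = s * (X * M').trace := by
    calc s * (X * M).trace = (X * M * (P.face x t * P.face (-x) t)).trace := by
          rw [hu]; simp
      _ = (X * (M * P.face x t) * P.face (-x) t).trace := by simp only [Matrix.mul_assoc]
      _ = (P.face x t * (X * M') * P.face (-x) t).trace := by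
          rw [hMf, ← Matrix.mul_assoc X, hXf, Matrix.mul_assoc _ X]
      _ = ((P.face (-x) t * P.face x t) * (X * M')).trace := by
          rw [Matrix.trace_mul_comm, Matrix.mul_assoc]
      _ = s * (X * M').trace := by rw [hu']; simp
  exact mul_left_cancel₀ hs this

/-- The antisymmetric vector of two auxiliary spaces. -/
def singlet (p : Fin 2 × Fin 2) : ℂ := ((p.2 : ℕ) : ℂ) - ((p.1 : ℕ) : ℂ)

/-- The quantum determinant of one site: with spectral parameters u and u - η the antisymmetric
vector is preserved, and the site acts on it by a scalar. -/
lemma lop2_mulVec_singlet (hω : 0 < P.ω.im) {u t : ℂ} (ht : P.Regular t) (h r : Fin 2) :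
    (P.lop2 u (u - P.η) t h r).mulVec singlet = (if h = r then
      P.th (u + P.η) * P.th (u - P.η) * (P.phi t / P.phi (t + P.η * spin h)) else 0) •
        singlet := by
  have h0 := ht.ne
  have h1 := ht.ne_add
  have hm := ht.ne_sub
  have e := (P.threeTerm hω).square P.η u t
  have e1 : ∀ s, P.phi s ≠ 0 →
      P.th P.η * (P.phi (t - u) / P.phi t) * (P.th P.η * (P.phi (t + u) / P.phi s)) -
      P.th u * (P.phi (t - P.η) / P.phi t) * P.th u * (P.phi (t + P.η) / P.phi s) =
      -(P.th (u + P.η) * P.th (u - P.η) * (P.phi t / P.phi s)) := fun s hs => by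
    field_simp
    linear_combination e
  have e2 := e1 _ h1
  have e3 := e1 _ hm
  have a1 : ∀ s, t + P.η + (s - P.η) = t + s := fun s => by ring
  have a4 : ∀ s, t - P.η - (s - P.η) = t - s := fun s => by ring
  ext ⟨a, b⟩
  fin_cases h <;> fin_cases r <;> fin_cases a <;> fin_cases b <;>
    simp [Matrix.mulVec, dotProduct, Fintype.sum_prod_type, lop2, singlet, lop_zero_zero,
      lop_zero_one, lop_one_zero, lop_one_one, spin_zero, spin_one, ← sub_eq_add_neg, a1, a4] <;>
    first
    | done
    | ring1
    | linear_combination e2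
    | linear_combination -e2
    | linear_combination e3
    | linear_combination -e3
    | (field_simp; done)
    | (field_simp; ring1)
    | (field_simp; linear_combination e)
    | (field_simp; linear_combination -e)

/-- At the inhomogeneity the two-row `L`-operator projects on the antisymmetric vector. -/
lemma exists_lop2_eq_vecMulVec {t : ℂ} (ht : P.Regular t) (h r : Fin 2) :
    ∃ x : Fin 2 × Fin 2 → ℂ, P.lop2 0 (-P.η) t h r = Matrix.vecMulVec singlet x := by
  have h0 := ht.ne
  have t0 : P.th 0 = 0 := theta_zero _
  refine ⟨fun q => P.lop2 0 (-P.η) t h r (0, 1) q, ?_⟩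
  ext ⟨a, b⟩ ⟨c, d⟩
  fin_cases h <;> fin_cases r <;> fin_cases a <;> fin_cases b <;> fin_cases c <;> fin_cases d <;>
    simp [Matrix.vecMulVec_apply, lop2, singlet, lop_zero_zero,
      lop_zero_one, lop_one_zero, lop_one_one, spin_zero, spin_one, ← sub_eq_add_neg, t0, th_neg,
      h0]

lemma mon2_mulVec_singlet (hω : 0 < P.ω.im) {ξ : ℕ → ℂ} {u t : ℂ} (ht : P.Regular t)
    (h r : ℕ → Fin 2) (n : ℕ) :
    (P.mon2 ξ u (u - P.η) t h r n).mulVec singlet = (if ∀ a < n, h a = r a then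
      (∏ a ∈ Finset.range n, P.th (u - ξ a + P.η) * P.th (u - ξ a - P.η)) *
        (P.phi t / P.phi (P.hgt t h n)) else 0) • singlet := by
  induction n with
  | zero => simp [mon2, hgt, ht.ne]
  | succ n ih =>
    rw [mon2, ← Matrix.mulVec_mulVec, ih, Matrix.mulVec_smul,
      show u - P.η - ξ n = u - ξ n - P.η by ring, P.lop2_mulVec_singlet hω (ht.hgt h n), smul_smul,
      hgt_succ]
    congr 1
    have h1 := (ht.hgt h n).ne
    have hsplit : (∀ a < n + 1, h a = r a) ↔ (∀ a < n, h a = r a) ∧ h n = r n :=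
      Nat.forall_lt_succ_right
    by_cases c1 : ∀ a < n, h a = r a
    · by_cases c2 : h n = r n
      · rw [if_pos c1, if_pos c2, if_pos (hsplit.mpr ⟨c1, c2⟩), Finset.prod_range_succ]
        field_simp
      · rw [if_neg c2, if_neg fun H => c2 (hsplit.mp H).2, mul_zero]
    · rw [if_neg c1, if_neg fun H => c1 (hsplit.mp H).1, zero_mul]

/-- Site j projects onto the antisymmetric vector because a weight vanishes at u = 0. The later
sites preserve that line by the quantum determinant, and the earlier ones act only on the covector.
-/
lemma exists_mon2_eq_vecMulVec (hω : 0 < P.ω.im) {ξ : ℕ → ℂ} {t : ℂ} (ht : P.Regular t)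
    (h r : ℕ → Fin 2) {j n : ℕ} (hj : j < n) :
    ∃ y, P.mon2 ξ (ξ j) (ξ j - P.η) t h r n = Matrix.vecMulVec singlet y := by
  induction n, hj using Nat.le_induction with
  | base =>
    obtain ⟨x, hx⟩ := P.exists_lop2_eq_vecMulVec (ht.hgt h j) (h j) (r j)
    refine ⟨Matrix.vecMul x (P.mon2 ξ (ξ j) (ξ j - P.η) t h r j), ?_⟩
    rw [Nat.succ_eq_add_one, mon2, sub_self, show ξ j - P.η - ξ j = -P.η by ring, hx,
      Matrix.vecMulVec_mul]
  | succ n hn ih =>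
    obtain ⟨y, hy⟩ := ih
    rw [mon2, hy, Matrix.mul_vecMulVec, show ξ j - P.η - ξ n = ξ j - ξ n - P.η by ring,
      P.lop2_mulVec_singlet hω (ht.hgt h n)]
    exact ⟨_, Matrix.smul_vecMulVec _ _ _ |>.trans (Matrix.vecMulVec_smul _ _ _).symm⟩

/-- Fusion of two transfer matrices at an inhomogeneity. -/
lemma tm_fusion (hω : 0 < P.ω.im) {ξ : ℕ → ℂ} {n : ℕ} {τ c : ℂ} (hτ : P.Regular τ) (hc : c ≠ 0)
    (hr : ∀ s, P.phi (2 * τ + P.η * n - s) = c * P.phi s) {j : ℕ} (hj : j < n) :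
    P.tm ξ n τ (ξ j) * P.tm ξ n τ (ξ j - P.η) =
      (-(c⁻¹ * ∏ a ∈ Finset.range n, P.th (ξ j - ξ a + P.η) * P.th (ξ j - ξ a - P.η))) •
        (1 : Matrix (Fin n → Fin 2) (Fin n → Fin 2) ℂ) := by
  ext h r
  rw [tm_mul_tm]
  set t := τ + P.η * downs n (extend h) with htdef
  have ht : P.Regular t := by simpa using hτ.shift (downs n (extend h))
  obtain ⟨y, hy⟩ := P.exists_mon2_eq_vecMulVec hω (ξ := ξ) ht (extend h) (extend r) hj
  have hs := P.mon2_mulVec_singlet hω (ξ := ξ) (u := ξ j) ht (extend h) (extend r) n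
  rw [hy] at hs
  have h01 := congrFun hs (0, 1)
  have hy2 : (Matrix.vecMulVec singlet y).mulVec singlet (0, 1) = y (0, 1) - y (1, 0) := by
    simp [Matrix.mulVec, dotProduct, Matrix.vecMulVec_apply, Fintype.sum_prod_type, singlet]
    ring
  rw [hy2] at h01
  -- For a rank-one matrix with the singlet as its column, the antiperiodic double trace and the
  -- action on the singlet give the same number y(0,1) - y(1,0) up to sign, so the trace is a
  -- quantum determinant.
  have hsum : ∑ q : Fin 2 × Fin 2, Matrix.vecMulVec singlet y (q.1.rev, q.2.rev) q =
      -(y (0, 1) - y (1, 0)) := by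
    simp [Matrix.vecMulVec_apply, Fintype.sum_prod_type, singlet]
    ring
  rw [hy, hsum, h01]
  have hlast : P.phi (P.hgt t (extend h) n) = c * P.phi t := by
    rw [← hr, hgt_eq, htdef]
    congr 1
    ring
  have hiff : (∀ a < n, extend h a = extend r a) ↔ h = r := by
    constructor
    · intro H
      funext i
      simpa [extend_val] using H i i.2
    · rintro rfl _ _
      rfl
  have h0 := ht.ne
  simp only [hiff, hlast, Matrix.smul_apply, Matrix.one_apply, Pi.smul_apply, singlet]
  split_ifs
  · simp
    field_simp
  · simp

end Params

/-! ### Quasi-periods of the transfer matrix and regularity of the heights. -/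

lemma QP.comp_sub {ω : ℂ} {n : ℕ} {s b : ℂ} {f : ℂ → ℂ} (hf : QP ω n s b f) (a : ℂ) :
    QP ω n s (b + n * a) fun u => f (u - a) where
  diff := hf.diff.comp (by fun_prop)
  pi u := by rw [add_sub_right_comm, hf.pi]
  tau u := by
    rw [add_sub_right_comm, hf.tau, show -(2 * I * n * (u - a)) =
      2 * I * (n * a) + -(2 * I * n * u) by ring, exp_add, mul_add, exp_add]
    ring

namespace Params

variable {N : ℕ} (P : Params N)

lemma qp_phi_add (hω : 0 < P.ω.im) (t : ℂ) :
    QP P.ω 1 P.y (-t + P.y * Real.pi * P.ω / 2) fun u => P.phi (t + u) := by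
  have := (QP.exponential (ω := P.ω) P.y (I * P.y * t)).mul (QP.theta_add hω t)
  convert this using 1
  · ring
  · ring
  · funext u; rw [phi, th]; ring_nf

lemma qp_phi_sub (hω : 0 < P.ω.im) (t : ℂ) :
    QP P.ω 1 (-P.y) (t - P.y * Real.pi * P.ω / 2) fun u => P.phi (t - u) := by
  have := ((QP.exponential (ω := P.ω) (-P.y) (I * P.y * t)).mul
    (QP.theta_sub hω t)).const_mul (-1)
  convert this using 1
  · ring
  · ring
  · funext u; rw [phi, ← neg_sub, th_neg, th]; ring_nf

/-- The quasi-periodicity of the entries of the `L`-operator. -/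
lemma qp_lop (hω : 0 < P.ω.im) (t : ℂ) (h k g g' : Fin 2) :
    QP P.ω 1 (P.y * (spin g - spin g') / 2)
      (P.y * Real.pi * P.ω * (spin g - spin g') / 4 +
        (spin g' * t - spin g * (t + P.η * spin h)) / 2 - P.η / 2)
      fun u => P.lop u t h k g g' := by
  have q1 : QP P.ω 1 0 0 fun u => P.th u := by
    simpa [th] using QP.theta_sub hω 0
  fin_cases h <;> fin_cases k <;> fin_cases g <;> fin_cases g' <;>
    simp only [Fin.zero_eta, Fin.mk_one, Fin.isValue, lop_zero_zero, lop_one_one, lop_zero_one,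
      lop_one_zero, spin_zero, spin_one, Matrix.of_apply, Matrix.cons_val', Matrix.cons_val_zero,
      Matrix.cons_val_one, Matrix.cons_val_fin_one] <;>
    first
    | exact QP.zero
    | (convert QP.theta_add hω P.η using 1 <;> first | ring1 | rfl)
    | (convert q1.const_mul (P.phi (t - P.η) / P.phi t) using 1 <;>
        first | ring1 | (funext u; ring1))
    | (convert q1.const_mul (P.phi (t + P.η) / P.phi t) using 1 <;>
        first | ring1 | (funext u; ring1))
    | (convert (P.qp_phi_add hω t).const_mul (P.th P.η / P.phi t) using 1 <;>
        first | ring1 | (funext u; ring1))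
    | (convert (P.qp_phi_sub hω t).const_mul (P.th P.η / P.phi t) using 1 <;>
        first | ring1 | (funext u; ring1))

/-- The height contributions of successive sites telescope, leaving only the two end heights
weighted by the outer auxiliary spins. -/
lemma qp_mon (hω : 0 < P.ω.im) (ξ : ℕ → ℂ) (t : ℂ) (h k : ℕ → Fin 2) (n : ℕ) (g g' : Fin 2) :
    QP P.ω n (P.y * (spin g - spin g') / 2)
      (P.y * Real.pi * P.ω * (spin g - spin g') / 4 +
        (spin g' * t - spin g * P.hgt t h n) / 2 - n * P.η / 2 + ∑ a ∈ Finset.range n, ξ a)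
      fun u => P.mon ξ u t h k n g g' := by
  induction n generalizing g with
  | zero =>
    by_cases hg : g = g'
    · subst hg
      simpa [mon, hgt] using QP.const (ω := P.ω) 1
    · simpa [mon, hg] using QP.zero
  | succ n ih =>
    simp_rw [mon, Matrix.mul_apply]
    refine QP.sum _ fun γ _ => ?_
    have := ((P.qp_lop hω (P.hgt t h n) (h n) (k n) g γ).comp_sub (ξ n)).mul (ih γ)
    convert this using 1
    · ring
    · ring
    · rw [hgt_succ, Finset.sum_range_succ]; push_cast; ring

/-- The quasi-periodicity of the entries of the transfer matrix. -/
lemma qp_tm (hω : 0 < P.ω.im) (ξ : ℕ → ℂ) (n : ℕ) {τ : ℂ}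
    (hτ : 2 * τ + P.η * n = P.x * Real.pi + P.y * Real.pi * P.ω) (h k : Fin n → Fin 2) :
    QP P.ω n P.y (∑ a ∈ Finset.range n, ξ a - n * P.η / 2 + P.x * Real.pi / 2)
      fun u => P.tm ξ n τ u h k := by
  simp_rw [tm, Matrix.of_apply]
  -- The two antidiagonal entries have different parameters in general; the constraint `hτ` makes
  -- them agree modulo 2 in s and modulo π in b.
  refine QP.sum _ fun g _ => (P.qp_mon hω ξ _ _ _ n g.rev g).congr ?_ ?_
  · fin_cases g
    · exact ⟨P.y, by simp [spin]; ring⟩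
    · exact ⟨0, by simp [spin]⟩
  · rw [hgt_eq]
    fin_cases g
    · refine ⟨0, ?_⟩
      simp [spin]
      linear_combination -hτ / 2
    · refine ⟨P.x, ?_⟩
      simp [spin]
      linear_combination hτ / 2

variable {P}

namespace Admissible


lemma th_eq_zero_iff (hP : P.Admissible) {z : ℂ} : P.th z = 0 ↔ z ∈ lattice P.ω := theta_eq_zero_iff hP.im_pos

lemma two_mul_t₀ : 2 * P.t₀ + P.η * N = P.x * Real.pi + P.y * Real.pi * P.ω := by
  rw [t₀]; ring

lemma th_mul_eta_ne_zero (hP : P.Admissible) {n : ℤ} (hn : n ≠ 0) : P.th (n * P.η) ≠ 0 := fun h =>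
  hP.generic n hn (hP.th_eq_zero_iff.mp h)

lemma th_eta_ne_zero (hP : P.Admissible) : P.th P.η ≠ 0 := by
  simpa using hP.th_mul_eta_ne_zero one_ne_zero

/-- Half-periods that are not excluded by the parity of `N`. -/
lemma half_period_notMem (hP : P.Admissible) {k x y : ℤ} (h : Even (N : ℤ) → Even k → ¬ (Even x ∧ Even y))
    (hk : Even k → Even (N : ℤ)) :
    k * (P.η / 2) + x * (Real.pi / 2) + y * (Real.pi / 2) * P.ω ∉ lattice P.ω := by
  rintro ⟨m, n, hmn⟩
  have hk0 : k = 0 := by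
    by_contra hk0
    exact hP.generic k hk0 ⟨2 * m - x, 2 * n - y, by push_cast; linear_combination 2 * hmn⟩
  subst hk0
  have hω := hP.im_pos
  have hpi := Real.pi_pos
  have him := congrArg Complex.im hmn
  have hre := congrArg Complex.re hmn
  simp [mul_comm, mul_assoc] at him hre
  have h1 : (y : ℝ) = 2 * n := by
    have h3 := him.resolve_right hω.ne'
    have : Real.pi * ((y : ℝ) - 2 * n) = 0 := by linarith
    rcases mul_eq_zero.mp this with h | h
    · linarith
    · linarith
  have h2 : (x : ℝ) = 2 * m := by
    rw [h1] at hre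
    have : Real.pi * ((x : ℝ) - 2 * m) = 0 := by linarith
    rcases mul_eq_zero.mp this with h | h
    · linarith
    · linarith
  refine h (hk (by simp)) (by simp) ⟨⟨m, ?_⟩, ⟨n, ?_⟩⟩
  · have : x = 2 * m := by exact_mod_cast h2
    omega
  · have : y = 2 * n := by exact_mod_cast h1
    omega

lemma xy_not_even (hP : P.Admissible) (h : Even (N : ℤ)) : ¬ (Even (P.x : ℤ) ∧ Even (P.y : ℤ)) := by
  rintro ⟨h1, h2⟩
  have := hP.x_le
  have := hP.y_le
  have hN : Even N := by exact_mod_cast h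
  refine hP.xy_ne hN ⟨?_, ?_⟩
  · obtain ⟨k, hk⟩ := h1; omega
  · obtain ⟨k, hk⟩ := h2; omega

/-- Genericity of η leaves only the case 2m = N. Then N is even, and (x, y) ≠ (0, 0) makes the
remaining half-period a non-period. Hence no dynamical denominator vanishes. -/
lemma t₀_add_notMem (hP : P.Admissible) (m : ℤ) : P.t₀ + P.η * m ∉ lattice P.ω := by
  have := hP.half_period_notMem (k := 2 * m - N) (x := P.x) (y := P.y)
    (fun h _ => hP.xy_not_even h) (fun h => by
      obtain ⟨c, hc⟩ := h
      exact ⟨m - c, by omega⟩)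
  convert this using 1
  rw [t₀]; push_cast; ring

lemma th_t₀_add_ne_zero (hP : P.Admissible) (m : ℤ) : P.th (P.t₀ + P.η * m) ≠ 0 := fun h =>
  hP.t₀_add_notMem m (hP.th_eq_zero_iff.mp h)

lemma th_t₀_ne_zero (hP : P.Admissible) : P.th P.t₀ ≠ 0 := by simpa using hP.th_t₀_add_ne_zero 0

lemma regular (hP : P.Admissible) : P.Regular P.t₀ := fun m => mul_ne_zero (exp_ne_zero _) (hP.th_t₀_add_ne_zero m)

/-- The origin of the sign in `bigAxy`: `phi` is odd when x = y = 0, and even about the half-period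
in the other three cases. -/
lemma phi_reflect (hP : P.Admissible) (s : ℂ) : P.phi (P.x * Real.pi + P.y * Real.pi * P.ω - s) =
    -(-1) ^ (P.x + P.y + P.x * P.y) * P.phi s := by
  have hx := hP.x_le
  have hy := hP.y_le
  have a1 : ∀ s, P.th (Real.pi - s) = P.th s := fun s => by
    rw [th, show (Real.pi : ℂ) - s = -s + Real.pi by ring, theta_add_pi, theta_neg, neg_neg, th]
  have a2 : ∀ s, P.phi (Real.pi * P.ω - s) = exp (I * P.y * (Real.pi * P.ω - s)) *
      (exp (-(I * Real.pi * P.ω) + 2 * I * s) * P.th s) := fun s => by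
    rw [phi, th, show Real.pi * P.ω - s = -s + Real.pi * P.ω by ring, theta_add_pi_mul, theta_neg,
      th]
    ring_nf
  generalize hxx : P.x = x at *
  generalize hyy : P.y = y at *
  interval_cases x <;> interval_cases y <;> simp [phi, hyy, th_neg, a1]
  · have := a2 s
    simp only [phi, hyy] at this
    simp at this
    rw [this, ← mul_assoc, ← exp_add]; ring_nf
  · have := a2 s
    simp only [phi, hyy] at this
    simp at this
    have key : exp (I * Real.pi * P.ω - I * s) *
        (exp (-(I * Real.pi * P.ω) + 2 * I * s) * P.th s) = exp (I * s) * P.th s := by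
      rw [← mul_assoc, ← exp_add]; ring_nf
    rw [show (Real.pi : ℂ) + Real.pi * P.ω - s = Real.pi - -(Real.pi * P.ω - s) by ring, a1,
      th_neg, this, show I * ((Real.pi : ℂ) - -(Real.pi * P.ω - s)) =
        Real.pi * I + (I * Real.pi * P.ω - I * s) by ring, exp_add, exp_pi_mul_I]
    linear_combination key

lemma reflection (hP : P.Admissible) (s : ℂ) : P.phi (2 * P.t₀ + P.η * N - s) =
    -(-1) ^ (P.x + P.y + P.x * P.y) * P.phi s := by
  rw [two_mul_t₀, hP.phi_reflect]

end Admissible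

end Params

/-! ### Separation of variables. -/

section OrderedProduct

variable {ι : Type*} [Fintype ι] [DecidableEq ι]

/-- The ordered product `M (n-1) ^ S (n-1) * ⋯ * M 0 ^ S 0`. -/
def ordProd (M : ℕ → Matrix ι ι ℂ) (S : ℕ → Fin 2) : ℕ → Matrix ι ι ℂ
  | 0 => 1
  | n + 1 => (if S n = 1 then M n else 1) * ordProd M S n

lemma ordProd_congr (M : ℕ → Matrix ι ι ℂ) {S S' : ℕ → Fin 2} {n : ℕ}
    (h : ∀ a < n, S a = S' a) : ordProd M S n = ordProd M S' n := by
  induction n with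
  | zero => rfl
  | succ n ih => rw [ordProd, ordProd, ih fun a ha => h a (by omega), h n (by omega)]

/-- A factor that commutes with all the others can be inserted at its place. -/
lemma ordProd_mul (M : ℕ → Matrix ι ι ℂ) {S : ℕ → Fin 2} {j n : ℕ} (hj : j < n)
    (hc : ∀ i < n, Commute (M i) (M j)) (hS : S j = 0) :
    ordProd M S n * M j = ordProd M (Function.update S j 1) n := by
  induction n, hj using Nat.le_induction with
  | base =>
    have hcc : ∀ m, m ≤ j → Commute (ordProd M S m) (M j) := by
      intro m hm
      induction m with
      | zero => exact Commute.one_left _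
      | succ m ih =>
        rw [ordProd]
        refine Commute.mul_left ?_ (ih (by omega))
        split_ifs
        · exact hc m (by omega)
        · exact Commute.one_left _
    rw [Nat.succ_eq_add_one, ordProd, ordProd, if_neg (by simp [hS]), one_mul,
      Function.update_self, if_pos rfl, (hcc j le_rfl).eq]
    congr 1
    refine ordProd_congr M fun a ha => ?_
    rw [Function.update_of_ne (by omega)]
  | succ n hn ih =>
    rw [ordProd, ordProd, Matrix.mul_assoc, ih fun i hi => hc i (by omega),
      Function.update_of_ne (by omega)]

end OrderedProduct

namespace Params

variable {N : ℕ} (P : Params N)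

/-- The lowering part of the transfer matrix. -/
noncomputable def cm (ξ : ℕ → ℂ) (n : ℕ) (τ u : ℂ) :
    Matrix (Fin n → Fin 2) (Fin n → Fin 2) ℂ :=
  Matrix.of fun h k => P.mon ξ u (τ + P.η * downs n (extend h)) (extend h) (extend k) n 1 0

lemma downs_snoc {n : ℕ} (h : Fin n → Fin 2) (s : Fin 2) :
    downs (n + 1) (extend (Fin.snoc h s : Fin (n + 1) → Fin 2)) =
      downs n (extend h) + (s : ℕ) := by
  rw [downs_succ, extend_snoc_last, downs_congr fun a ha => extend_snoc_of_lt h s ha]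

lemma cm_snoc (ξ : ℕ → ℂ) (n : ℕ) (τ u : ℂ) (h k : Fin n → Fin 2) (s r : Fin 2) :
    P.cm ξ (n + 1) τ u (Fin.snoc h s : Fin (n + 1) → Fin 2)
        (Fin.snoc k r : Fin (n + 1) → Fin 2) =
      ∑ γ, P.lop (u - ξ n) (P.hgt (τ + P.η * s + P.η * downs n (extend h)) (extend h) n) s r 1 γ *
        P.mon ξ u (τ + P.η * s + P.η * downs n (extend h)) (extend h) (extend k) n γ 0 := by
  have e : ∀ a < n, extend (Fin.snoc h s : Fin (n + 1) → Fin 2) a = extend h a :=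
    fun a ha => extend_snoc_of_lt h s ha
  have e' : ∀ a < n, extend (Fin.snoc k r : Fin (n + 1) → Fin 2) a = extend k a :=
    fun a ha => extend_snoc_of_lt k r ha
  rw [cm, Matrix.of_apply, downs_snoc, mon, Matrix.mul_apply, P.mon_congr e e', P.hgt_congr e,
    extend_snoc_last, extend_snoc_last]
  push_cast
  rw [mul_add, add_comm (P.η * (downs n (extend h) : ℂ)), ← add_assoc]

/-- The lowering operator is triangular in the spin of the last site; its diagonal blocks are
lowering operators of the shorter chain, one with τ shifted by η, the other conjugated by `gauge`.
-/
lemma cm_snoc_one_zero (ξ : ℕ → ℂ) (n : ℕ) (τ u : ℂ) (h k : Fin n → Fin 2) :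
    P.cm ξ (n + 1) τ u (Fin.snoc h 1 : Fin (n + 1) → Fin 2)
        (Fin.snoc k 0 : Fin (n + 1) → Fin 2) = 0 := by
  simp [cm_snoc, lop_one_zero]

lemma cm_snoc_one_one (ξ : ℕ → ℂ) (n : ℕ) (τ u : ℂ) (h k : Fin n → Fin 2) :
    P.cm ξ (n + 1) τ u (Fin.snoc h 1 : Fin (n + 1) → Fin 2)
        (Fin.snoc k 1 : Fin (n + 1) → Fin 2) =
      P.th (u - ξ n + P.η) * P.cm ξ n (τ + P.η) u h k := by
  rw [cm_snoc]
  simp [lop_one_one, cm]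

/-- The gauge factor of the last site. -/
noncomputable def gauge (τ : ℂ) (n : ℕ) (h : Fin n → Fin 2) : ℂ :=
  P.phi (τ + P.η * (n - downs n (extend h)))

lemma gauge_ne_zero {τ : ℂ} (hτ : P.Regular τ) {n : ℕ} (h : Fin n → Fin 2) :
    P.gauge τ n h ≠ 0 := by
  simpa using! hτ (n - downs n (extend h))

lemma cm_snoc_zero_zero (ξ : ℕ → ℂ) (n : ℕ) {τ : ℂ} (hτ : P.Regular τ) (u : ℂ)
    (h k : Fin n → Fin 2) :
    P.gauge τ n h * P.cm ξ (n + 1) τ u (Fin.snoc h 0 : Fin (n + 1) → Fin 2)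
        (Fin.snoc k 0 : Fin (n + 1) → Fin 2) =
      P.th (u - ξ n) * (P.cm ξ n τ u h k * P.gauge τ n k) := by
  have hg := P.gauge_ne_zero hτ h
  have e : P.hgt (τ + P.η * downs n (extend h)) (extend h) n =
      τ + P.η * (n - downs n (extend h)) := by rw [hgt_eq]; ring
  rw [cm_snoc]
  simp only [lop_zero_zero, cm, Fin.sum_univ_two, Matrix.of_apply, Fin.val_zero,
    Matrix.cons_val', Matrix.cons_val_zero, Matrix.cons_val_one, Matrix.cons_val_fin_one,
    Nat.cast_zero, mul_zero, add_zero, zero_mul, zero_add, e]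
  by_cases h0 : P.mon ξ u (τ + P.η * downs n (extend h)) (extend h) (extend k) n 1 0 = 0
  · simp [h0]
  have hi : downs n (extend h) + 1 = downs n (extend k) := by simpa using P.mon_ice h0
  rw [gauge, gauge, ← hi]
  rw [gauge] at hg
  rw [show τ + P.η * (n - ((downs n (extend h) + 1 : ℕ) : ℂ)) =
    τ + P.η * (n - downs n (extend h)) - P.η by push_cast; ring]
  field_simp

lemma mon_zero_zero (ξ : ℕ → ℂ) (u t : ℂ) {h k : ℕ → Fin 2} {n : ℕ} (hh : ∀ a < n, h a = 0)
    (hk : ∀ a < n, k a = 0) :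
    P.mon ξ u t h k n 0 0 = ∏ a ∈ Finset.range n, P.th (u - ξ a + P.η) := by
  induction n with
  | zero => simp [mon]
  | succ n ih =>
    rw [mon, Matrix.mul_apply, Finset.prod_range_succ, ← ih (fun a ha => hh a (by omega))
      fun a ha => hk a (by omega), hh n (by omega), hk n (by omega)]
    simp [lop_zero_zero, mul_comm]

lemma eq_zero_of_downs {n : ℕ} {k : Fin n → Fin 2} (h : downs n (extend k) = 0) : k = 0 := by
  rw [downs_extend, Finset.sum_eq_zero_iff] at h
  funext i
  exact Fin.ext (h i (Finset.mem_univ _))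

lemma downs_zero (n : ℕ) : downs n (extend (0 : Fin n → Fin 2)) = 0 := by simp [downs_extend]

/-- At u = ξ_n the weight θ(u - ξ_n) vanishes, so the all-up covector can only be sent to the one
with the last spin flipped. -/
lemma cm_last_zero (ξ : ℕ → ℂ) (n : ℕ) {τ : ℂ} (hτ : P.Regular τ) (k : Fin n → Fin 2)
    (r : Fin 2) :
    P.cm ξ (n + 1) τ (ξ n) (Fin.snoc (0 : Fin n → Fin 2) 0 : Fin (n + 1) → Fin 2)
        (Fin.snoc k r : Fin (n + 1) → Fin 2) =
      if k = 0 ∧ r = 1 then P.th P.η * ∏ a ∈ Finset.range n, P.th (ξ n - ξ a + P.η) else 0 := by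
  have t0 : P.th 0 = 0 := theta_zero _
  fin_cases r
  · simp [cm_snoc, lop_zero_zero, t0]
  · have hr := (hτ.hgt (extend (0 : Fin n → Fin 2)) n).ne
    simp only [cm_snoc, lop_zero_one, Fin.mk_one, Fin.sum_univ_two, Fin.val_zero,
      Nat.cast_zero, mul_zero, add_zero, downs_zero, sub_self, sub_zero, Matrix.of_apply,
      Matrix.cons_val', Matrix.cons_val_zero, Matrix.cons_val_one, Matrix.cons_val_fin_one,
      zero_mul, and_true]
    rw [div_self hr, mul_one]
    split_ifs with hk
    · subst hk
      rw [P.mon_zero_zero] <;> intro a ha <;> rw [extend_of_lt _ ha] <;> rfl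
    · by_cases h0 : P.mon ξ (ξ n) τ (extend (0 : Fin n → Fin 2)) (extend k) n 0 0 = 0
      · rw [h0, mul_zero]
      · have := P.mon_ice h0
        rw [downs_zero] at this
        exact absurd (eq_zero_of_downs (by simpa using this.symm)) hk

lemma ordProd_cm_snoc_one (ξ : ℕ → ℂ) (n : ℕ) (τ : ℂ) (S : ℕ → Fin 2)
    (w : (Fin (n + 1) → Fin 2) → ℂ) (m : ℕ) (h : Fin n → Fin 2) :
    (ordProd (fun j => P.cm ξ (n + 1) τ (ξ j)) S m).mulVec w
        (Fin.snoc h 1 : Fin (n + 1) → Fin 2) =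
      (∏ j ∈ Finset.range m, if S j = 1 then P.th (ξ j - ξ n + P.η) else 1) *
      (ordProd (fun j => P.cm ξ n (τ + P.η) (ξ j)) S m).mulVec
        (fun k => w (Fin.snoc k 1 : Fin (n + 1) → Fin 2)) h := by
  induction m generalizing h with
  | zero => simp [ordProd]
  | succ m ih =>
    rw [ordProd, ordProd, ← Matrix.mulVec_mulVec, ← Matrix.mulVec_mulVec, Finset.prod_range_succ]
    split_ifs
    · rw [Matrix.mulVec, dotProduct, sum_snoc, Fin.sum_univ_two]
      simp_rw [cm_snoc_one_zero, cm_snoc_one_one, ih]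
      rw [Matrix.mulVec, dotProduct, Finset.mul_sum]
      simp only [zero_mul, Finset.sum_const_zero, zero_add]
      exact Finset.sum_congr rfl fun k _ => by ring
    · simp [ih]

lemma ordProd_cm_snoc_zero (ξ : ℕ → ℂ) (n : ℕ) {τ : ℂ} (hτ : P.Regular τ) (S : ℕ → Fin 2)
    {w : (Fin (n + 1) → Fin 2) → ℂ}
    (hw : ∀ k : Fin n → Fin 2, w (Fin.snoc k 1 : Fin (n + 1) → Fin 2) = 0)
    (m : ℕ) (h : Fin n → Fin 2) :
    P.gauge τ n h * (ordProd (fun j => P.cm ξ (n + 1) τ (ξ j)) S m).mulVec w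
        (Fin.snoc h 0 : Fin (n + 1) → Fin 2) =
      (∏ j ∈ Finset.range m, if S j = 1 then P.th (ξ j - ξ n) else 1) *
      (ordProd (fun j => P.cm ξ n τ (ξ j)) S m).mulVec
        (fun k => P.gauge τ n k * w (Fin.snoc k 0 : Fin (n + 1) → Fin 2)) h := by
  have h1 : ∀ m (k : Fin n → Fin 2),
      (ordProd (fun j => P.cm ξ (n + 1) τ (ξ j)) S m).mulVec w
        (Fin.snoc k 1 : Fin (n + 1) → Fin 2) = 0 := fun m k => by
    rw [ordProd_cm_snoc_one, show (fun k => w (Fin.snoc k 1 : Fin (n + 1) → Fin 2)) = 0 from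
      funext hw]
    simp
  induction m generalizing h with
  | zero => simp [ordProd]
  | succ m ih =>
    rw [ordProd, ordProd, ← Matrix.mulVec_mulVec, ← Matrix.mulVec_mulVec, Finset.prod_range_succ]
    split_ifs
    · rw [Matrix.mulVec, dotProduct, sum_snoc, Fin.sum_univ_two]
      simp_rw [h1]
      rw [Matrix.mulVec, dotProduct, Finset.mul_sum, mul_add, Finset.mul_sum]
      simp only [mul_zero, Finset.sum_const_zero, add_zero]
      refine Finset.sum_congr rfl fun k _ => ?_
      rw [← mul_assoc, P.cm_snoc_zero_zero ξ n hτ, mul_assoc, mul_assoc, ih]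
      ring
    · simp [ih]

/-- The covectors built from the lowering operators separate vectors. -/
lemma eq_zero_of_ordProd_cm (hη : P.th P.η ≠ 0) {ξ : ℕ → ℂ} {n : ℕ} {τ : ℂ} (hτ : P.Regular τ)
    (hξ : ∀ i < n, ∀ j < n, i ≠ j → P.th (ξ i - ξ j) ≠ 0 ∧ P.th (ξ i - ξ j + P.η) ≠ 0)
    {w : (Fin n → Fin 2) → ℂ}
    (hw : ∀ S, (ordProd (fun j => P.cm ξ n τ (ξ j)) S n).mulVec w 0 = 0) : w = 0 := by
  induction n generalizing τ with
  | zero =>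
    have := hw 0
    rw [ordProd, Matrix.one_mulVec] at this
    funext h
    rw [Subsingleton.elim h 0, this, Pi.zero_apply]
  | succ n ih =>
    have hξ' : ∀ i < n, ∀ j < n, i ≠ j → P.th (ξ i - ξ j) ≠ 0 ∧ P.th (ξ i - ξ j + P.η) ≠ 0 :=
      fun i hi j hj => hξ i (by omega) j (by omega)
    have hz : (Fin.snoc (0 : Fin n → Fin 2) 0 : Fin (n + 1) → Fin 2) = 0 := by
      funext i
      refine Fin.lastCases ?_ (fun i => ?_) i <;> simp
    -- Words that contain the operator at ξ_n see only the components with last spin down, by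
    -- `cm_last_zero`. On these the remaining word acts as on the shorter chain with τ + η.
    have hw1 : ∀ k : Fin n → Fin 2, w (Fin.snoc k 1 : Fin (n + 1) → Fin 2) = 0 := by
      have hτ' : P.Regular (τ + P.η) := by simpa using hτ.shift 1
      refine congrFun (ih hτ' hξ' (w := fun k => w (Fin.snoc k 1 : Fin (n + 1) → Fin 2))
        fun S => ?_)
      have := hw (Function.update S n 1)
      rw [ordProd, Function.update_self, if_pos rfl, ← Matrix.mulVec_mulVec, Matrix.mulVec,
        dotProduct, ← hz, sum_snoc, Finset.sum_comm,
        ordProd_congr _ (S' := S) (fun a ha => Function.update_of_ne (by omega) _ _),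
        Finset.sum_eq_single 0 (fun k _ hk => by
          rw [Fin.sum_univ_two, P.cm_last_zero ξ n hτ, P.cm_last_zero ξ n hτ]; simp [hk])
          (by simp), Fin.sum_univ_two,
        P.cm_last_zero ξ n hτ, P.cm_last_zero ξ n hτ, ordProd_cm_snoc_one] at this
      simp only [Fin.isValue, true_and, zero_ne_one, if_false, zero_mul, if_true, zero_add] at this
      refine ((mul_eq_zero.mp this).resolve_left (mul_ne_zero hη
        (Finset.prod_ne_zero_iff.mpr fun a ha => ?_)) |> mul_eq_zero.mp).resolve_left
        (Finset.prod_ne_zero_iff.mpr fun a ha => ?_)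
      · have ha := Finset.mem_range.mp ha
        exact (hξ n (by omega) a (by omega) (by omega)).2
      · have ha := Finset.mem_range.mp ha
        split_ifs
        · exact (hξ a (by omega) n (by omega) (by omega)).2
        · exact one_ne_zero
    -- With those components gone, words without the operator at ξ_n see the components with last
    -- spin up, up to the gauge factor.
    have hw0 : ∀ k : Fin n → Fin 2, w (Fin.snoc k 0 : Fin (n + 1) → Fin 2) = 0 := by
      have := ih hτ hξ' (w := fun k => P.gauge τ n k *
        w (Fin.snoc k 0 : Fin (n + 1) → Fin 2)) fun S => by
        have := hw (Function.update S n 0)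
        rw [ordProd, Function.update_self, if_neg (by simp), one_mul, ← hz,
          ordProd_congr _ (S' := S) (fun a ha => Function.update_of_ne (by omega) _ _)] at this
        have h2 := P.ordProd_cm_snoc_zero ξ n hτ S hw1 n 0
        rw [this, mul_zero] at h2
        refine (mul_eq_zero.mp h2.symm).resolve_left (Finset.prod_ne_zero_iff.mpr fun a ha => ?_)
        have ha := Finset.mem_range.mp ha
        split_ifs
        · exact (hξ a (by omega) n (by omega) (by omega)).1
        · exact one_ne_zero
      exact fun k => (mul_eq_zero.mp (congrFun this k)).resolve_left (P.gauge_ne_zero hτ k)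
    funext h
    rw [← Fin.snoc_init_self h]
    rcases Fin.exists_fin_two.mp ⟨h (Fin.last n), rfl⟩ with e | e
    · rw [e]; exact hw0 _
    · rw [e]; exact hw1 _

end Params

namespace Params

variable {N : ℕ} (P : Params N)

lemma tm_apply (ξ : ℕ → ℂ) (n : ℕ) (τ u : ℂ) (h k : Fin n → Fin 2) :
    P.tm ξ n τ u h k = P.cm ξ n τ u h k +
      P.mon ξ u (τ + P.η * downs n (extend h)) (extend h) (extend k) n 0 1 := by
  rw [tm, Matrix.of_apply, Fin.sum_univ_two, cm]
  rfl

lemma cm_eq_zero {ξ : ℕ → ℂ} {n : ℕ} {τ u : ℂ} {h k : Fin n → Fin 2}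
    (hk : downs n (extend k) ≠ downs n (extend h) + 1) : P.cm ξ n τ u h k = 0 := by
  by_contra h0
  exact hk (by simpa using (P.mon_ice h0).symm)

/-- The leading part, with respect to the number of down spins, of products of transfer matrices
is given by the lowering operators. -/
lemma ordProd_tm_leading (ξ : ℕ → ℂ) (n : ℕ) (τ : ℂ) (S : ℕ → Fin 2) {d : ℕ}
    {w : (Fin n → Fin 2) → ℂ} (hw : ∀ h, downs n (extend h) < d → w h = 0) (m : ℕ) :
    (∀ h, downs n (extend h) + downs m S < d →
      (ordProd (fun j => P.tm ξ n τ (ξ j)) S m).mulVec w h = 0) ∧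
    (∀ h, (ordProd (fun j => P.cm ξ n τ (ξ j)) S m).mulVec
        (fun k => if downs n (extend k) = d then w k else 0) h =
      if downs n (extend h) + downs m S = d then
        (ordProd (fun j => P.tm ξ n τ (ξ j)) S m).mulVec w h else 0) := by
  induction m with
  | zero => exact ⟨by simpa [ordProd, downs] using hw, fun h => by
      rw [ordProd, ordProd, Matrix.one_mulVec, Matrix.one_mulVec, show downs 0 S = 0 from rfl,
        add_zero]⟩
  | succ m ih =>
    obtain ⟨ih1, ih2⟩ := ih
    simp only [ordProd, ← Matrix.mulVec_mulVec, downs_succ]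
    rcases Fin.exists_fin_two.mp ⟨S m, rfl⟩ with e | e
    · simpa [e, -Matrix.mulVec_mulVec] using And.intro ih1 ih2
    simp only [e, if_true, Fin.val_one]
    -- A lowering factor removes one down spin and the other part of T adds one. Starting at level d
    -- or above, a word of r factors thus has no component below level d - r, and only lowering
    -- factors reach that level from level d.
    have htm : ∀ h k : Fin n → Fin 2, downs n (extend h) + (downs m S + 1) < d →
        P.tm ξ n τ (ξ m) h k * (ordProd (fun j => P.tm ξ n τ (ξ j)) S m).mulVec w k = 0 := by
      intro h k hh
      by_cases hk : downs n (extend k) + downs m S < d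
      · rw [ih1 k hk, mul_zero]
      · rw [tm_apply, P.cm_eq_zero (by omega), zero_add]
        by_cases h0 : P.mon ξ (ξ m) (τ + P.η * downs n (extend h)) (extend h) (extend k) n 0 1 = 0
        · rw [h0, zero_mul]
        · have := P.mon_ice h0
          simp at this
          omega
    refine ⟨fun h hh => ?_, fun h => ?_⟩
    · exact Finset.sum_eq_zero fun k _ => htm h k hh
    · rw [Matrix.mulVec, Matrix.mulVec, dotProduct, dotProduct]
      simp_rw [ih2]
      split_ifs with hh
      · refine Finset.sum_congr rfl fun k _ => ?_
        rw [tm_apply]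
        by_cases hk : downs n (extend k) = downs n (extend h) + 1
        · have : P.mon ξ (ξ m) (τ + P.η * downs n (extend h)) (extend h) (extend k) n 0 1 = 0 := by
            by_contra h0
            have := P.mon_ice h0
            simp at this
            omega
          rw [this, add_zero, if_pos (by omega)]
        · rw [P.cm_eq_zero hk, zero_mul, zero_add]
          by_cases h0 :
            P.mon ξ (ξ m) (τ + P.η * downs n (extend h)) (extend h) (extend k) n 0 1 = 0
          · rw [h0, zero_mul]
          · have := P.mon_ice h0
            simp at this
            rw [ih1 k (by omega), mul_zero]
      · refine Finset.sum_eq_zero fun k _ => ?_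
        by_cases hk : downs n (extend k) = downs n (extend h) + 1
        · rw [if_neg (by omega), mul_zero]
        · rw [P.cm_eq_zero hk, zero_mul]

/-- The covectors built from the transfer matrices separate vectors. -/
lemma eq_zero_of_ordProd_tm (hη : P.th P.η ≠ 0) {ξ : ℕ → ℂ} {n : ℕ} {τ : ℂ} (hτ : P.Regular τ)
    (hξ : ∀ i < n, ∀ j < n, i ≠ j → P.th (ξ i - ξ j) ≠ 0 ∧ P.th (ξ i - ξ j + P.η) ≠ 0)
    {w : (Fin n → Fin 2) → ℂ}
    (hw : ∀ S, (ordProd (fun j => P.tm ξ n τ (ξ j)) S n).mulVec w 0 = 0) : w = 0 := by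
  -- Induction on the level: if w vanishes below level d, its level-d part is annihilated by all
  -- words in the lowering operators, hence is zero.
  have key : ∀ d h, downs n (extend h) < d → w h = 0 := by
    intro d
    induction d with
    | zero => simp
    | succ d ih =>
      intro h hh
      rcases Nat.lt_succ_iff_lt_or_eq.mp hh with hlt | heq
      · exact ih h hlt
      have := P.eq_zero_of_ordProd_cm hη hτ hξ
        (w := fun k => if downs n (extend k) = d then w k else 0) fun S => by
        rw [(P.ordProd_tm_leading ξ n τ S ih n).2 0]
        split_ifs
        · exact hw S
        · rfl
      simpa [heq] using congrFun this h
  exact funext fun h => key _ h (Nat.lt_succ_self _)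

/-- The quasi-momentum of the eigenvalues of the transfer matrix. -/
noncomputable def momentum : ℂ := ∑ j, P.ξ j - N * P.η / 2 + P.x * Real.pi / 2

/-- The functions of the spectral parameter that satisfy the discrete characterisation of the
spectrum. -/
def Fused (t : ℂ → ℂ) : Prop :=
  QP P.ω N P.y P.momentum t ∧
    ∀ j, t (P.ξ j) * t (P.ξ j - P.η) = P.bigAxy (P.ξ j) * P.bigD (P.ξ j - P.η)

lemma sum_extend {N : ℕ} (f : Fin N → ℂ) : ∑ a ∈ Finset.range N, extend f a = ∑ j, f j := by
  rw [Finset.sum_range]; simp [extend_val]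

/-- The transfer matrix of the chain. -/
noncomputable def tmat (u : ℂ) : Matrix (Fin N → Fin 2) (Fin N → Fin 2) ℂ :=
  P.tm (extend P.ξ) N P.t₀ u

variable {P}

lemma qp_tmat (hP : P.Admissible) (h k : Fin N → Fin 2) :
    QP P.ω N P.y P.momentum fun u => P.tmat u h k := by
  have := P.qp_tm hP.im_pos (extend P.ξ) N Admissible.two_mul_t₀ h k
  rwa [sum_extend] at this

lemma tmat_fusion (hP : P.Admissible) (j : Fin N) :
    P.tmat (P.ξ j) * P.tmat (P.ξ j - P.η) = (P.bigAxy (P.ξ j) * P.bigD (P.ξ j - P.η)) • 1 := by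
  have := P.tm_fusion hP.im_pos (ξ := extend P.ξ) hP.regular (by simp) hP.reflection j.2
  rw [extend_val] at this
  rw [tmat, tmat, this]
  congr 1
  rw [Finset.prod_range, inv_neg, neg_mul, neg_neg, ← inv_pow, bigAxy, bigD, bigA, bigA, mul_assoc,
    ← Finset.prod_mul_distrib]
  congr 1
  · norm_num
  · refine Finset.prod_congr rfl fun a _ => ?_
    rw [extend_val, wa, wa]
    ring_nf

lemma condInh_th (hP : P.Admissible) (hξ : P.CondInh) {i j : Fin N} (hij : i ≠ j) :
    P.th (P.ξ i - P.ξ j) ≠ 0 ∧ P.th (P.ξ i - P.ξ j + P.η) ≠ 0 ∧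
      P.th (P.ξ i - P.ξ j - P.η) ≠ 0 := by
  simp_rw [Ne, hP.th_eq_zero_iff]
  refine ⟨?_, ?_, ?_⟩
  · simpa using hξ i j hij 0 (by simp)
  · simpa using hξ i j hij 1 (by simp)
  · simpa [← sub_eq_add_neg] using hξ i j hij (-1) (by simp)

lemma tmat_commute (hP : P.Admissible) (hξ : P.CondInh) (i j : Fin N) :
    Commute (P.tmat (P.ξ i)) (P.tmat (P.ξ j)) := by
  by_cases hij : i = j
  · rw [hij]
  have := P.tm_comm hP.im_pos (ξ := extend P.ξ) (n := N) (u := P.ξ i) (x := P.ξ j - P.ξ i)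
    hP.regular (by simp) hP.reflection (fun a ha => by
      rw [extend_of_lt _ ha, add_sub_cancel]
      by_cases hja : j = ⟨a, ha⟩
      · rw [← hja, sub_self, zero_add]; exact hP.th_eta_ne_zero
      · exact (condInh_th hP hξ hja).2.1)
    (by rw [add_comm]; exact (condInh_th hP hξ (Ne.symm hij)).2.1)
    (by
      rw [show P.η - (P.ξ j - P.ξ i) = P.ξ i - P.ξ j + P.η by ring]
      exact (condInh_th hP hξ hij).2.1)
  rwa [add_sub_cancel] at this

/-- The separation of variables characterisation of the spectrum. -/
theorem exists_eigenvector_iff (hP : P.Admissible) (hξ : P.CondInh) (t : ℂ → ℂ) :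
    (∃ w : (Fin N → Fin 2) → ℂ, w ≠ 0 ∧ ∀ u, (P.tmat u).mulVec w = t u • w) ↔ P.Fused t := by
  constructor
  · rintro ⟨w, hw0, hw⟩
    obtain ⟨h, hh⟩ : ∃ h, w h ≠ 0 := by
      by_contra! hc
      exact hw0 (funext hc)
    refine ⟨?_, fun j => ?_⟩
    · have : QP P.ω N P.y P.momentum fun u => (w h)⁻¹ * ∑ k, w k * P.tmat u h k :=
        (QP.sum _ fun k _ => (qp_tmat hP h k).const_mul (w k)).const_mul _
      convert this using 1
      funext u
      have e := congrFun (hw u) h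
      rw [Pi.smul_apply, smul_eq_mul, Matrix.mulVec, dotProduct] at e
      rw [Finset.sum_congr rfl fun k _ => mul_comm (w k) (P.tmat u h k), e]
      field_simp
    · have e := congrArg (fun M => Matrix.mulVec M w h) (tmat_fusion hP j)
      simp only [← Matrix.mulVec_mulVec, hw, Matrix.mulVec_smul, Matrix.smul_mulVec,
        Matrix.one_mulVec, Pi.smul_apply, smul_eq_mul] at e
      refine mul_right_cancel₀ hh ?_
      linear_combination e
  -- Coordinates are taken along the covectors ⟨0| ∏ T(ξ_j)^{S_j}; the matrix `E` of these covectors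
  -- is invertible.
  · rintro ⟨hqp, hj⟩
    set M : ℕ → Matrix (Fin N → Fin 2) (Fin N → Fin 2) ℂ :=
      fun j => P.tm (extend P.ξ) N P.t₀ (extend P.ξ j) with hM
    have hMj : ∀ j : Fin N, M j = P.tmat (P.ξ j) := fun j => by rw [hM, tmat]; simp [extend_val]
    have hres : ∀ S : ℕ → Fin 2, ordProd M S N = ordProd M (extend fun i : Fin N => S i) N :=
      fun S => ordProd_congr M fun a ha => by rw [extend_of_lt _ ha]
    set E : Matrix (Fin N → Fin 2) (Fin N → Fin 2) ℂ :=
      Matrix.of fun S k => ordProd M (extend S) N 0 k with hE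
    have hEw : ∀ w S, E.mulVec w S = (ordProd M (extend S) N).mulVec w 0 := fun w S => rfl
    have hinj : ∀ w, E.mulVec w = 0 → w = 0 := fun w hw => by
      refine P.eq_zero_of_ordProd_tm hP.th_eta_ne_zero (ξ := extend P.ξ) hP.regular
        (fun i hi j hj hij => ?_) fun S => ?_
      · rw [extend_of_lt _ hi, extend_of_lt _ hj]
        have := condInh_th hP hξ (i := ⟨i, hi⟩) (j := ⟨j, hj⟩) (by simpa using hij)
        exact ⟨this.1, this.2.1⟩
      · change (ordProd M S N).mulVec w 0 = 0
        rw [hres, ← hEw, hw, Pi.zero_apply]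
    have hunit : IsUnit E := Matrix.mulVec_injective_iff_isUnit.mp fun a b hab => by
      have := hinj (a - b) (by rw [Matrix.mulVec_sub, hab, sub_self])
      exact sub_eq_zero.mp this
    -- In these coordinates an eigenvector must have factorised entries; this defines the candidate.
    obtain ⟨w, hw⟩ := Matrix.mulVec_surjective_iff_isUnit.mpr hunit
      fun S => ∏ j, if S j = 1 then t (P.ξ j) else 1
    have hval : ∀ S : ℕ → Fin 2, (ordProd M S N).mulVec w 0 =
        ∏ j : Fin N, if S j = 1 then t (P.ξ j) else 1 := fun S => by
      rw [hres, ← hEw, hw]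
    refine ⟨w, ?_, fun u => ?_⟩
    · rintro rfl
      have := hval 0
      simp at this
    have hcomm : ∀ j < N, ∀ i < N, Commute (M i) (M j) := fun j hj i hi => by
      rw [hMj ⟨j, hj⟩, hMj ⟨i, hi⟩]; exact tmat_commute hP hξ _ _
    have hone : ∀ (S : ℕ → Fin 2) (j : Fin N), S j = 0 →
        (∏ i : Fin N, if Function.update S j 1 i = 1 then t (P.ξ i) else 1) =
          t (P.ξ j) * ∏ i : Fin N, if S i = 1 then t (P.ξ i) else 1 := fun S j hS => by
      rw [← Finset.mul_prod_erase _ _ (Finset.mem_univ j), Function.update_self, if_pos rfl,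
        ← Finset.mul_prod_erase _ (fun i : Fin N => if S i = 1 then t (P.ξ i) else 1)
        (Finset.mem_univ j), hS, if_neg (by simp), one_mul]
      congr 1
      refine Finset.prod_congr rfl fun i hi => ?_
      rw [Function.update_of_ne]
      exact fun h => Finset.ne_of_mem_erase hi (Fin.ext h)
    refine sub_eq_zero.mp (hinj _ ?_)
    funext S
    rw [Matrix.mulVec_sub, Pi.sub_apply, Matrix.mulVec_smul, Pi.smul_apply, smul_eq_mul, hw,
      Pi.zero_apply, Matrix.mulVec_mulVec]
    have hq : QP P.ω N P.y P.momentum fun u => (E * P.tmat u).mulVec w S -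
        (∏ j, if S j = 1 then t (P.ξ j) else 1) * t u := by
      refine QP.sub ?_ (hqp.const_mul _)
      simp_rw [Matrix.mulVec, dotProduct, Matrix.mul_apply, Finset.sum_mul]
      refine QP.sum _ fun k _ => QP.sum _ fun l _ => ?_
      convert (qp_tmat hP l k).const_mul (E S l * w k) using 1
      funext u; ring
    rw [mul_comm (t u)]
    -- In coordinate S the zeros are ξ_j if S_j = 0 and ξ_j - η if S_j = 1.
    refine QP.eq_zero_of_vanish hP.im_pos Finset.univ (fun j => P.ξ j - P.η * (S j : ℕ))
      (fun i _ j _ hij => ?_) (by simp) hq (fun j _ => ?_) ?_ u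
    · have h0 := hξ i j hij
      generalize S i = a
      generalize S j = b
      fin_cases a <;> fin_cases b <;> simp
      · simpa using h0 0 (by simp)
      · convert h0 1 (by simp) using 1; push_cast; ring
      · convert h0 (-1) (by simp) using 1; push_cast; ring
      · simpa using h0 0 (by simp)
    · rcases Fin.exists_fin_two.mp ⟨S j, rfl⟩ with e | e
      -- At ξ_j the extra operator T(ξ_j) completes the word to the one with S_j = 1.
      · rw [e]
        have h1 := hval (Function.update (extend S) j 1)
        rw [← ordProd_mul M j.2 (hcomm j j.2) (by rw [extend_val, e]), hMj,
          hone _ _ (by rw [extend_val, e])] at h1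
        simp only [extend_val] at h1
        change (ordProd M (extend S) N * P.tmat (P.ξ j - P.η * ((0 : Fin 2) : ℕ))).mulVec w 0 - _ = 0
        simp only [Fin.val_zero, Nat.cast_zero, mul_zero, sub_zero]
        rw [h1, mul_comm, sub_self]
      -- At ξ_j - η the extra operator fuses with the T(ξ_j) already in the word, which leaves the
      -- word with S_j = 0 and the scalar prescribed by `Fused`.
      · set S' := Function.update (extend S) j 0 with hS'
        have hSS : extend S = Function.update S' j 1 := by
          rw [hS', Function.update_idem, ← e, ← extend_val S j, Function.update_eq_self]
        have h0 : S' j = 0 := Function.update_self _ _ _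
        have h1 := hone S' j h0
        have h2 := ordProd_mul M j.2 (hcomm j j.2) h0
        rw [← hSS] at h1 h2
        simp only [extend_val] at h1
        rw [e, h1]
        change (ordProd M (extend S) N * P.tmat (P.ξ j - P.η * ((1 : Fin 2) : ℕ))).mulVec w 0 - _ = 0
        simp only [Fin.val_one, Nat.cast_one, mul_one]
        rw [← h2, hMj, Matrix.mul_assoc, tmat_fusion hP, Matrix.mul_smul, Matrix.mul_one,
          Matrix.smul_mulVec, Pi.smul_apply, smul_eq_mul, hval, ← hj]
        ring
    -- The sum of the zeros misses the exceptional value by (N - 2|S|)η/2 - xπ/2 + yπω/2, where |S|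
    -- is the sum of the S_j; this is not a period.
    · have := hP.half_period_notMem (k := N - 2 * ∑ j, ((S j : ℕ) : ℤ)) (x := -P.x) (y := P.y)
        (fun h _ => by simpa using hP.xy_not_even h) (fun h => by
          obtain ⟨c, hc⟩ := h
          exact ⟨c + ∑ j, ((S j : ℕ) : ℤ), by omega⟩)
      convert this using 1
      rw [Finset.sum_sub_distrib, ← Finset.mul_sum, momentum]
      push_cast
      ring

end Params

/-! ### From the representation space to the matrix `tmat`. -/

lemma shift_apply {N : ℕ} (e : ℤ) (v : StateSpace N) (h : Fin N → Fin 2) (a : ℤ) :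
    shift e v (h, a) = v (h, a - e) := by
  induction v using Finsupp.induction_linear with
  | zero => simp
  | add v w hv hw => simp [map_add, hv, hw]
  | single p c =>
    rw [shift, Finsupp.linearCombination_single, Finsupp.smul_apply, Finsupp.single_apply,
      Finsupp.single_apply, smul_eq_mul]
    have : ((p.1, p.2 + e) = (h, a)) ↔ p = (h, a - e) := by
      rw [Prod.ext_iff, Prod.ext_iff, eq_sub_iff_add_eq]
    simp [this]

lemma totalSpin_apply {N : ℕ} (v : StateSpace N) (p : (Fin N → Fin 2) × ℤ) :
    totalSpin v p = (∑ n, Params.spin (p.1 n)) * v p := by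
  induction v using Finsupp.induction_linear with
  | zero => simp
  | add v w hv hw => simp [map_add, hv, hw, mul_add]
  | single q c =>
    rw [totalSpin, Finsupp.linearCombination_single, Finsupp.smul_apply, Finsupp.single_apply,
      Finsupp.single_apply, smul_eq_mul]
    by_cases h : q = p
    · simp [h, mul_comm]
    · simp [h]

namespace Params

variable {N : ℕ} (P : Params N)

lemma tau_apply (v : StateSpace N) (p : (Fin N → Fin 2) × ℤ) :
    P.tau v p = P.height p.2 * v p := by
  induction v using Finsupp.induction_linear with
  | zero => simp
  | add v w hv hw => simp [map_add, hv, hw, mul_add]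
  | single q c =>
    rw [tau, Finsupp.linearCombination_single, Finsupp.smul_apply, Finsupp.single_apply,
      Finsupp.single_apply, smul_eq_mul]
    by_cases h : q = p
    · simp [h, mul_comm]
    · simp [h]

lemma atTau_apply (M : ℂ → Matrix (Fin N → Fin 2) (Fin N → Fin 2) ℂ) (v : StateSpace N)
    (h : Fin N → Fin 2) (a : ℤ) :
    P.atTau M v (h, a) = ∑ k, M (P.height a) h k * v (k, a) := by
  induction v using Finsupp.induction_linear with
  | zero => simp
  | add v w hv hw => simp [map_add, hv, hw, mul_add, Finset.sum_add_distrib]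
  | single q c =>
    obtain ⟨k, b⟩ := q
    rw [atTau, Finsupp.linearCombination_single, Finsupp.smul_apply, Finsupp.finsetSum_apply,
      Finset.sum_eq_single h (fun l _ hl => by simp [hl]) (by simp),
      Finset.sum_eq_single k (fun l _ hl => by simp [hl.symm]) (by simp)]
    by_cases hb : b = a
    · simp [hb, mul_comm]
    · simp [hb]

lemma transfer_apply (κ u : ℂ) (v : StateSpace N) (h : Fin N → Fin 2) (a : ℤ) :
    P.transfer κ u v (h, a) =
      κ⁻¹ * (∑ k, P.monB u (P.height a) h k * v (k, a + 1)) +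
        κ * ∑ k, P.monC u (P.height a) h k * v (k, a - 1) := by
  simp [transfer, calB, calC, atTau_apply, shift_apply]

lemma sum_spin (h : Fin N → Fin 2) : ∑ n, spin (h n) = N - 2 * downs N (extend h) := by
  simp [spin, downs_extend, Finset.sum_sub_distrib, Finset.mul_sum]

/-- On a basis vector (h, a) the eigenvalue of η S + 2τ differs from xπ + yπω by -2η(a + number of
downs of h). The eigenspace is thus parametrised by spin configurations alone. -/
lemma mem_physicalSpace (hη : P.η ≠ 0) (v : StateSpace N) :
    v ∈ P.physicalSpace ↔ ∀ h a, v (h, a) ≠ 0 → a = -(downs N (extend h) : ℤ) := by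
  rw [physicalSpace, Module.End.mem_eigenspace_iff, Finsupp.ext_iff]
  refine ⟨fun H h a hv => ?_, fun H ⟨h, a⟩ => ?_⟩
  · have := H (h, a)
    simp only [LinearMap.add_apply, LinearMap.smul_apply, Finsupp.add_apply, Finsupp.smul_apply,
      totalSpin_apply, tau_apply, smul_eq_mul, sum_spin, height, t₀] at this
    have h2 : P.η * v (h, a) * (downs N (extend h) + a) = 0 := by linear_combination -this / 2
    have h3 := (mul_eq_zero.mp h2).resolve_left (mul_ne_zero hη hv)
    have h4 : (downs N (extend h) : ℤ) + a = 0 := by exact_mod_cast h3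
    omega
  · simp only [LinearMap.add_apply, LinearMap.smul_apply, Finsupp.add_apply, Finsupp.smul_apply,
      totalSpin_apply, tau_apply, smul_eq_mul, sum_spin, height, t₀]
    by_cases hv : v (h, a) = 0
    · simp [hv]
    · rw [H h a hv]; push_cast; ring

lemma monB_ice {u t : ℂ} {h k : Fin N → Fin 2} (hne : P.monB u t h k ≠ 0) :
    downs N (extend h) = downs N (extend k) + 1 := by
  rw [monB, Matrix.of_apply, monodromy_apply] at hne
  simpa using P.mon_ice hne

lemma monC_ice {u t : ℂ} {h k : Fin N → Fin 2} (hne : P.monC u t h k ≠ 0) :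
    downs N (extend h) + 1 = downs N (extend k) := by
  rw [monC, Matrix.of_apply, monodromy_apply] at hne
  simpa using P.mon_ice hne

lemma tmat_eq (u : ℂ) (h k : Fin N → Fin 2) :
    P.tmat u h k = P.monC u (P.height (-(downs N (extend h) : ℤ))) h k +
      P.monB u (P.height (-(downs N (extend h) : ℤ))) h k := by
  rw [tmat, tm_apply, cm, Matrix.of_apply, monC, Matrix.of_apply, monodromy_apply, monB,
    Matrix.of_apply, monodromy_apply, height]
  have : -P.η * ((-(downs N (extend h) : ℤ) : ℤ) : ℂ) + P.t₀ =
    P.t₀ + P.η * downs N (extend h) := by push_cast; ring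
  rw [this]

/-- On the space of states, the transfer matrix is gauge equivalent to the untwisted one. -/
lemma transfer_apply_of_mem (hη : P.η ≠ 0) {κ : ℂ} (hκ : κ ≠ 0) (u : ℂ) {v : StateSpace N}
    (hv : v ∈ P.physicalSpace) (h : Fin N → Fin 2) (a : ℤ) :
    κ ^ downs N (extend h) * P.transfer κ u v (h, a) = if a = -(downs N (extend h) : ℤ) then
      (P.tmat u).mulVec (fun k => κ ^ downs N (extend k) * v (k, -(downs N (extend k) : ℤ))) h
      else 0 := by
  rw [mem_physicalSpace P hη] at hv
  rw [transfer_apply]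
  split_ifs with ha
  · subst ha
    rw [Matrix.mulVec, dotProduct, mul_add, ← mul_assoc, ← mul_assoc, Finset.mul_sum,
      Finset.mul_sum, ← Finset.sum_add_distrib]
    refine Finset.sum_congr rfl fun k _ => ?_
    rw [tmat_eq]
    by_cases hB : P.monB u (P.height (-(downs N (extend h) : ℤ))) h k = 0
    · by_cases hC : P.monC u (P.height (-(downs N (extend h) : ℤ))) h k = 0
      · simp [hB, hC]
      · have := P.monC_ice hC
        rw [hB, ← this, pow_succ, Nat.cast_add, Nat.cast_one, neg_add, ← sub_eq_add_neg]
        ring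
    · have hi := P.monB_ice hB
      have hC : P.monC u (P.height (-(downs N (extend h) : ℤ))) h k = 0 := by
        by_contra hC
        have := P.monC_ice hC
        omega
      rw [hC, hi, pow_succ, Nat.cast_add, Nat.cast_one, neg_add, neg_add_cancel_right]
      field_simp
      ring
  · have hB : ∀ k, P.monB u (P.height a) h k * v (k, a + 1) = 0 := fun k => by
      by_contra hne
      have h1 := P.monB_ice (left_ne_zero_of_mul hne)
      have h2 := hv k _ (right_ne_zero_of_mul hne)
      omega
    have hC : ∀ k, P.monC u (P.height a) h k * v (k, a - 1) = 0 := fun k => by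
      by_contra hne
      have h1 := P.monC_ice (left_ne_zero_of_mul hne)
      have h2 := hv k _ (right_ne_zero_of_mul hne)
      omega
    simp [hB, hC]

/-- As 𝓑 raises and 𝓒 lowers the number of down spins by one, rescaling by κ to that number removes
the twist; the spectrum does not depend on κ. -/
lemma mem_spectrumT_iff (hη : P.η ≠ 0) {κ : ℂ} (hκ : κ ≠ 0) (t : ℂ → ℂ) :
    t ∈ P.spectrumT κ ↔
      ∃ w : (Fin N → Fin 2) → ℂ, w ≠ 0 ∧ ∀ u, (P.tmat u).mulVec w = t u • w := by
  constructor
  · rintro ⟨v, hv, hv0, ht⟩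
    refine ⟨fun k => κ ^ downs N (extend k) * v (k, -(downs N (extend k) : ℤ)), fun h0 => hv0 ?_,
      fun u => ?_⟩
    · ext ⟨h, a⟩
      by_contra hne
      rw [(mem_physicalSpace P hη v).mp hv h a hne] at hne
      exact hne ((mul_eq_zero.mp (congrFun h0 h)).resolve_left (pow_ne_zero _ hκ))
    · funext h
      have := P.transfer_apply_of_mem hη hκ u hv h (-(downs N (extend h) : ℤ))
      rw [if_pos rfl] at this
      rw [← this, ht, Pi.smul_apply, Finsupp.smul_apply, smul_eq_mul, smul_eq_mul]
      ring
  · rintro ⟨w, hw0, hw⟩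
    set v : StateSpace N := ∑ k : Fin N → Fin 2, Finsupp.single (k, -(downs N (extend k) : ℤ))
      ((κ ^ downs N (extend k))⁻¹ * w k) with hvdef
    have hva : ∀ h a, v (h, a) = if a = -(downs N (extend h) : ℤ) then
        (κ ^ downs N (extend h))⁻¹ * w h else 0 := fun h a => by
      rw [hvdef, Finsupp.finsetSum_apply, Finset.sum_eq_single h
        (fun k _ hk => by simp [hk]) (by simp), Finsupp.single_apply]
      simp [eq_comm]
    have hv : v ∈ P.physicalSpace := (mem_physicalSpace P hη v).mpr fun h a hne => by
      by_contra hc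
      exact hne (by rw [hva, if_neg hc])
    have hvw : (fun k => κ ^ downs N (extend k) * v (k, -(downs N (extend k) : ℤ))) = w := by
      funext k
      rw [hva, if_pos rfl, ← mul_assoc, mul_inv_cancel₀ (pow_ne_zero _ hκ), one_mul]
    refine ⟨v, hv, fun h0 => hw0 ?_, fun u => ?_⟩
    · rw [← hvw, h0]
      funext k
      simp
    · ext ⟨h, a⟩
      have := P.transfer_apply_of_mem hη hκ u hv h a
      rw [hvw, hw] at this
      refine mul_left_cancel₀ (pow_ne_zero (downs N (extend h)) hκ) ?_
      rw [this, Finsupp.smul_apply, hva, Pi.smul_apply, smul_eq_mul, smul_eq_mul]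
      have := pow_ne_zero (downs N (extend h)) hκ
      split_ifs
      · field_simp
      · simp

end Params

/-! ### The T-Q equation in entire form. -/

/-- A quotient of elliptic polynomials is an elliptic polynomial, if it is entire. -/
lemma QP.of_mul {ω : ℂ} {n m : ℕ} {s s' b b' : ℂ} {f g : ℂ → ℂ} (hf : Differentiable ℂ f)
    (hg : QP ω m s' b' g) (hg0 : ∃ z, g z ≠ 0)
    (h : QP ω (n + m) (s + s') (b + b') fun u => f u * g u) : QP ω n s b f := by
  have hne : ¬ ∀ z, g z = 0 := by simpa using hg0
  refine ⟨hf, fun u => ?_, fun u => ?_⟩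
  · refine sub_eq_zero.mp ((entire_mul_eq_zero
      (f := fun u => f (u + Real.pi) - (-1) ^ n * exp (I * Real.pi * s) * f u)
      (by fun_prop) hg.diff (fun z => ?_)).resolve_right hne u)
    have h1 := h.pi z
    simp only [hg.pi, mul_add, exp_add, pow_add] at h1
    have hc : ((-1) ^ m * exp (I * Real.pi * s') : ℂ) ≠ 0 := by simp [exp_ne_zero]
    refine (mul_eq_zero.mp ?_).resolve_left hc
    linear_combination h1
  · refine sub_eq_zero.mp ((entire_mul_eq_zero
      (f := fun u => f (u + Real.pi * ω) -
        thetaFactor ω ^ n * exp (2 * I * b) * exp (-(2 * I * n * u)) * f u)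
      (by fun_prop) hg.diff (fun z => ?_)).resolve_right hne u)
    have h1 := h.tau z
    simp only [hg.tau, Nat.cast_add, mul_add, add_mul, neg_add, exp_add, pow_add] at h1
    have hc : (thetaFactor ω ^ m * exp (2 * I * b') * exp (-(2 * I * m * z)) : ℂ) ≠ 0 := by
      simp [exp_ne_zero, thetaFactor_ne_zero]
    refine (mul_eq_zero.mp ?_).resolve_left hc
    linear_combination h1

lemma QP.congr' {ω : ℂ} {n : ℕ} {s s' b b' : ℂ} {f g : ℂ → ℂ} (hf : QP ω n s b f)
    (hs : ∃ k : ℤ, s' = s + 2 * k) (hb : ∃ k : ℤ, b' = b + Real.pi * k) (hfg : ∀ u, g u = f u) :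
    QP ω n s' b' g := by
  rw [funext hfg]
  exact hf.congr hs hb

namespace Params

variable {N : ℕ} (P : Params N)

lemma bigA_eq_Q (u : ℂ) : P.bigA u = P.Q (fun j => P.ξ j - P.η) u :=
  Finset.prod_congr rfl fun j _ => by rw [wa]; ring_nf

lemma bigD_eq_Q (u : ℂ) : P.bigD u = P.Q P.ξ u := by
  rw [bigD, bigA]
  exact
  Finset.prod_congr rfl fun j _ => by rw [wa, sub_right_comm, sub_add_cancel]

lemma Q_sub (r : Fin N → ℂ) (u c : ℂ) : P.Q r (u - c) = P.Q (fun j => r j + c) u :=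
  Finset.prod_congr rfl fun j _ => by ring_nf

lemma qp_th_sub (hω : 0 < P.ω.im) (a : ℂ) : QP P.ω 1 0 a fun u => P.th (u - a) :=
  QP.theta_sub hω a

lemma qp_Q (hω : 0 < P.ω.im) (r : Fin N → ℂ) : QP P.ω N 0 (∑ j, r j) (P.Q r) := by
  simpa using! QP.finset_prod Finset.univ fun j _ => P.qp_th_sub hω (r j)

lemma exists_th_sub_ne_zero (hω : 0 < P.ω.im) (a : ℂ) : ∃ u, P.th (u - a) ≠ 0 := by
  obtain ⟨z, hz⟩ := exists_theta_ne_zero hω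
  exact ⟨z + a, by simpa [th] using hz⟩

lemma exists_Q_ne_zero (hω : 0 < P.ω.im) (r : Fin N → ℂ) : ∃ u, P.Q r u ≠ 0 :=
  entire_prod_ne_zero _ (fun j _ => (P.qp_th_sub hω (r j)).diff)
    fun _ _ => P.exists_th_sub_ne_zero hω _

lemma qp_term (hω : 0 < P.ω.im) (s c a b : ℂ) (r r' : Fin N → ℂ) :
    QP P.ω (2 * N + 2) s (s * Real.pi * P.ω / 2 + a + b + ∑ j, r j + ∑ j, r' j)
      fun u => exp (I * s * u + c) * (P.th (u - a) * P.th (u - b)) * (P.Q r u * P.Q r' u) := by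
  have := ((QP.exponential (ω := P.ω) s c).mul ((P.qp_th_sub hω a).mul (P.qp_th_sub hω b))).mul
    ((P.qp_Q hω r).mul (P.qp_Q hω r'))
  convert this using 1 <;> ring

/-- The product of the two denominators of the `T`-`Q` equation. -/
noncomputable def denom (μ u : ℂ) : ℂ := P.th (u - μ + P.t₀) * P.th (u - μ + P.η)

/-- The constants in the inhomogeneous term. -/
noncomputable def constA (μ β : ℂ) (r : Fin N → ℂ) : ℂ :=
  β⁻¹ * (-1) ^ (P.x + P.y + P.x * P.y) * P.th P.t₀ / P.th (P.t₀ + P.X r) *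
    (P.Q r (μ - P.η - P.t₀) / P.bigD (μ - P.t₀))

noncomputable def constB (μ β : ℂ) (r : Fin N → ℂ) : ℂ :=
  β * P.th P.t₀ / P.th (P.y * Real.pi * P.ω - P.t₀ - P.X r) * (P.Q r μ / P.bigA (μ - P.η))

/-- The right-hand side of the `T`-`Q` equation, after multiplication by the denominators. -/
noncomputable def tqRhs (μ β : ℂ) (r : Fin N → ℂ) (u : ℂ) : ℂ :=
  β⁻¹ * (-1) ^ (P.x + P.y + P.x * P.y) * (exp (-(I * P.y * u)) *
      (P.th (u - μ) * P.th (u - μ + P.η)) * (P.bigA u * P.Q r (u - P.η))) +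
    β * (exp (I * P.y * (u + P.η)) *
      (P.th (u - μ + P.η + P.t₀) * P.th (u - μ + P.t₀)) * (P.bigD u * P.Q r (u + P.η))) -
    (P.constA μ β r * (exp (-(I * P.y * u)) *
      (P.th (u - μ - P.X r) * P.th (u - μ + P.η)) * (P.bigA u * P.bigD u)) +
    P.constB μ β r * (exp (I * P.y * (u + P.η)) *
      (P.th (u - μ + P.η + P.y * Real.pi * P.ω - P.t₀ - P.X r) * P.th (u - μ + P.t₀)) *
        (P.bigA u * P.bigD u)))

lemma inv_f (μ β u : ℂ) : (P.f μ β (u + P.η))⁻¹ = β * exp (I * P.y * (u + P.η)) *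
    P.th (u - μ + P.η + P.t₀) / P.th (u - μ + P.η) := by
  rw [f, inv_div, exp_neg, show u + P.η - μ = u - μ + P.η by ring]
  simp only [div_eq_mul_inv, mul_inv, inv_inv]
  ring

lemma denom_mul_tq (μ β : ℂ) (r : Fin N → ℂ) {u : ℂ} (h : P.denom μ u ≠ 0) :
    P.denom μ u * (P.f μ β u * P.bigAxy u * P.Q r (u - P.η) +
        P.bigD u / P.f μ β (u + P.η) * P.Q r (u + P.η) -
        P.bigA u * P.bigD u * P.F μ β r u) = P.tqRhs μ β r u := by
  rw [denom] at h
  have h1 := left_ne_zero_of_mul h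
  have h2 := right_ne_zero_of_mul h
  rw [div_eq_mul_inv, inv_f, f, F, bigAxy, denom, tqRhs, constA, constB]
  -- The constant denominators become opaque inverses: no assumption on them is available here, and
  -- only the two factors of `denom` have to be cancelled.
  generalize P.th (P.t₀ + P.X r) = d1
  generalize P.th (P.y * Real.pi * P.ω - P.t₀ - P.X r) = d2
  generalize P.bigA (μ - P.η) = d3
  generalize P.bigD (μ - P.t₀) = d4
  simp only [div_eq_mul_inv]
  generalize d1⁻¹ = d1
  generalize d2⁻¹ = d2
  generalize d3⁻¹ = d3
  generalize d4⁻¹ = d4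
  generalize β⁻¹ = γ
  field_simp

lemma qp_denom (hω : 0 < P.ω.im) (μ : ℂ) :
    QP P.ω 2 0 (μ - P.t₀ + (μ - P.η)) (P.denom μ) := by
  convert (P.qp_th_sub hω (μ - P.t₀)).mul (P.qp_th_sub hω (μ - P.η)) using 1
  · ring
  · funext u; rw [denom]; ring_nf

lemma exists_denom_ne_zero (hω : 0 < P.ω.im) (μ : ℂ) : ∃ u, P.denom μ u ≠ 0 := by
  have e : ∀ a u, P.th (u - μ + a) = P.th (u - (μ - a)) := fun a u => by ring_nf
  simp_rw [denom, e]
  by_contra! h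
  rcases entire_mul_eq_zero (P.qp_th_sub hω _).diff (P.qp_th_sub hω _).diff h with h | h
  · obtain ⟨z, hz⟩ := P.exists_th_sub_ne_zero hω (μ - P.t₀)
    exact hz (h z)
  · obtain ⟨z, hz⟩ := P.exists_th_sub_ne_zero hω (μ - P.η)
    exact hz (h z)

/-- The right-hand side of the `T`-`Q` equation has the quasi-periods of its left-hand side. -/
lemma qp_tqRhs (hω : 0 < P.ω.im) (μ β : ℂ) (r : Fin N → ℂ) :
    QP P.ω (2 * N + 2) P.y
      (2 * μ - P.η + ∑ j, P.ξ j + ∑ j, r j - P.y * Real.pi * P.ω / 2) (P.tqRhs μ β r) := by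
  refine QP.sub (QP.add (QP.const_mul _ ?_) (QP.const_mul _ ?_))
    (QP.add (QP.const_mul _ ?_) (QP.const_mul _ ?_))
  · refine (P.qp_term hω (-P.y) 0 μ (μ - P.η) (fun j => P.ξ j - P.η)
      fun j => r j + P.η).congr' ⟨P.y, by push_cast; ring⟩ ⟨0, ?_⟩ fun u => ?_
    · simp [Finset.sum_add_distrib, Finset.sum_sub_distrib]; ring
    · rw [bigA_eq_Q, Q_sub, sub_sub_eq_add_sub, sub_add_eq_add_sub]
      ring_nf
  -- Here 2t₀ = xπ + yπω - Nη enters; the leftover xπ does not affect the multiplier.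
  · refine (P.qp_term hω P.y (I * P.y * P.η) (μ - P.η - P.t₀) (μ - P.t₀) P.ξ
      fun j => r j - P.η).congr' ⟨0, by push_cast; ring⟩ ⟨P.x, ?_⟩ fun u => ?_
    · simp [Finset.sum_sub_distrib, t₀]; ring
    · rw [bigD_eq_Q, show u + P.η = u - -P.η by ring, Q_sub]
      ring_nf
  -- Replacing Q(u - η) by d(u) changes the sum of the zeros by -X, which the shifted zero μ + X
  -- compensates; this dictates the form of F.
  · refine (P.qp_term hω (-P.y) 0 (μ + P.X r) (μ - P.η) (fun j => P.ξ j - P.η)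
      P.ξ).congr' ⟨P.y, by push_cast; ring⟩ ⟨0, ?_⟩ fun u => ?_
    · simp [Finset.sum_sub_distrib, X]; ring
    · rw [bigA_eq_Q, bigD_eq_Q]
      ring_nf
  · refine (P.qp_term hω P.y (I * P.y * P.η) (μ - P.η - P.y * Real.pi * P.ω + P.t₀ + P.X r)
      (μ - P.t₀) (fun j => P.ξ j - P.η) P.ξ).congr' ⟨0, by push_cast; ring⟩ ⟨0, ?_⟩
      fun u => ?_
    · simp [Finset.sum_sub_distrib, X]; ring
    · rw [bigA_eq_Q, bigD_eq_Q]
      ring_nf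

lemma qp_tqLhs (hω : 0 < P.ω.im) (μ : ℂ) {t : ℂ → ℂ} (ht : QP P.ω N P.y P.momentum t)
    (r : Fin N → ℂ) :
    QP P.ω (2 * N + 2) P.y
      (2 * μ - P.η + ∑ j, P.ξ j + ∑ j, r j - P.y * Real.pi * P.ω / 2)
      fun u => P.denom μ u * (t u * P.Q r u) := by
  convert (P.qp_denom hω μ).mul (ht.mul (P.qp_Q hω r)) using 1
  · ring
  · ring
  · rw [momentum, t₀]; ring

/-- The entire form of the `T`-`Q` equation. -/
lemma solvesTQ_iff (hω : 0 < P.ω.im) {μ β : ℂ} {t : ℂ → ℂ} (ht : Differentiable ℂ t)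
    (r : Fin N → ℂ) :
    P.SolvesTQ μ β t r ↔ P.th (P.t₀ + P.X r) ≠ 0 ∧
      P.th (P.y * Real.pi * P.ω - P.t₀ - P.X r) ≠ 0 ∧
      ∀ u, P.denom μ u * (t u * P.Q r u) = P.tqRhs μ β r u := by
  refine and_congr_right fun _ => and_congr_right fun _ => ⟨fun H u => ?_, fun H u h1 h2 => ?_⟩
  · have hd := (P.qp_denom hω μ).diff
    have hne : ¬ ∀ z, P.denom μ z = 0 := by simpa using P.exists_denom_ne_zero hω μ
    refine sub_eq_zero.mp ((entire_mul_eq_zero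
      (f := fun u => P.denom μ u * (t u * P.Q r u) - P.tqRhs μ β r u)
      ((hd.fun_mul (ht.fun_mul (P.qp_Q hω r).diff)).fun_sub (P.qp_tqRhs hω μ β r).diff)
      hd fun z => ?_).resolve_right hne u)
    by_cases hz : P.denom μ z = 0
    · rw [hz, mul_zero]
    · have := H z (left_ne_zero_of_mul hz) (right_ne_zero_of_mul hz)
      rw [this, P.denom_mul_tq μ β r hz, sub_self, zero_mul]
  · have hd : P.denom μ u ≠ 0 := mul_ne_zero h1 h2
    refine mul_left_cancel₀ hd ?_
    rw [H, P.denom_mul_tq μ β r hd]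

end Params

/-! ### The T-Q equation at the inhomogeneities. -/

namespace Params

variable {N : ℕ} {P : Params N}

lemma bigD_xi (j : Fin N) : P.bigD (P.ξ j) = 0 := by
  rw [bigD_eq_Q]
  exact Finset.prod_eq_zero (Finset.mem_univ j) (by rw [sub_self]; exact theta_zero _)

lemma bigA_xi_sub (j : Fin N) : P.bigA (P.ξ j - P.η) = 0 := by
  rw [bigA_eq_Q]
  exact Finset.prod_eq_zero (Finset.mem_univ j) (by rw [sub_self]; exact theta_zero _)

lemma bigA_xi_ne_zero (hP : P.Admissible) (hξ : P.CondInh) (j : Fin N) : P.bigA (P.ξ j) ≠ 0 :=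
  Finset.prod_ne_zero_iff.mpr fun i _ => by
    rw [wa]
    by_cases hij : j = i
    · rw [hij, sub_self, zero_add]; exact hP.th_eta_ne_zero
    · exact (condInh_th hP hξ hij).2.1

lemma bigD_xi_sub_ne_zero (hP : P.Admissible) (hξ : P.CondInh) (j : Fin N) :
    P.bigD (P.ξ j - P.η) ≠ 0 :=
  bigD_eq_Q P _ ▸ Finset.prod_ne_zero_iff.mpr fun i _ => by
    by_cases hij : j = i
    · rw [hij, sub_right_comm, sub_self, zero_sub, th_neg]
      exact neg_ne_zero.mpr hP.th_eta_ne_zero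
    · rw [sub_right_comm]; exact (condInh_th hP hξ hij).2.2

lemma sign_ne_zero : ((-1) ^ (P.x + P.y + P.x * P.y) : ℂ) ≠ 0 := by simp

lemma bigAxy_xi_ne_zero (hP : P.Admissible) (hξ : P.CondInh) (j : Fin N) :
    P.bigAxy (P.ξ j) ≠ 0 := mul_ne_zero sign_ne_zero (bigA_xi_ne_zero hP hξ j)

lemma condMu_th (hP : P.Admissible) {μ : ℂ} (hμ : P.CondMu μ) (j : Fin N) :
    P.th (P.ξ j - μ) ≠ 0 ∧ P.th (P.ξ j - μ + P.η) ≠ 0 ∧ P.th (P.ξ j - μ + P.t₀) ≠ 0 ∧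
      P.th (P.ξ j - μ + P.t₀ - P.η) ≠ 0 := by
  have key : ∀ {z w : ℂ}, w ∉ lattice P.ω → z = -w → P.th z ≠ 0 := fun {z w} hw e h => by
    rw [hP.th_eq_zero_iff, e] at h
    exact hw (by simpa using neg_mem_lattice h)
  obtain ⟨h1, h2, h3, h4⟩ := hμ j
  exact ⟨key h1 (by ring), key h2 (by ring), key h3 (by ring), key h4 (by ring)⟩

/-- The transformation between `t` at the inhomogeneities and the Baxter equation there. -/
noncomputable def ratio (P : Params N) (μ : ℂ) (t : ℂ → ℂ) (j : Fin N) : ℂ :=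
  P.th (P.ξ j - μ + P.t₀) * t (P.ξ j) * exp (I * P.y * P.ξ j) /
    (P.th (P.ξ j - μ) * P.bigAxy (P.ξ j))

/-- The `T`-`Q` equation at `ξ_j`. -/
lemma tq_at_xi (hP : P.Admissible) (hξ : P.CondInh) {μ β : ℂ} (hβ : β ≠ 0) (hμ : P.CondMu μ)
    (t : ℂ → ℂ) (r : Fin N → ℂ) (j : Fin N) :
    P.denom μ (P.ξ j) * (t (P.ξ j) * P.Q r (P.ξ j)) = P.tqRhs μ β r (P.ξ j) ↔
      P.Q r (P.ξ j - P.η) = β * P.ratio μ t j * P.Q r (P.ξ j) := by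
  obtain ⟨h1, h2, h3, h4⟩ := condMu_th hP hμ j
  have ha := bigAxy_xi_ne_zero hP hξ j
  have he := exp_ne_zero (I * P.y * P.ξ j)
  -- Since d(ξ_j) = 0, only the term with Q(u - η) survives on the right.
  rw [denom, tqRhs, bigD_xi, ratio, exp_neg]
  have e : P.bigAxy (P.ξ j) = (-1) ^ (P.x + P.y + P.x * P.y) * P.bigA (P.ξ j) := rfl
  constructor
  · intro H
    rw [div_eq_mul_inv]
    field_simp
    field_simp at H
    rw [e]
    refine mul_left_cancel₀ h2 ?_
    linear_combination -H
  · intro H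
    field_simp at H ⊢
    rw [e] at H
    linear_combination -P.th (P.ξ j - μ + P.η) * H

/-- The `T`-`Q` equation at `ξ_j - η`. -/
lemma tq_at_xi_sub (hP : P.Admissible) {μ β : ℂ} (hμ : P.CondMu μ)
    (t : ℂ → ℂ) (r : Fin N → ℂ) (j : Fin N) :
    P.denom μ (P.ξ j - P.η) * (t (P.ξ j - P.η) * P.Q r (P.ξ j - P.η)) =
        P.tqRhs μ β r (P.ξ j - P.η) ↔
      P.th (P.ξ j - μ) * t (P.ξ j - P.η) * P.Q r (P.ξ j - P.η) =
        β * exp (I * P.y * P.ξ j) * P.th (P.ξ j - μ + P.t₀) * P.bigD (P.ξ j - P.η) *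
          P.Q r (P.ξ j) := by
  obtain ⟨h1, h2, h3, h4⟩ := condMu_th hP hμ j
  -- Since a(ξ_j - η) = 0, only the term with Q(u + η) survives on the right.
  rw [denom, tqRhs, bigA_xi_sub]
  rw [show P.ξ j - P.η - μ + P.t₀ = P.ξ j - μ + P.t₀ - P.η by ring,
    show P.ξ j - P.η - μ + P.η = P.ξ j - μ by ring, sub_add_cancel]
  constructor
  · intro H
    refine mul_left_cancel₀ h4 ?_
    linear_combination H
  · intro H
    linear_combination P.th (P.ξ j - μ + P.t₀ - P.η) * H

/-- A solution of the `T`-`Q` equation gives an eigenvalue. -/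
lemma fused_of_hasQ (hP : P.Admissible) (hξ : P.CondInh) {μ β : ℂ} (hβ : β ≠ 0)
    (hμ : P.CondMu μ) {t : ℂ → ℂ} (ht : Differentiable ℂ t) (h : P.HasQ μ β t) : P.Fused t := by
  obtain ⟨r, hr, hs⟩ := h
  obtain ⟨-, -, H⟩ := (P.solvesTQ_iff hP.im_pos ht r).mp hs
  have hQ := P.qp_Q hP.im_pos r
  have hd := P.qp_denom hP.im_pos μ
  refine ⟨?_, fun j => ?_⟩
  · refine QP.of_mul (m := 2 + N) ht (hd.mul hQ) ?_ ?_
    · by_contra! hc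
      rcases entire_mul_eq_zero hd.diff hQ.diff hc with h0 | h0
      · obtain ⟨z, hz⟩ := P.exists_denom_ne_zero hP.im_pos μ
        exact hz (h0 z)
      · obtain ⟨z, hz⟩ := P.exists_Q_ne_zero hP.im_pos r
        exact hz (h0 z)
    · have := P.qp_tqRhs hP.im_pos μ β r
      convert this using 1
      · ring
      · ring
      · rw [momentum, t₀]; ring
      · funext u; rw [← H]; ring
  · have e1 := (tq_at_xi hP hξ hβ hμ t r j).mp (H _)
    have e2 := (tq_at_xi_sub hP hμ t r j).mp (H _)
    obtain ⟨h1, h2, h3, h4⟩ := condMu_th hP hμ j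
    have ha := bigAxy_xi_ne_zero hP hξ j
    have hdd := bigD_xi_sub_ne_zero hP hξ j
    have he := exp_ne_zero (I * P.y * P.ξ j)
    -- If Q(ξ_j) vanished, the equation at ξ_j would make Q(ξ_j - η) vanish too, which is excluded.
    -- So Q cancels between the two equations and the fusion relation remains.
    have hQ1 : P.Q r (P.ξ j) ≠ 0 := fun h0 => hr j ⟨h0, by rw [e1, h0, mul_zero]⟩
    rw [e1, ratio] at e2
    field_simp at e2
    linear_combination e2

lemma th_reflect_ne_zero (hP : P.Admissible) {z : ℂ} (h : P.th z ≠ 0) :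
    P.th (P.y * Real.pi * P.ω - z) ≠ 0 := by
  rw [Ne, hP.th_eq_zero_iff] at h ⊢
  rintro ⟨m, n, hmn⟩
  exact h ⟨-m, P.y - n, by push_cast; linear_combination -hmn⟩

/-- The Bethe roots are determined by the `T`-`Q` equation at the inhomogeneities. -/
lemma solvesTQ_of_roots (hP : P.Admissible) (hξ : P.CondInh) {μ β : ℂ} (hβ : β ≠ 0)
    (hμ : P.CondMu μ) {t : ℂ → ℂ} (ht : P.Fused t) {r : Fin N → ℂ}
    (hX : P.th (P.t₀ + P.X r) ≠ 0)
    (hr : ∀ j, P.Q r (P.ξ j - P.η) = β * P.ratio μ t j * P.Q r (P.ξ j)) :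
    P.SolvesTQ μ β t r := by
  obtain ⟨hqp, hf⟩ := ht
  have hX' := th_reflect_ne_zero hP hX
  rw [← sub_sub] at hX'
  refine (P.solvesTQ_iff hP.im_pos hqp.diff r).mpr ⟨hX, hX', fun u => sub_eq_zero.mp ?_⟩
  have hmem : ∀ {z w : ℂ}, P.th z ≠ 0 → w = z ∨ w = -z → w ∉ lattice P.ω :=
    fun {z w} hz hw hm => by
      rw [Ne, hP.th_eq_zero_iff] at hz
      rcases hw with rfl | rfl
      · exact hz hm
      · exact hz (by simpa using neg_mem_lattice hm)
  have hηξ : ∀ i j, P.th (P.ξ i - P.ξ j + P.η) ≠ 0 := fun i j => by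
    by_cases hij : i = j
    · rw [hij, sub_self, zero_add]; exact hP.th_eta_ne_zero
    · exact (condInh_th hP hξ hij).2.1
  have hηt : P.th (P.t₀ - P.η) ≠ 0 := by
    simpa [← sub_eq_add_neg] using hP.th_t₀_add_ne_zero (-1)
  -- The order is 2N+2: the test points are ξ_j, ξ_j - η and the two zeros μ - t₀, μ - η of `denom`,
  -- pairwise incongruent by the conditions on ξ, μ and t₀.
  refine QP.eq_zero_of_vanish hP.im_pos (Finset.univ : Finset (Fin N ⊕ Fin N ⊕ Fin 2))
    (Sum.elim P.ξ (Sum.elim (fun j => P.ξ j - P.η) ![μ - P.t₀, μ - P.η])) ?_ ?_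
    ((P.qp_tqLhs hP.im_pos μ hqp r).sub (P.qp_tqRhs hP.im_pos μ β r)) ?_ ?_ u
  · rintro (i | i | i) - (j | j | j) - hij
    · exact hmem (condInh_th hP hξ (by simpa using hij)).1 (Or.inl (by simp))
    · exact hmem (hηξ i j) (Or.inl (by simp; ring))
    · have h := condMu_th hP hμ i
      fin_cases j
      · exact hmem h.2.2.1 (Or.inl (by simp; ring))
      · exact hmem h.2.1 (Or.inl (by simp; ring))
    · exact hmem (hηξ j i) (Or.inr (by simp; ring))
    · exact hmem (condInh_th hP hξ (by simpa using hij)).1 (Or.inl (by simp))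
    · have h := condMu_th hP hμ i
      fin_cases j
      · exact hmem h.2.2.2 (Or.inl (by simp; ring))
      · exact hmem h.1 (Or.inl (by simp))
    · have h := condMu_th hP hμ j
      fin_cases i
      · exact hmem h.2.2.1 (Or.inr (by simp; ring))
      · exact hmem h.2.1 (Or.inr (by simp; ring))
    · have h := condMu_th hP hμ j
      fin_cases i
      · exact hmem h.2.2.2 (Or.inr (by simp; ring))
      · exact hmem h.1 (Or.inr (by simp))
    · fin_cases i <;> fin_cases j
      · simp at hij
      · exact hmem hηt (Or.inr (by simp))
      · exact hmem hηt (Or.inl (by simp))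
      · simp at hij
  · simp; ring
  · rintro (j | j | j) -
    · exact sub_eq_zero.mpr ((tq_at_xi hP hξ hβ hμ t r j).mpr (hr j))
    · refine sub_eq_zero.mpr ((tq_at_xi_sub hP hμ t r j).mpr ?_)
      obtain ⟨h1, h2, h3, h4⟩ := condMu_th hP hμ j
      have ha := bigAxy_xi_ne_zero hP hξ j
      simp only [hr j, ratio]
      field_simp
      linear_combination P.Q r (P.ξ j) * hf j
    -- At a zero of `denom` the left side vanishes, and `constA` and `constB` are the constants for
    -- which the right side does too.
    · obtain ⟨hd, ha⟩ : P.bigD (μ - P.t₀) ≠ 0 ∧ P.bigA (μ - P.η) ≠ 0 := by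
        constructor
        · rw [bigD_eq_Q]
          refine Finset.prod_ne_zero_iff.mpr fun j _ h => ?_
          exact (hμ j).2.2.1 (hP.th_eq_zero_iff.mp h)
        · refine Finset.prod_ne_zero_iff.mpr fun j _ h => ?_
          rw [wa, sub_right_comm, sub_add_cancel] at h
          exact (hμ j).1 (hP.th_eq_zero_iff.mp h)
      have t0 : P.th 0 = 0 := theta_zero _
      fin_cases j
      · simp only [Fin.zero_eta, Sum.elim_inr, Matrix.cons_val_zero, denom, tqRhs, constA,
          neg_add_cancel, t0, mul_zero, zero_mul, add_zero, zero_sub,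
          show μ - P.t₀ - μ = -P.t₀ by ring, show -P.t₀ - P.X r = -(P.t₀ + P.X r) by ring, th_neg,
          show μ - P.t₀ - P.η = μ - P.η - P.t₀ by ring]
        field_simp
        ring
      · simp only [Fin.mk_one, Sum.elim_inr, Matrix.cons_val_one, Matrix.cons_val_fin_one, denom,
          tqRhs, constB,
          show μ - P.η - μ + P.η = 0 by ring, t0, mul_zero, zero_mul, zero_add, zero_sub,
          sub_add_cancel]
        field_simp
        ring
  -- The defect in the sum of the zeros is yπω - t₀ - X, so the requirement t₀ + X ∉ Γ is just what
  -- uniqueness needs.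
  · refine hmem hX' (Or.inl ?_)
    simp [X, t₀]
    ring

end Params

/-! ### Existence of Bethe roots. -/

namespace Params

variable {N : ℕ} {P : Params N}

/-- The conditions on the Bethe roots at the inhomogeneities. -/
structure Roots (P : Params N) (g : Fin N → ℂ) (β : ℂ) (r : Fin N → ℂ) : Prop where
  ne : P.th (P.t₀ + P.X r) ≠ 0
  Q_ne : ∀ j, P.Q r (P.ξ j) ≠ 0
  eq : ∀ j, P.Q r (P.ξ j - P.η) = β * g j * P.Q r (P.ξ j)

lemma Roots.hasQ (hP : P.Admissible) (hξ : P.CondInh) {μ β : ℂ} (hβ : β ≠ 0)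
    (hμ : P.CondMu μ) {t : ℂ → ℂ} (ht : P.Fused t) {r : Fin N → ℂ}
    (hr : P.Roots (P.ratio μ t) β r) : P.HasQ μ β t :=
  ⟨r, fun j h => hr.Q_ne j h.1, solvesTQ_of_roots hP hξ hβ hμ ht hr.ne hr.eq⟩

/-- The map from Bethe roots to the values of the Baxter equation is open at `ξ - η`. -/
lemma map_nhds_roots (hP : P.Admissible) (hξ : P.CondInh) :
    map (fun (r : Fin N → ℂ) j => P.Q r (P.ξ j - P.η) / P.Q r (P.ξ j))
      (𝓝 fun j => P.ξ j - P.η) = 𝓝 0 := by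
  have hθ : ContDiff ℂ 1 P.th := (differentiable_theta hP.im_pos).contDiff
  set r₀ : Fin N → ℂ := fun j => P.ξ j - P.η with hr₀
  -- The j-th component is θ(ξ_j - η - r_j) H_j, whose first factor vanishes at the base point and
  -- depends on r_j alone. So the Jacobian there is diagonal.
  set H : Fin N → (Fin N → ℂ) → ℂ := fun j r =>
    (∏ i ∈ Finset.univ.erase j, P.th (P.ξ j - P.η - r i)) / P.Q r (P.ξ j) with hH
  have hQ0 : ∀ j, P.Q r₀ (P.ξ j) ≠ 0 := fun j => by
    rw [hr₀, ← bigA_eq_Q]; exact bigA_xi_ne_zero hP hξ j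
  have hH0 : ∀ j, H j r₀ ≠ 0 := fun j => div_ne_zero (Finset.prod_ne_zero_iff.mpr fun i hi => by
    rw [hr₀, sub_sub_sub_cancel_right]
    exact (condInh_th hP hξ (Finset.ne_of_mem_erase hi).symm).1) (hQ0 j)
  have hfac : ∀ j r, P.Q r (P.ξ j - P.η) / P.Q r (P.ξ j) =
      P.th (P.ξ j - P.η - r j) * H j r := fun j r => by
    rw [hH, Q, ← Finset.mul_prod_erase _ _ (Finset.mem_univ j), mul_div_assoc]
  have hHd : ∀ j, ContDiffAt ℂ 1 (H j) r₀ := fun j => by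
    refine ContDiffAt.div ?_ ?_ (hQ0 j)
    · exact (contDiff_prod fun i _ => hθ.comp (by fun_prop)).contDiffAt
    · exact (contDiff_prod fun i _ => hθ.comp (by fun_prop)).contDiffAt
  have hz : ∀ j, P.th (P.ξ j - P.η - r₀ j) = 0 := fun j => by
    rw [hr₀, sub_self]; exact theta_zero _
  have hd0 : deriv P.th 0 ≠ 0 := deriv_theta_ne_zero hP.im_pos (theta_zero _)
  have hder : ∀ j, HasStrictFDerivAt (fun r : Fin N → ℂ => P.th (P.ξ j - P.η - r j) * H j r)
      ((-(H j r₀ * deriv P.th 0)) • ContinuousLinearMap.proj j : (Fin N → ℂ) →L[ℂ] ℂ) r₀ := by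
    intro j
    have h1 : HasStrictDerivAt P.th (deriv P.th 0) (P.ξ j - P.η - r₀ j) := by
      rw [hr₀, sub_self]
      exact hθ.contDiffAt.hasStrictDerivAt (by simp)
    have h2 : HasStrictFDerivAt (fun r : Fin N → ℂ => P.ξ j - P.η - r j)
        (-ContinuousLinearMap.proj j : (Fin N → ℂ) →L[ℂ] ℂ) r₀ :=
      (ContinuousLinearMap.proj (R := ℂ) (φ := fun _ : Fin N => ℂ) j).hasStrictFDerivAt.const_sub _
    have h3 := (h1.comp_hasStrictFDerivAt r₀ h2).mul
      ((hHd j).hasStrictFDerivAt (by simp))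
    refine h3.congr_fderiv (ContinuousLinearMap.ext fun v => ?_)
    simp [hz]
    ring
  have hpi : HasStrictFDerivAt
      (fun (r : Fin N → ℂ) j => P.Q r (P.ξ j - P.η) / P.Q r (P.ξ j))
      (ContinuousLinearMap.pi fun j =>
        (-(H j r₀ * deriv P.th 0)) • ContinuousLinearMap.proj j : (Fin N → ℂ) →L[ℂ] _) r₀ := by
    simp_rw [hfac]
    exact hasStrictFDerivAt_pi.mpr hder
  -- The diagonal entries -H_j θ'(0) are nonzero because theta has a simple zero at the origin, so
  -- the map is open at the base point.
  rw [hpi.map_nhds_eq_of_surj]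
  · congr 1
    funext j
    rw [hfac, hz, zero_mul, Pi.zero_apply]
  · refine LinearMap.range_eq_top.mpr fun v => ⟨fun j => -(v j / (H j r₀ * deriv P.th 0)), ?_⟩
    funext j
    have := hH0 j
    simp
    field_simp

/-- Bethe roots exist for small `β`. -/
lemma eventually_roots (hP : P.Admissible) (hξ : P.CondInh) (g : Fin N → ℂ) :
    ∀ᶠ β in 𝓝 (0 : ℂ), ∃ r, P.Roots g β r := by
  have hθ : Continuous P.th := (differentiable_theta hP.im_pos).continuous
  set r₀ : Fin N → ℂ := fun j => P.ξ j - P.η with hr₀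
  have e1 : ∀ᶠ r in 𝓝 r₀, P.th (P.t₀ + P.X r) ≠ 0 := by
    refine ContinuousAt.eventually_ne (Continuous.continuousAt ?_) ?_
    · unfold X
      fun_prop
    · have : P.X r₀ = 0 := by simp [X, hr₀]
      rw [this, add_zero]
      exact hP.th_t₀_ne_zero
  have e2 : ∀ᶠ r in 𝓝 r₀, ∀ j, P.Q r (P.ξ j) ≠ 0 := by
    refine eventually_all.mpr fun j => ContinuousAt.eventually_ne (Continuous.continuousAt ?_) ?_
    · unfold Q
      fun_prop
    · rw [hr₀, ← bigA_eq_Q]; exact bigA_xi_ne_zero hP hξ j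
  have h1 := image_mem_map (m := fun (r : Fin N → ℂ) j => P.Q r (P.ξ j - P.η) / P.Q r (P.ξ j))
    (e1.and e2)
  rw [map_nhds_roots hP hξ] at h1
  -- For small β the target vector β g lies in the image of roots near ξ - η, where X is near 0 and
  -- Q(ξ_j) is nonzero.
  have h2 : Tendsto (fun β : ℂ => β • g) (𝓝 0) (𝓝 0) := by
    have : Continuous fun β : ℂ => β • g := by fun_prop
    simpa using this.tendsto 0
  filter_upwards [h2 h1] with β hβ
  obtain ⟨r, ⟨hr1, hr2⟩, hr3⟩ := hβ
  refine ⟨r, hr1, hr2, fun j => ?_⟩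
  have := congrFun hr3 j
  rw [div_eq_iff (hr2 j)] at this
  exact this

/-- Multiplication of the elliptic polynomial by an exponential. -/
lemma Roots.of_exp (hP : P.Admissible) {g : Fin N → ℂ} {β k c : ℂ} {r r' : Fin N → ℂ}
    (hr : P.Roots g β r) (hk : k ≠ 0) (hQ : ∀ u, P.Q r' u = k * exp (c * u) * P.Q r u)
    (hX : P.X r' - P.X r ∈ lattice P.ω) : P.Roots g (exp (-(c * P.η)) * β) r' where
  ne h := hr.ne <| by
    rw [hP.th_eq_zero_iff] at h ⊢
    convert add_mem_lattice h (neg_mem_lattice hX) using 1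
    ring
  Q_ne j := by
    rw [hQ]
    exact mul_ne_zero (mul_ne_zero hk (exp_ne_zero _)) (hr.Q_ne j)
  eq j := by
    rw [hQ, hQ, hr.eq, mul_sub, sub_eq_add_neg, exp_add]
    ring

lemma Q_update (hN : 0 < N) (r : Fin N → ℂ) : ∃ k : ℂ, k ≠ 0 ∧ ∀ u,
    P.Q (Function.update r ⟨0, hN⟩ (r ⟨0, hN⟩ - Real.pi * P.ω)) u =
      k * exp (-(2 * I) * u) * P.Q r u := by
  refine ⟨-exp (-(I * Real.pi * P.ω) + 2 * I * r ⟨0, hN⟩), neg_ne_zero.mpr (exp_ne_zero _),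
    fun u => ?_⟩
  rw [Q, Q, ← Finset.mul_prod_erase _ _ (Finset.mem_univ ⟨0, hN⟩),
    ← Finset.mul_prod_erase _ (fun j => P.th (u - r j)) (Finset.mem_univ ⟨0, hN⟩),
    Function.update_self, ← sub_add, th, theta_add_pi_mul,
    Finset.prod_congr rfl fun j hj => by rw [Function.update_of_ne (Finset.ne_of_mem_erase hj)],
    show -(I * Real.pi * P.ω) - 2 * I * (u - r ⟨0, hN⟩) =
      -(I * Real.pi * P.ω) + 2 * I * r ⟨0, hN⟩ + -(2 * I) * u by ring, exp_add]
  rw [th]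
  ring

lemma X_update (hN : 0 < N) (r : Fin N → ℂ) (a : ℂ) :
    P.X (Function.update r ⟨0, hN⟩ (r ⟨0, hN⟩ + a)) = P.X r + a := by
  rw [X, X, ← Finset.add_sum_erase _ _ (Finset.mem_univ ⟨0, hN⟩),
    ← Finset.add_sum_erase _ r (Finset.mem_univ ⟨0, hN⟩), Function.update_self,
    Finset.sum_congr rfl fun j hj => by rw [Function.update_of_ne (Finset.ne_of_mem_erase hj)]]
  ring

/-- Moving one root by -πω multiplies Q(u) by a constant times exp(-2iu), hence Q(u - η)/Q(u) by
exp(2iη), while X changes by a period. This needs at least one root. -/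
lemma exists_roots_exp (hP : P.Admissible) (hN : 0 < N) {g : Fin N → ℂ} {β : ℂ}
    (h : ∃ r, P.Roots g β r) : ∃ r, P.Roots g (exp (2 * I * P.η) * β) r := by
  obtain ⟨r, hr⟩ := h
  obtain ⟨k, hk, hQ⟩ := Q_update (P := P) hN r
  have := hr.of_exp hP hk hQ (by
    rw [sub_eq_add_neg (r _), X_update]
    exact ⟨0, -1, by push_cast; ring⟩)
  rw [neg_mul, neg_neg] at this
  exact ⟨_, this⟩

lemma exists_roots_exp_neg (hP : P.Admissible) (hN : 0 < N) {g : Fin N → ℂ} {β : ℂ}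
    (h : ∃ r, P.Roots g β r) : ∃ r, P.Roots g (exp (-(2 * I * P.η)) * β) r := by
  obtain ⟨r, hr⟩ := h
  obtain ⟨k, hk, hQ⟩ := Q_update (P := P) hN
    (Function.update r ⟨0, hN⟩ (r ⟨0, hN⟩ + Real.pi * P.ω))
  simp only [Function.update_self, Function.update_idem, add_sub_cancel_right,
    Function.update_eq_self] at hQ
  refine ⟨_, hr.of_exp hP (k := k⁻¹) (c := 2 * I)
    (r' := Function.update r ⟨0, hN⟩ (r ⟨0, hN⟩ + Real.pi * P.ω)) (inv_ne_zero hk)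
    (fun u => ?_) ?_⟩
  · rw [hQ, neg_mul, exp_neg]
    have := exp_ne_zero (2 * I * u)
    field_simp
  · rw [X_update]
    exact ⟨0, 1, by push_cast; ring⟩

/-- Some q^m β lies in the neighbourhood of 0 where roots exist; m steps of multiplication by q⁻¹
lead back to β. -/
lemma exists_roots_of_pow {g : Fin N → ℂ} {q : ℂ} (hq0 : q ≠ 0) (hq : ‖q‖ < 1)
    (hstep : ∀ β, (∃ r, P.Roots g β r) → ∃ r, P.Roots g (q⁻¹ * β) r)
    (hsmall : ∀ᶠ β in 𝓝 (0 : ℂ), ∃ r, P.Roots g β r) (β : ℂ) : ∃ r, P.Roots g β r := by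
  have ht : Tendsto (fun m : ℕ => q ^ m * β) atTop (𝓝 0) := by
    simpa using (tendsto_pow_atTop_nhds_zero_of_norm_lt_one hq).mul_const β
  obtain ⟨m, hm⟩ := (ht.eventually hsmall).exists
  have key : ∀ m, (∃ r, P.Roots g (q ^ m * β) r) → ∃ r, P.Roots g β r := by
    intro m
    induction m with
    | zero => simp
    | succ m ih =>
      intro h
      refine ih ?_
      convert hstep _ h using 3
      rw [pow_succ']
      field_simp
  exact key m hm

/-- Bethe roots exist for all `β`, if `η` is not real. -/
lemma exists_roots (hP : P.Admissible) (hξ : P.CondInh) (hN : 0 < N) (hη : P.η.im ≠ 0)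
    (g : Fin N → ℂ) (β : ℂ) : ∃ r, P.Roots g β r := by
  -- The modulus of exp(2iη) is exp(-2 Im η); the sign of Im η decides which of the two shifts
  -- provides the contraction q.
  rcases hη.lt_or_gt with h | h
  · refine exists_roots_of_pow (q := exp (-(2 * I * P.η))) (exp_ne_zero _) ?_ (fun β hβ => ?_)
      (eventually_roots hP hξ g) β
    · rw [norm_exp, Real.exp_lt_one_iff]
      simp
      linarith
    · rw [← exp_neg, neg_neg]
      exact exists_roots_exp hP hN hβ
  · refine exists_roots_of_pow (q := exp (2 * I * P.η)) (exp_ne_zero _) ?_ (fun β hβ => ?_)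
      (eventually_roots hP hξ g) β
    · rw [norm_exp, Real.exp_lt_one_iff]
      simp [h]
    · rw [← exp_neg]
      exact exists_roots_exp_neg hP hN hβ

lemma Admissible.eta_ne_zero (hP : P.Admissible) : P.η ≠ 0 := fun h =>
  hP.generic 1 one_ne_zero (by rw [h, mul_zero]; exact zero_mem_lattice)

end Params

end SOS
theorem mainTheorem10 (N : ℕ) (hN : 1 ≤ N) (P : SOS.Params N) (hP : P.Admissible)
    (hξ : P.CondInh) (μ : ℂ) (hμ : P.CondMu μ) (κ : ℂ) (hκ : κ ≠ 0) (t : ℂ → ℂ) :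
    (t ∈ P.spectrumT κ ↔
      Differentiable ℂ t ∧ ∃ β : ℂ, β ≠ 0 ∧ P.HasQ μ β t) ∧
    (P.η.im ≠ 0 →
      (t ∈ P.spectrumT κ ↔
        Differentiable ℂ t ∧ ∀ β : ℂ, β ≠ 0 → P.HasQ μ β t)) := by
  rw [P.mem_spectrumT_iff hP.eta_ne_zero hκ, SOS.Params.exists_eigenvector_iff hP hξ]
  refine ⟨⟨fun ht => ⟨ht.1.diff, ?_⟩, fun ⟨hd, β, hβ, h⟩ =>
    SOS.Params.fused_of_hasQ hP hξ hβ hμ hd h⟩, fun hη => ⟨fun ht => ⟨ht.1.diff, fun β hβ => ?_⟩,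
    fun ⟨hd, h⟩ => SOS.Params.fused_of_hasQ hP hξ one_ne_zero hμ hd (h 1 one_ne_zero)⟩⟩
  · have hsmall := SOS.Params.eventually_roots hP hξ (P.ratio μ t)
    -- Solvability holds in a full neighbourhood of 0, so a nonzero β can be taken from the
    -- punctured one.
    obtain ⟨β, ⟨r, hr⟩, hβ⟩ := ((hsmall.filter_mono nhdsWithin_le_nhds).and
      (self_mem_nhdsWithin : {0}ᶜ ∈ nhdsWithin (0 : ℂ) {0}ᶜ)).exists
    exact ⟨β, hβ, hr.hasQ hP hξ hβ hμ ht⟩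
  · obtain ⟨r, hr⟩ := SOS.Params.exists_roots hP hξ hN hη (P.ratio μ t) β
    exact hr.hasQ hP hξ hβ hμ ht
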